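/- **Corollary 3.1 (Comparison Principle).** Let $d\ge 1$, $0<T<\infty$, $\alpha\in(0,1)$, and let $F\in W^{1,\infty}_{loc}(\mathbb R;\mathbb R^d)$, $A\in W^{1,1}_{loc}(\mathbb R)$, $B\in W^{1,\infty}_{loc}(\mathbb R)$ (continuous representatives) with a.e. derivatives $f=F'$, $A'$, $b=B'$. Suppose $A(0)=0$, $B(0)=0$, $b\ge 0$ a.e., $b\in L^\infty(\mathbb R)$, and that there are $M_1,M_2\in\mathbb R$ with $A'(v)\le M_1$ for a.e. $v>0$ and $-M_2\le A'(v)\le M_1$ for a.e. $v\le 0$. Consider $$\partial_t\rho+\operatorname{div}F(\rho)+(-\Delta)^{\alpha/2}B(\rho)=A(\rho)\ \text{ in }(0,T)\times\mathbb R^d,\qquad \rho(0)=\rho_0, \tag{1}$$ where $$(-\Delta)^{\alpha/2}g(x)=c(d,\alpha)\int_{\mathbb R^d}\frac{g(x)-g(x+z)}{|z|^{d+\alpha}}\,dz,\qquad c(d,\alpha)=\frac{\alpha\,2^{\alpha-1}\pi^{-d/2}\,\Gamma(\frac{d+\alpha}{2})}{\Gamma(\frac{2-\alpha}{2})}.$$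 *Kinetic solutions.* Put $\chi_r(v)=1_{(0,r)}(v)-1_{(r,0)}(v)$. For $\rho_0\in L^1\cap BV(\mathbb R^d)$, a function $\rho\in C([0,T];L^1(\mathbb R^d))\cap L^\infty([0,T);BV(\mathbb R^d))$ is a *kinetic solution* of (1) if there is a nonnegative measure $m$ on $[0,T)\times\mathbb R^d\times\mathbb R$ such that, with the nonnegative measure $n(t,x,v)\,dt\,dx\,dv$ on $(0,T)\times\mathbb R^d\times\mathbb R$ given by $$n(t,x,v)=\tfrac12\Big[\operatorname{sgn}(\rho(t,x)-v)\,(-\Delta)^{\alpha/2}B(\rho)(t,x)-(-\Delta)^{\alpha/2}|B(\rho)-B(v)|(t,x)\Big],$$ the function $u(t,x,v)=\chi_{\rho(t,x)}(v)$ satisfies $$\partial_tu+f(v)\cdot\nabla_xu+A(v)\,\partial_vu+b(v)(-\Delta_x)^{\alpha/2}u=\partial_v(m+n),\qquad u(0,x,v)=\chi_{\rho_0(x)}(v),$$ in $\mathcal D'([0,T)\times\mathbb R^{d+1})$, and the marginal $\int_0^T\!\int_{\mathbb R^d}(m+n)(dt,dx,\cdot)$ of $m+n$ in $v$ has a density with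 respect to Lebesgue measure that is essentially bounded and tends (essentially) to $0$ as $v\to\pm\infty$. *Claim.* Let $\rho_{0,1},\rho_{0,2}\in L^1\cap BV(\mathbb R^d)$ and let $\rho_1,\rho_2$ be kinetic solutions of (1) with initial values $\rho_{0,1}$ and $\rho_{0,2}$ respectively. Then for every $t\in[0,T]$ $$\|\rho_1(t)-\rho_2(t)\|_{L^1(\mathbb R^d)}\le e^{M_1t}\,\|\rho_{0,1}-\rho_{0,2}\|_{L^1(\mathbb R^d)}.$$ If $\rho_{0,1}\le\rho_{0,2}$ a.e., then $\rho_1(t)\le\rho_2(t)$ a.e. for every $t\in[0,T]$. In particular, if $\rho_0\in L^1\cap BV(\mathbb R^d)$ is nonnegative a.e., then every kinetic solution $\rho$ of (1) with initial value $\rho_0$ satisfies $\rho(t)\ge 0$ a.e. for every $t\in[0,T]$. -/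

import Mathlib

open MeasureTheory Set Filter Topology
open scoped ENNReal NNReal ContDiff

namespace NonlocalKinetic

noncomputable section

/-- Euclidean space `ℝᵈ`. -/
abbrev E (d : ℕ) : Type := EuclideanSpace ℝ (Fin d)

/-- The divergence of a vector field on `ℝᵈ`. -/
def divergence {d : ℕ} (φ : E d → E d) (x : E d) : ℝ :=
  ∑ i : Fin d, (fderiv ℝ φ x (EuclideanSpace.single i 1)) i

/-- The total variation of `g` on `ℝᵈ`: the supremum of `∫ g div φ` over all smooth compactly
supported vector fields `φ` with `|φ| ≤ 1`. -/
def totalVariation {d : ℕ} (g : E d → ℝ) : ℝ≥0∞ :=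
  ⨆ φ : {φ : E d → E d // ContDiff ℝ ∞ φ ∧ HasCompactSupport φ ∧ ∀ x, ‖φ x‖ ≤ 1},
    ENNReal.ofReal (∫ x, g x * divergence φ.1 x)

/-- `g ∈ L¹ ∩ BV(ℝᵈ)`. -/
def MemL1BV {d : ℕ} (g : E d → ℝ) : Prop :=
  Integrable g ∧ totalVariation g < ⊤

/-- The constant `c(d, α)` of the fractional Laplacian. -/
def fracConst (d : ℕ) (α : ℝ) : ℝ :=
  α * (2 : ℝ) ^ (α - 1) * Real.pi ^ (-(d : ℝ) / 2) * Real.Gamma (((d : ℝ) + α) / 2) /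
    Real.Gamma ((2 - α) / 2)

/-- The fractional Laplacian `(-Δ)^{α/2} g (x)` for `0 < α < 1`. For `g` smooth with compact
support the integral converges absolutely at every `x`, and for `g ∈ L¹ ∩ BV` (up to an additive
constant) at almost every `x`. -/
def fracLap {d : ℕ} (α : ℝ) (g : E d → ℝ) (x : E d) : ℝ :=
  fracConst d α * ∫ z : E d, (g x - g (z + x)) / ‖z‖ ^ ((d : ℝ) + α)

/-- The kinetic function `χ_r(v) = 1_{(0,r)}(v) - 1_{(r,0)}(v)`. -/
def chi (r v : ℝ) : ℝ :=
  (Ioo 0 r).indicator (fun _ => (1 : ℝ)) v - (Ioo r 0).indicator (fun _ => (1 : ℝ)) v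

/-- The density
`n(t,x,v) = (sgn(ρ(t,x) - v) (-Δ)^{α/2} B(ρ(t,x)) - (-Δ)^{α/2} |B(ρ(t,x)) - B(v)|) / 2`. -/
def defectDensity {d : ℕ} (α : ℝ) (B : ℝ → ℝ) (ρ : ℝ → E d → ℝ) (p : ℝ × E d × ℝ) : ℝ :=
  (Real.sign (ρ p.1 p.2.1 - p.2.2) * fracLap α (fun y => B (ρ p.1 y)) p.2.1 -
    fracLap α (fun y => |B (ρ p.1 y) - B p.2.2|) p.2.1) / 2

/-- The domain `(0,T) × ℝᵈ × ℝ` of the kinetic equation. -/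
def kineticDomain (d : ℕ) (T : ℝ) : Set (ℝ × E d × ℝ) :=
  Ioo 0 T ×ˢ univ

/-- The measure `n(t,x,v) dt dx dv` on `(0,T) × ℝᵈ × ℝ`. (For monotone `B` its density is
nonnegative wherever the two singular integrals converge.) -/
def defectMeasure {d : ℕ} (α T : ℝ) (B : ℝ → ℝ) (ρ : ℝ → E d → ℝ) : Measure (ℝ × E d × ℝ) :=
  (volume.restrict (kineticDomain d T)).withDensity
    (fun p => ENNReal.ofReal (defectDensity α B ρ p))

/-- `g ∈ L^∞_0(ℝ)`: `g` is essentially bounded and tends (essentially) to `0` at `±∞`. -/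
def MemLinftyZero (g : ℝ → ℝ≥0∞) : Prop :=
  Measurable g ∧ (∃ C : ℝ≥0, ∀ᵐ v, g v ≤ C) ∧
    ∀ ε : ℝ≥0, 0 < ε → ∃ R : ℝ, ∀ᵐ v, R < |v| → g v ≤ ε

/-- Test functions on `[0,T) × ℝᵈ × ℝ` (restrictions of smooth functions with compact support in
`(-∞,T) × ℝᵈ × ℝ`); they need not vanish at `t = 0`. -/
def IsTestFunction {d : ℕ} (T : ℝ) (φ : ℝ × E d × ℝ → ℝ) : Prop :=
  ContDiff ℝ ∞ φ ∧ HasCompactSupport φ ∧ tsupport φ ⊆ Iio T ×ˢ univ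

/-- The formal adjoint of `∂ₜ + f(v)·∇ₓ + A(v)∂ᵥ + b(v)(-Δₓ)^{α/2}`, up to sign, applied to `φ`,
where `f = F'`, `b = B'`:
`∂ₜφ + f(v)·∇ₓφ + ∂ᵥ(A(v) φ) - b(v) (-Δₓ)^{α/2} φ`. -/
def adjointOp {d : ℕ} (α : ℝ) (F : ℝ → E d) (A B : ℝ → ℝ) (φ : ℝ × E d × ℝ → ℝ)
    (p : ℝ × E d × ℝ) : ℝ :=
  deriv (fun s => φ (s, p.2.1, p.2.2)) p.1
    + fderiv ℝ (fun y => φ (p.1, y, p.2.2)) p.2.1 (deriv F p.2.2)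
    + (deriv A p.2.2 * φ p + A p.2.2 * deriv (fun w => φ (p.1, p.2.1, w)) p.2.2)
    - deriv B p.2.2 * fracLap α (fun y => φ (p.1, y, p.2.2)) p.2.1

/-- `u = χ_ρ` solves, in `𝒟'([0,T) × ℝᵈ × ℝ)`,
`∂ₜu + f(v)·∇ₓu + A(v)∂ᵥu + b(v)(-Δₓ)^{α/2}u = ∂ᵥμ` with `u(t=0) = χ_{ρ₀}`. -/
def SolvesKineticEq {d : ℕ} (α T : ℝ) (F : ℝ → E d) (A B : ℝ → ℝ) (ρ₀ : E d → ℝ)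
    (ρ : ℝ → E d → ℝ) (μ : Measure (ℝ × E d × ℝ)) : Prop :=
  ∀ φ : ℝ × E d × ℝ → ℝ, IsTestFunction T φ →
    (∫ p in kineticDomain d T, chi (ρ p.1 p.2.1) p.2.2 * adjointOp α F A B φ p)
      + (∫ q : E d × ℝ, chi (ρ₀ q.1) q.2 * φ (0, q.1, q.2))
      = ∫ p, deriv (fun w => φ (p.1, p.2.1, w)) p.2.2 ∂μ

/-- `ρ` is a kinetic solution on `[0,T]` of
`∂ₜρ + div F(ρ) + (-Δ)^{α/2} B(ρ) = A(ρ)`, `ρ(0) = ρ₀`. Functions of `(t,x)` are given by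
jointly measurable representatives; only the values for `t ∈ [0,T]` matter. -/
structure IsKineticSolution {d : ℕ} (α T : ℝ) (F : ℝ → E d) (A B : ℝ → ℝ) (ρ₀ : E d → ℝ)
    (ρ : ℝ → E d → ℝ) : Prop where
  measurable : Measurable (Function.uncurry ρ)
  /-- `ρ(t) ∈ L¹(ℝᵈ)` for every `t ∈ [0,T]`. -/
  integrable : ∀ t ∈ Icc 0 T, Integrable (ρ t)
  /-- `ρ ∈ C([0,T]; L¹(ℝᵈ))`. -/
  continuous : ∀ t ∈ Icc 0 T,
    Tendsto (fun s => eLpNorm (ρ s - ρ t) 1 volume) (𝓝[Icc 0 T] t) (𝓝 0)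
  /-- `ρ ∈ L^∞([0,T); BV(ℝᵈ))`. -/
  bounded_variation : ∃ C : ℝ≥0, ∀ᵐ t, t ∈ Ico 0 T → totalVariation (ρ t) ≤ C
  /-- There is a nonnegative measure `m` on `[0,T) × ℝᵈ × ℝ` such that the kinetic equation holds
  with right-hand side `∂ᵥ(m + n)`, and `v ↦ ∫₀ᵀ∫ (m + n)(dt,dx,v)` belongs to `L^∞_0(ℝ)`. -/
  kinetic : ∃ m : Measure (ℝ × E d × ℝ), m (Ico 0 T ×ˢ univ)ᶜ = 0 ∧
    SolvesKineticEq α T F A B ρ₀ ρ (m + defectMeasure α T B ρ) ∧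
    ∃ g : ℝ → ℝ≥0∞, MemLinftyZero g ∧
      (m + defectMeasure α T B ρ).map (fun p => p.2.2) = volume.withDensity g

end

end NonlocalKinetic

namespace NonlocalKinetic

noncomputable section

/-! The argument is Kruzhkov's doubling of variables, run on the kinetic formulation.

Pair the kinetic equation with θ(t)ψ(x)η(v). Integration against χ_ρ in v takes the primitive that
vanishes at 0, so the local terms become an entropy of ρ, its flux and the source A(ρ)η(ρ), while
the diffusion becomes (-Δ)^{α/2}β(ρ) with β' = ηb. The density n is exactly the defect in the chain
rule: ∫ η' n dv = η(ρ)(-Δ)^{α/2}B(ρ) - (-Δ)^{α/2}β(ρ). Hence β disappears, the diffusion enters as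
η(ρ)(-Δ)^{α/2}B(ρ), and only m is left as dissipation (`entropy_identity`). Since ρ is bounded in BV
and α < 1, (-Δ)^{α/2}B(ρ) is an honest integrable function
(`TranslationBounded.integrable_fracLap`), and the kernel never has to be split into a near and a
far part.

Take η = jH with j a monotone smooth step and H a cutoff in v. In (jH)' = j'H + jH' the first term
is nonnegative and can be dropped against m; the second costs at most ∫ |H'| dm. For a cutoff at
scale R, |H'| is of order 1/R on the shell R ≤ |v| ≤ 2R, whose mass is o(R) because the v-marginal
of m + n has a density tending to 0. So the cost vanishes in the limit
(`VanishingTail.tendsto_cutoff`). This yields truncated Kruzhkov inequalities for (ρ - k)⁺ and (k -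
ρ)⁺ (`EntropySolution.inequality`).

Freeze k = ρ₂(s,y) in the inequality for ρ₁ and k = ρ₁(t,x) in the one for ρ₂, with weight
θ(t)γ(t-s)κ(x-y), and add (`doubling_truncated`). Derivatives that fall on γ and κ cancel. The
diffusion has a favourable sign: the positive part is convex, and moving x and y by the same vector
leaves κ(x-y) unchanged (`integral_nonlocal_nonneg`). The source is bounded by the one-sided
Lipschitz bound M₁. One obstacle is that A has no lower growth bound on (0,∞), so that A(ρ) is not
obviously integrable; the entropy inequality with k = 0, together with Fatou, bounds its dissipative
part (`EntropySolution.integrable_source`).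

Concentrating γ and κ on the diagonal (`integral_diagonal_difference_le`) gives d/dt ∫ (ρ₁-ρ₂)⁺ ≤ M₁
∫ (ρ₁-ρ₂)⁺ weakly on (0,T). Gronwall and the attainment of the initial datum
(`EntropySolution.initial_eq`) give `comparison_positive_part`. The L¹ estimate is the sum of this
bound for both orders of the pair, order preservation is the case of vanishing right-hand side, and
nonnegativity is comparison with the zero solution. -/

/-! ### Duality: L¹ norm, total variation and translations. -/

/-- A smooth odd function with values in `[-1,1]` that fixes `-1`, `0` and `1`. -/
def softSign (x : ℝ) : ℝ := 2 * x / (1 + x ^ 2)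

lemma contDiff_softSign : ContDiff ℝ ∞ softSign := by
  unfold softSign
  exact (contDiff_const.mul contDiff_id).div (contDiff_const.add (contDiff_id.pow 2))
    fun x => by positivity

lemma abs_softSign_le_one (x : ℝ) : |softSign x| ≤ 1 := by
  have h : 0 < 1 + x ^ 2 := by positivity
  rw [softSign, abs_div, abs_of_pos h, div_le_one h, abs_le]
  constructor <;> nlinarith [sq_nonneg (x - 1), sq_nonneg (x + 1)]

lemma softSign_sign (x : ℝ) : softSign (Real.sign x) = Real.sign x := by
  rcases Real.sign_apply_eq x with h | h | h <;> rw [h] <;> norm_num [softSign]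

lemma abs_softSign_sub_le (x y : ℝ) : |softSign x - softSign y| ≤ 2 * |x - y| := by
  have hx : 0 < 1 + x ^ 2 := by positivity
  have hy : 0 < 1 + y ^ 2 := by positivity
  have e : softSign x - softSign y
      = 2 * ((1 - x * y) / ((1 + x ^ 2) * (1 + y ^ 2))) * (x - y) := by
    unfold softSign; field_simp; ring
  have h1 : |(1 - x * y) / ((1 + x ^ 2) * (1 + y ^ 2))| ≤ 1 := by
    rw [abs_div, abs_of_pos (mul_pos hx hy), div_le_one (mul_pos hx hy), abs_le]
    constructor <;>
      nlinarith [sq_nonneg (x - y), sq_nonneg (x + y), sq_nonneg (x * y), sq_nonneg x, sq_nonneg y]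
  rw [e, abs_mul, abs_mul, abs_two]
  nlinarith [abs_nonneg (x - y)]

/-- The `L¹` norm is the supremum over smooth compactly supported test functions bounded by one. -/
lemma integral_abs_le_of_forall_test {d : ℕ} {w : E d → ℝ} (hm : Measurable w) (hw : Integrable w)
    {C : ℝ} (h : ∀ φ : E d → ℝ, ContDiff ℝ ∞ φ → HasCompactSupport φ → (∀ x, |φ x| ≤ 1) →
      ∫ x, w x * φ x ≤ C) : ∫ x, |w x| ≤ C := by
  refine le_of_forall_pos_le_add fun ε hε => ?_
  -- The sign of w is approximated in L¹ of the finite measure |w| dx, so that approximation errors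
  -- come already weighted by |w|.
  set μ : Measure (E d) := volume.withDensity (fun x => (‖w x‖₊ : ℝ≥0∞)) with hμ
  have : IsFiniteMeasure μ := by
    refine ⟨?_⟩
    rw [hμ, withDensity_apply _ MeasurableSet.univ, Measure.restrict_univ]
    exact hw.2
  have hsm : Measurable Real.sign := by
    unfold Real.sign
    exact Measurable.ite measurableSet_Iio measurable_const
      (Measurable.ite measurableSet_Ioi measurable_const measurable_const)
  have hsle : ∀ r, |Real.sign r| ≤ 1 := fun r => by
    rcases Real.sign_apply_eq r with h | h | h <;> rw [h] <;> norm_num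
  have hsgn : MemLp (fun x => Real.sign (w x)) 1 μ :=
    MemLp.of_bound (hsm.comp hm).aestronglyMeasurable 1 (Eventually.of_forall fun x => hsle _)
  obtain ⟨φ, hφc, hφs, hφ⟩ := hsgn.exist_eLpNorm_sub_le ENNReal.one_ne_top le_rfl
    (show 0 < ε / 2 by positivity)
  have hφb : Integrable φ μ := by
    obtain ⟨K, hK⟩ := hφc.exists_bound_of_continuous hφs.continuous
    exact Integrable.of_bound hφs.continuous.aestronglyMeasurable K (Eventually.of_forall hK)
  have hdist : ∫ x, |Real.sign (w x) - φ x| ∂μ ≤ ε / 2 := by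
    have hi : Integrable (fun x => Real.sign (w x) - φ x) μ := (memLp_one_iff_integrable.1 hsgn).sub hφb
    have := ENNReal.toReal_mono ENNReal.ofReal_ne_top hφ
    rw [ENNReal.toReal_ofReal (by positivity), eLpNorm_one_eq_lintegral_enorm] at this
    exact (integral_norm_eq_lintegral_enorm hi.1).trans_le this
  -- The smooth approximation need not be bounded by one. Composing with `softSign` enforces this,
  -- keeps smoothness and compact support, and moves the values -1, 0, 1 nowhere; being 2-Lipschitz
  -- it only doubles the error ε/2.
  have hsφ : ContDiff ℝ ∞ (fun x => softSign (φ x)) := contDiff_softSign.comp hφs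
  have hsc : HasCompactSupport (fun x => softSign (φ x)) :=
    hφc.comp_left (g := softSign) (by simp [softSign])
  have h1 := h _ hsφ hsc fun x => abs_softSign_le_one _
  have hb1 : Integrable fun x => w x * softSign (φ x) :=
    hw.mul_bdd (c := 1) hsφ.continuous.aestronglyMeasurable
      (Eventually.of_forall fun x => abs_softSign_le_one _)
  have h2 : ∫ x, |w x| - w x * softSign (φ x) ≤ ε := by
    calc ∫ x, |w x| - w x * softSign (φ x)
        ≤ ∫ x, ‖w x‖₊ • (2 * |Real.sign (w x) - φ x|) := by
          refine integral_mono_ae (hw.abs.sub hb1) ?_ (Eventually.of_forall fun x => ?_)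
          · have := (((memLp_one_iff_integrable.1 hsgn).sub hφb).abs.const_mul 2)
            rw [hμ, integrable_withDensity_iff_integrable_smul hm.nnnorm] at this
            exact this
          · have e : |w x| = w x * softSign (Real.sign (w x)) := by
              rw [softSign_sign]
              rcases lt_trichotomy (w x) 0 with h | h | h
              · rw [Real.sign_of_neg h, abs_of_neg h, mul_neg_one]
              · simp [h]
              · rw [Real.sign_of_pos h, abs_of_pos h, mul_one]
            simp only [NNReal.smul_def, coe_nnnorm, smul_eq_mul, Real.norm_eq_abs]
            rw [e, ← mul_sub, ← e]
            calc w x * (softSign (Real.sign (w x)) - softSign (φ x))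
                ≤ |w x * (softSign (Real.sign (w x)) - softSign (φ x))| := le_abs_self _
              _ ≤ _ := by
                rw [abs_mul]
                exact mul_le_mul_of_nonneg_left (abs_softSign_sub_le _ _) (abs_nonneg _)
      _ = ∫ x, 2 * |Real.sign (w x) - φ x| ∂μ := by
          rw [hμ, integral_withDensity_eq_integral_smul hm.nnnorm]
      _ ≤ ε := by rw [integral_const_mul]; linarith
  rw [integral_sub hw.abs hb1] at h2
  linarith

lemma divergence_smul_const {d : ℕ} {φ : E d → ℝ} (hφ : Differentiable ℝ φ) (e x : E d) :
    divergence (fun y => φ y • e) x = fderiv ℝ φ x e := by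
  have h : ∀ v, fderiv ℝ (fun y => φ y • e) x v = fderiv ℝ φ x v • e := fun v => by
    rw [fderiv_smul_const (hφ x)]; rfl
  have he : e = ∑ i, e i • EuclideanSpace.single i (1 : ℝ) := by
    ext j; simp [Finset.sum_apply, Pi.single_apply]
  unfold divergence
  conv_rhs => rw [he, map_sum]
  refine Finset.sum_congr rfl fun i _ => ?_
  rw [h, map_smul]
  simp [mul_comm]

/-- Pairing an integrable function with a directional derivative of a test function is controlled
by the total variation. -/
lemma abs_integral_mul_fderiv_le {d : ℕ} {g : E d → ℝ} {C : ℝ≥0}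
    (hC : totalVariation g ≤ C) {φ : E d → ℝ} (hφ : ContDiff ℝ ∞ φ) (hc : HasCompactSupport φ)
    (hb : ∀ x, |φ x| ≤ 1) (h : E d) : |∫ x, g x * fderiv ℝ φ x h| ≤ C * ‖h‖ := by
  -- The fields φ e with |e| ≤ 1 are admissible in the definition of the total variation; the claim
  -- follows from e = ±h/|h|.
  have key : ∀ e : E d, ‖e‖ ≤ 1 → ∫ x, g x * fderiv ℝ φ x e ≤ C := fun e he => by
    have hψ : ContDiff ℝ ∞ (fun y => φ y • e) := hφ.smul contDiff_const
    have hψc : HasCompactSupport (fun y => φ y • e) := hc.smul_right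
    have hψb : ∀ x, ‖φ x • e‖ ≤ 1 := fun x => by
      rw [norm_smul]; exact mul_le_one₀ (hb x) (norm_nonneg _) he
    have := (le_iSup (fun φ : {φ : E d → E d // ContDiff ℝ ∞ φ ∧ HasCompactSupport φ ∧
      ∀ x, ‖φ x‖ ≤ 1} => ENNReal.ofReal (∫ x, g x * divergence φ.1 x)) ⟨_, hψ, hψc, hψb⟩).trans hC
    simp only [divergence_smul_const (hφ.differentiable (by simp))] at this
    have := ENNReal.toReal_mono ENNReal.coe_ne_top this
    rw [ENNReal.toReal_ofReal'] at this
    exact (le_max_left _ _).trans this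
  rcases eq_or_ne h 0 with rfl | hh
  · simp
  have hpos : 0 < ‖h‖ := norm_pos_iff.2 hh
  have hn : ‖‖h‖⁻¹ • h‖ ≤ 1 := by rw [norm_smul, norm_inv, norm_norm, inv_mul_cancel₀ hpos.ne']
  have hs : ∀ c : ℝ, ∫ x, g x * fderiv ℝ φ x (c • h) = c * ∫ x, g x * fderiv ℝ φ x h := fun c => by
    rw [← integral_const_mul]
    refine integral_congr_ae (Eventually.of_forall fun x => ?_)
    simp only [map_smul, smul_eq_mul]; ring
  have h1 := key _ hn
  have h2 := key (-(‖h‖⁻¹ • h)) (by rwa [norm_neg])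
  rw [← neg_smul, hs] at h2
  rw [hs] at h1
  rw [abs_le]
  constructor
  · have := mul_le_mul_of_nonneg_left h2 hpos.le
    rw [← mul_assoc, mul_neg, mul_inv_cancel₀ hpos.ne'] at this
    linarith
  · have := mul_le_mul_of_nonneg_left h1 hpos.le
    rw [← mul_assoc, mul_inv_cancel₀ hpos.ne'] at this
    linarith

/-- Translation estimate for functions of bounded variation. -/
lemma integral_abs_translate_sub_le {d : ℕ} {g : E d → ℝ} (hm : Measurable g) (hg : Integrable g)
    {C : ℝ≥0} (hC : totalVariation g ≤ C) (h : E d) :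
    ∫ x, |g (h + x) - g x| ≤ C * ‖h‖ := by
  have hgt : Integrable fun x => g (h + x) := hg.comp_add_left h
  refine integral_abs_le_of_forall_test ((hm.comp (measurable_const_add h)).sub hm) (hgt.sub hg)
    fun φ hφ hφc hφb => ?_
  obtain ⟨K, hK⟩ := hφc.exists_bound_of_continuous hφ.continuous
  have hφ1 : Differentiable ℝ φ := hφ.differentiable (by simp)
  have hd : Continuous (fderiv ℝ φ) := hφ.continuous_fderiv (by simp)
  obtain ⟨K', hK'⟩ := (hφc.fderiv (𝕜 := ℝ)).exists_bound_of_continuous hd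
  have hint : ∀ y : E d, Integrable fun x => g x * φ (x - y) := fun y =>
    hg.mul_bdd (c := K) (hφ.continuous.comp (continuous_id.sub continuous_const)).aestronglyMeasurable
      (Eventually.of_forall fun x => hK _)
  -- The pairing is Θ(1) - Θ(0), and Θ'(τ) pairs g with a directional derivative of a translate of
  -- φ. The mean value inequality then replaces any smoothing of g.
  set Θ : ℝ → ℝ := fun τ => ∫ x, g x * φ (x - τ • h) with hΘ
  have e : ∫ x, (g (h + x) - g x) * φ x = Θ 1 - Θ 0 := by
    have e1 : ∫ x, g (h + x) * φ x = Θ 1 := by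
      have := integral_add_left_eq_self (μ := volume) (fun x => g x * φ (x - (1 : ℝ) • h)) h
      simpa [hΘ] using this
    have i1 : Integrable fun x => g (h + x) * φ x :=
      hgt.mul_bdd (c := K) hφ.continuous.aestronglyMeasurable (Eventually.of_forall hK)
    have i2 : Integrable fun x => g x * φ x := by simpa using hint 0
    rw [← e1]
    simp only [hΘ, zero_smul, sub_zero, sub_mul]
    rw [integral_sub i1 i2]
  have hder : ∀ τ : ℝ, HasDerivAt Θ (∫ x, g x * fderiv ℝ φ (x - τ • h) (-h)) τ := fun τ => by
    refine (hasDerivAt_integral_of_dominated_loc_of_deriv_le (F := fun τ x => g x * φ (x - τ • h))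
      (F' := fun τ x => g x * fderiv ℝ φ (x - τ • h) (-h)) (bound := fun x => |g x| * (K' * ‖h‖))
      (s := univ) univ_mem
      (Eventually.of_forall fun τ => (hint _).1) (hint _) ?_ ?_ ?_ ?_).2
    · refine hg.1.mul (Continuous.aestronglyMeasurable ?_)
      exact (hd.comp (continuous_id.sub continuous_const)).clm_apply continuous_const
    · refine Eventually.of_forall fun x τ _ => ?_
      rw [norm_mul]
      refine mul_le_mul_of_nonneg_left ?_ (norm_nonneg _)
      exact (ContinuousLinearMap.le_opNorm _ _).trans (by
        rw [norm_neg]; exact mul_le_mul_of_nonneg_right (hK' _) (norm_nonneg _))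
    · exact hg.abs.mul_const _
    · refine Eventually.of_forall fun x τ _ => ?_
      have h1 : HasDerivAt (fun τ : ℝ => x - τ • h) (-h) τ := by
        simpa using ((hasDerivAt_id τ).smul_const h).const_sub x
      exact ((hφ1 _).hasFDerivAt.comp_hasDerivAt τ h1).const_mul (g x)
  have hbd : ∀ τ : ℝ, ‖∫ x, g x * fderiv ℝ φ (x - τ • h) (-h)‖ ≤ C * ‖h‖ := fun τ => by
    have := abs_integral_mul_fderiv_le hC (φ := fun x => φ (x - τ • h))
      (hφ.comp (contDiff_id.sub contDiff_const))
      (hφc.comp_homeomorph (Homeomorph.subRight (τ • h)))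
      (fun x => hφb _) (-h)
    simp only [fderiv_comp_sub, norm_neg] at this
    exact this
  change ∫ x, (g (h + x) - g x) * φ x ≤ _
  rw [e]
  have := norm_image_sub_le_of_norm_deriv_le_segment_01' (f := Θ) (C := C * ‖h‖)
    (fun τ _ => (hder τ).hasDerivWithinAt) (fun τ _ => hbd τ)
  exact (le_abs_self _).trans this

/-! ### Absolute convergence and symmetry of the fractional Laplacian. -/

/-- The singular weight `min(a, C|z|) / |z|^{d+α}` is integrable. -/
lemma integrable_min_div_rpow {d : ℕ} (hd : 0 < d) {α : ℝ} (hα : α ∈ Ioo (0 : ℝ) 1) {a C : ℝ}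
    (ha : 0 ≤ a) (hC : 0 ≤ C) :
    Integrable fun z : E d => min a (C * ‖z‖) / ‖z‖ ^ ((d : ℝ) + α) := by
  have : Nonempty (Fin d) := ⟨⟨0, hd⟩⟩
  have key := integrable_fun_norm_addHaar (volume : Measure (E d))
    (f := fun r : ℝ => min a (C * r) / r ^ ((d : ℝ) + α))
  refine key.2 ?_
  have hfr : Module.finrank ℝ (E d) = d := finrank_euclideanSpace_fin
  rw [hfr]
  have hmeas : Measurable fun r : ℝ => r ^ (d - 1) • (min a (C * r) / r ^ ((d : ℝ) + α)) := by
    simp only [smul_eq_mul]; fun_prop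
  have hval : ∀ r : ℝ, 0 < r → r ^ (d - 1) / r ^ ((d : ℝ) + α) = r ^ (-1 - α) := fun r hr => by
    rw [← Real.rpow_natCast, ← Real.rpow_sub hr]
    congr 1
    rw [Nat.cast_sub (by omega)]; push_cast; ring
  have h1 : IntegrableOn (fun r : ℝ => C * r ^ (-α)) (Ioc 0 1) := by
    refine Integrable.const_mul ?_ _
    have := intervalIntegral.intervalIntegrable_rpow' (a := 0) (b := 1) (r := -α) (by linarith [hα.2])
    rwa [intervalIntegrable_iff_integrableOn_Ioc_of_le zero_le_one] at this
  have h2 : IntegrableOn (fun r : ℝ => a * r ^ (-1 - α)) (Ioi 1) :=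
    (integrableOn_Ioi_rpow_of_lt (by linarith [hα.1]) zero_lt_one).const_mul _
  -- In polar coordinates the Lipschitz bound gives r^{-α} near 0, integrable because α < 1, and the
  -- constant bound gives r^{-1-α} at infinity, integrable because α > 0.
  rw [← Ioc_union_Ioi_eq_Ioi (zero_le_one' ℝ)]
  refine IntegrableOn.union ?_ ?_
  · refine Integrable.mono' h1 hmeas.aestronglyMeasurable ?_
    refine (ae_restrict_iff' measurableSet_Ioc).2 (Eventually.of_forall fun r hr => ?_)
    have hr0 : 0 < r := hr.1
    have hm : 0 ≤ min a (C * r) := le_min ha (by positivity)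
    rw [smul_eq_mul, mul_div_left_comm, hval r hr0, Real.norm_of_nonneg (by positivity)]
    have : r ^ (-α) = r * r ^ (-1 - α) := by
      rw [← Real.rpow_one_add' hr0.le (by linarith [hα.1])]; congr 1; ring
    rw [this, ← mul_assoc]
    exact mul_le_mul_of_nonneg_right (min_le_right _ _) (by positivity)
  · refine Integrable.mono' h2 hmeas.aestronglyMeasurable ?_
    refine (ae_restrict_iff' measurableSet_Ioi).2 (Eventually.of_forall fun r hr => ?_)
    have hr0 : 0 < r := zero_lt_one.trans hr
    have hm : 0 ≤ min a (C * r) := le_min ha (by positivity)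
    rw [smul_eq_mul, mul_div_left_comm, hval r hr0, Real.norm_of_nonneg (by positivity)]
    exact mul_le_mul_of_nonneg_right (min_le_left _ _) (by positivity)

lemma measurable_fracLap {β : Type*} [MeasurableSpace β] {d : ℕ} (α : ℝ) {u : β → E d → ℝ}
    (hu : Measurable (Function.uncurry u)) :
    Measurable fun p : β × E d => fracLap α (u p.1) p.2 := by
  have h1 : Measurable fun q : (β × E d) × E d => u q.1.1 q.1.2 :=
    hu.comp (measurable_fst.comp measurable_fst |>.prodMk (measurable_snd.comp measurable_fst))
  have h2 : Measurable fun q : (β × E d) × E d => u q.1.1 (q.2 + q.1.2) :=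
    hu.comp ((measurable_fst.comp measurable_fst).prodMk
      (measurable_snd.add (measurable_snd.comp measurable_fst)))
  have h3 : Measurable fun q : (β × E d) × E d => ‖q.2‖ ^ ((d : ℝ) + α) := by fun_prop
  exact (((h1.sub h2).div h3).stronglyMeasurable.integral_prod_right').measurable.const_mul _

/-- The strip `(0,T) × ℝᵈ` with Lebesgue measure. -/
def slab (d : ℕ) (T : ℝ) : Measure (ℝ × E d) := (volume.restrict (Ioo 0 T)).prod volume

instance (d : ℕ) (T : ℝ) : SFinite (slab d T) := by unfold slab; infer_instance

lemma integrable_slab_mul {d : ℕ} {T : ℝ} {θ : ℝ → ℝ} {ψ : E d → ℝ} (hθ : Integrable θ)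
    (hψ : Integrable ψ) : Integrable (fun p => θ p.1 * ψ p.2) (slab d T) :=
  hθ.restrict.mul_prod hψ

/-- A function on the strip with uniform (in time) bounds on its `L¹` norm in space and a Lipschitz
bound on its translates in space. -/
structure TranslationBounded {d : ℕ} (T M C : ℝ) (u : ℝ → E d → ℝ) : Prop where
  measurable : Measurable (Function.uncurry u)
  nonneg : 0 ≤ M ∧ 0 ≤ C
  bound : ∀ᵐ t ∂volume.restrict (Ioo 0 T), Integrable (u t) ∧ ∫ x, |u t x| ≤ M ∧
    ∀ z, ∫ x, |u t (z + x) - u t x| ≤ C * ‖z‖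

namespace TranslationBounded

variable {d : ℕ} {T M C : ℝ} {u : ℝ → E d → ℝ}

/-- Bounds on translates pass through Lipschitz maps without any chain rule in BV. This serves B(ρ)
as well as the primitives β(ρ) with β' = ηb. -/
lemma comp_lipschitz (hu : TranslationBounded T M C u) {Φ : ℝ → ℝ} {K : ℝ≥0}
    (hΦ : LipschitzWith K Φ) (h0 : Φ 0 = 0) :
    TranslationBounded T (K * M) (K * C) (fun t x => Φ (u t x)) where
  measurable := hΦ.continuous.measurable.comp hu.measurable
  nonneg := ⟨mul_nonneg K.2 hu.nonneg.1, mul_nonneg K.2 hu.nonneg.2⟩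
  bound := by
    have hl : ∀ r s, |Φ r - Φ s| ≤ K * |r - s| := fun r s => by
      simpa [Real.dist_eq] using hΦ.dist_le_mul r s
    filter_upwards [hu.bound] with t ⟨h1, h2, h3⟩
    have hlb : ∀ x, |Φ (u t x)| ≤ K * |u t x| := fun x => by simpa [h0] using hl (u t x) 0
    have hi : Integrable fun x => Φ (u t x) :=
      Integrable.mono' (h1.abs.const_mul K) (hΦ.continuous.comp_aestronglyMeasurable h1.1)
        (Eventually.of_forall hlb)
    refine ⟨hi, ?_, fun z => ?_⟩
    · calc _ ≤ ∫ x, K * |u t x| := integral_mono hi.abs (h1.abs.const_mul _) hlb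
        _ ≤ _ := by rw [integral_const_mul]; exact mul_le_mul_of_nonneg_left h2 K.2
    · calc _ ≤ ∫ x, K * |u t (z + x) - u t x| :=
            integral_mono ((hi.comp_add_left z).sub hi).abs
              (((h1.comp_add_left z).sub h1).abs.const_mul _) fun x => hl _ _
        _ ≤ _ := by
          rw [integral_const_mul, mul_assoc]; exact mul_le_mul_of_nonneg_left (h3 z) K.2

lemma integrable (hu : TranslationBounded T M C u) :
    Integrable (fun p => u p.1 p.2) (slab d T) := by
  refine (integrable_prod_iff hu.measurable.aestronglyMeasurable).2
    ⟨hu.bound.mono fun t h => h.1, ?_⟩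
  refine Integrable.of_bound
    (hu.measurable.norm.stronglyMeasurable.integral_prod_right').aestronglyMeasurable M ?_
  filter_upwards [hu.bound] with t h
  rw [Real.norm_of_nonneg (integral_nonneg fun _ => norm_nonneg _)]
  exact h.2.1

lemma measurable_translate (hu : TranslationBounded T M C u) :
    Measurable fun q : (ℝ × E d) × E d => u q.1.1 (q.2 + q.1.2) :=
  hu.measurable.comp ((measurable_fst.comp measurable_fst).prodMk
      (measurable_snd.add (measurable_snd.comp measurable_fst)))

lemma translate (hu : TranslationBounded T M C u) (z : E d) :
    TranslationBounded T M C (fun t x => u t (z + x)) where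
  measurable := hu.measurable.comp (measurable_fst.prodMk (measurable_snd.const_add z))
  nonneg := hu.nonneg
  bound := by
    filter_upwards [hu.bound] with t ⟨h1, h2, h3⟩
    refine ⟨h1.comp_add_left z, ?_, fun y => ?_⟩
    · rwa [integral_add_left_eq_self (fun x => |u t x|) z]
    · refine le_trans (le_of_eq ?_) (h3 y)
      rw [← integral_add_left_eq_self (fun x => |u t (y + x) - u t x|) z]
      simp only [add_left_comm]

/-- The triangle inequality handles large z, the translation bound small z; the minimum of the two
is the numerator in `integrable_min_div_rpow`. -/
lemma integral_abs_sub_le (hu : TranslationBounded T M C u) (hT : 0 < T) (z : E d) :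
    ∫ p, |u p.1 p.2 - u p.1 (z + p.2)| ∂slab d T ≤ T * min (2 * M) (C * ‖z‖) := by
  have hi := (hu.integrable.sub (hu.translate z).integrable).abs
  have e : ∫ p, |u p.1 p.2 - u p.1 (z + p.2)| ∂slab d T
      = ∫ t in Ioo 0 T, ∫ x, |u t x - u t (z + x)| := integral_prod _ hi
  have hc : ∫ _ in Ioo 0 T, min (2 * M) (C * ‖z‖) = T * min (2 * M) (C * ‖z‖) := by
    simp [hT.le]
  rw [e, ← hc]
  refine integral_mono_ae hi.integral_prod_left (integrable_const _) ?_
  filter_upwards [hu.bound] with t ⟨h1, h2, h3⟩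
  refine le_min ?_ ?_
  · calc _ ≤ ∫ x, |u t x| + |u t (z + x)| :=
          integral_mono (h1.sub (h1.comp_add_left z)).abs (h1.abs.add (h1.comp_add_left z).abs)
            fun x => abs_sub _ _
      _ = 2 * ∫ x, |u t x| := by
          rw [integral_add h1.abs (h1.comp_add_left z).abs,
            integral_add_left_eq_self (fun x => |u t x|) z]; ring
      _ ≤ _ := by linarith
  · simpa only [abs_sub_comm] using h3 z

/-- The double integral defining the fractional Laplacian converges absolutely. -/
lemma integrable_diff_div (hu : TranslationBounded T M C u) (hd : 0 < d) (hT : 0 < T) {α : ℝ}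
    (hα : α ∈ Ioo (0 : ℝ) 1) :
    Integrable (fun q : (ℝ × E d) × E d =>
      (u q.1.1 q.1.2 - u q.1.1 (q.2 + q.1.2)) / ‖q.2‖ ^ ((d : ℝ) + α))
      ((slab d T).prod volume) := by
  have hm : Measurable fun q : (ℝ × E d) × E d =>
      (u q.1.1 q.1.2 - u q.1.1 (q.2 + q.1.2)) / ‖q.2‖ ^ ((d : ℝ) + α) := by
    have h3 : Measurable fun q : (ℝ × E d) × E d => ‖q.2‖ ^ ((d : ℝ) + α) := by fun_prop
    exact ((hu.measurable.comp measurable_fst).sub hu.measurable_translate).div h3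
  have hz : ∀ z, Integrable (fun p => (u p.1 p.2 - u p.1 (z + p.2)) / ‖z‖ ^ ((d : ℝ) + α))
      (slab d T) := fun z => (hu.integrable.sub (hu.translate z).integrable).div_const _
  refine (integrable_prod_iff' hm.aestronglyMeasurable).2 ⟨Eventually.of_forall hz, ?_⟩
  have hb := (integrable_min_div_rpow hd hα (a := 2 * M) (C := C)
    (by linarith [hu.nonneg.1]) hu.nonneg.2).const_mul T
  refine hb.mono' (hm.norm.stronglyMeasurable.integral_prod_left').aestronglyMeasurable
    (Eventually.of_forall fun z => ?_)
  rw [Real.norm_of_nonneg (integral_nonneg fun _ => norm_nonneg _)]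
  have hz : 0 ≤ ‖z‖ ^ ((d : ℝ) + α) := by positivity
  simp only [norm_div, Real.norm_eq_abs, abs_of_nonneg hz]
  rw [integral_div, ← mul_div_assoc]
  exact div_le_div_of_nonneg_right (hu.integral_abs_sub_le hT z) hz

lemma ae_integrable_diff_div (hu : TranslationBounded T M C u) (hd : 0 < d) (hT : 0 < T) {α : ℝ}
    (hα : α ∈ Ioo (0 : ℝ) 1) : ∀ᵐ p ∂slab d T, Integrable fun z : E d =>
      (u p.1 p.2 - u p.1 (z + p.2)) / ‖z‖ ^ ((d : ℝ) + α) :=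
  (hu.integrable_diff_div hd hT hα).prod_right_ae

/-- The gain from BV and α < 1: the diffusion is an L¹ function on the strip and can be multiplied
by discontinuous bounded functions of ρ. -/
lemma integrable_fracLap (hu : TranslationBounded T M C u) (hd : 0 < d) (hT : 0 < T) {α : ℝ}
    (hα : α ∈ Ioo (0 : ℝ) 1) : Integrable (fun p => fracLap α (u p.1) p.2) (slab d T) :=
  (hu.integrable_diff_div hd hT hα).integral_prod_left.const_mul _

end TranslationBounded

lemma abs_sub_le_min {d : ℕ} {ψ : E d → ℝ} (hψ : ContDiff ℝ ∞ ψ)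
    (hc : HasCompactSupport ψ) : ∃ M C : ℝ, 0 ≤ M ∧ 0 ≤ C ∧ (∀ x, |ψ x| ≤ M) ∧
      ∀ x z, |ψ x - ψ (z + x)| ≤ min (2 * M) (C * ‖z‖) := by
  obtain ⟨M, hM⟩ := hc.exists_bound_of_continuous hψ.continuous
  obtain ⟨C, hC⟩ : ∃ C, LipschitzWith C ψ :=
    ContDiff.lipschitzWith_of_hasCompactSupport hc hψ (by simp)
  refine ⟨M, C, (norm_nonneg _).trans (hM 0), C.2, hM, fun x z => le_min ?_ ?_⟩
  · exact (abs_sub _ _).trans (by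
      have h1 := hM x; have h2 := hM (z + x); rw [Real.norm_eq_abs] at h1 h2; linarith)
  · simpa [Real.dist_eq, dist_eq_norm] using hC.dist_le_mul x (z + x)

lemma exists_bound_fracLap_test {d : ℕ} (hd : 0 < d) {α : ℝ} (hα : α ∈ Ioo (0 : ℝ) 1)
    {ψ : E d → ℝ} (hψ : ContDiff ℝ ∞ ψ) (hc : HasCompactSupport ψ) :
    ∃ K : ℝ, ∀ x, |fracLap α ψ x| ≤ K := by
  obtain ⟨M, C, hM, hC, -, h⟩ := abs_sub_le_min hψ hc
  refine ⟨|fracConst d α| * ∫ z : E d, min (2 * M) (C * ‖z‖) / ‖z‖ ^ ((d : ℝ) + α), fun x => ?_⟩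
  rw [fracLap, abs_mul, ← Real.norm_eq_abs (∫ _, _)]
  refine mul_le_mul_of_nonneg_left ?_ (abs_nonneg _)
  refine norm_integral_le_of_norm_le (integrable_min_div_rpow hd hα (a := 2 * M) (by linarith) hC)
    (Eventually.of_forall fun z => ?_)
  have hz : 0 ≤ ‖z‖ ^ ((d : ℝ) + α) := by positivity
  rw [norm_div, Real.norm_of_nonneg hz]
  exact div_le_div_of_nonneg_right (h x z) hz

lemma measurable_fracLap_test {d : ℕ} (α : ℝ) {ψ : E d → ℝ} (hψ : Continuous ψ) :
    Measurable (fracLap α ψ) := by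
  have := measurable_fracLap (β := Unit) α (u := fun _ => ψ) (hψ.measurable.comp measurable_snd)
  exact this.comp (measurable_const (a := ()) |>.prodMk measurable_id)

/-- The fractional Laplacian is symmetric. -/
lemma TranslationBounded.integral_mul_fracLap {d : ℕ} {T M C : ℝ} {u : ℝ → E d → ℝ}
    (hu : TranslationBounded T M C u) (hd : 0 < d) (hT : 0 < T) {α : ℝ} (hα : α ∈ Ioo (0 : ℝ) 1)
    {θ : ℝ → ℝ} {K : ℝ} (hθ : Measurable θ) (hK : ∀ t, |θ t| ≤ K)
    {ψ : E d → ℝ} (hψ : ContDiff ℝ ∞ ψ) (hc : HasCompactSupport ψ) :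
    ∫ p, θ p.1 * ψ p.2 * fracLap α (u p.1) p.2 ∂slab d T
      = ∫ p, θ p.1 * u p.1 p.2 * fracLap α ψ p.2 ∂slab d T := by
  obtain ⟨M', C', hM', hC', hψb, h⟩ := abs_sub_le_min hψ hc
  have hψm := hψ.continuous.measurable
  have hK0 : 0 ≤ K := (abs_nonneg _).trans (hK 0)
  have hθψb : ∀ p : ℝ × E d, ‖θ p.1 * ψ p.2‖ ≤ K * M' := fun p => by
    rw [norm_mul]; exact mul_le_mul (hK _) (hψb _) (norm_nonneg _) hK0
  have hi1 : Integrable (fun q : (ℝ × E d) × E d => θ q.1.1 * ψ q.1.2 *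
      ((u q.1.1 q.1.2 - u q.1.1 (q.2 + q.1.2)) / ‖q.2‖ ^ ((d : ℝ) + α)))
      ((slab d T).prod volume) :=
    (hu.integrable_diff_div hd hT hα).bdd_mul (c := K * M')
      (by fun_prop) (Eventually.of_forall fun q => hθψb q.1)
  have hθu : Integrable (fun p => θ p.1 * u p.1 p.2) (slab d T) :=
    hu.integrable.bdd_mul (c := K) (hθ.comp measurable_fst).aestronglyMeasurable
      (Eventually.of_forall fun q => hK q.1)
  have hi2 : Integrable (fun q : (ℝ × E d) × E d => θ q.1.1 * u q.1.1 q.1.2 *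
      ((ψ q.1.2 - ψ (q.2 + q.1.2)) / ‖q.2‖ ^ ((d : ℝ) + α))) ((slab d T).prod volume) := by
    refine (hθu.mul_prod (integrable_min_div_rpow hd hα (a := 2 * M') (C := C')
      (by linarith) hC')).mono (hθu.1.comp_fst.mul
        (Measurable.aestronglyMeasurable (by fun_prop))) (Eventually.of_forall fun q => ?_)
    rw [norm_mul (θ q.1.1 * u q.1.1 q.1.2), norm_mul (θ q.1.1 * u q.1.1 q.1.2)]
    refine mul_le_mul_of_nonneg_left ?_ (norm_nonneg (θ q.1.1 * u q.1.1 q.1.2))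
    have hz : 0 ≤ ‖q.2‖ ^ ((d : ℝ) + α) := by positivity
    have hmn : 0 ≤ min (2 * M') (C' * ‖q.2‖) := le_min (by linarith) (by positivity)
    rw [norm_div, norm_div, Real.norm_of_nonneg hz, Real.norm_of_nonneg hmn]
    exact div_le_div_of_nonneg_right (h _ _) hz
  have e1 : ∫ p, θ p.1 * ψ p.2 * fracLap α (u p.1) p.2 ∂slab d T = fracConst d α *
      ∫ z : E d, ∫ p, θ p.1 * ψ p.2 *
        ((u p.1 p.2 - u p.1 (z + p.2)) / ‖z‖ ^ ((d : ℝ) + α)) ∂slab d T := by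
    rw [← integral_prod_symm _ hi1, integral_prod _ hi1, ← integral_const_mul]
    refine integral_congr_ae (Eventually.of_forall fun p => ?_)
    simp only [fracLap]
    rw [integral_const_mul]; ring
  have e2 : ∫ p, θ p.1 * u p.1 p.2 * fracLap α ψ p.2 ∂slab d T = fracConst d α *
      ∫ z : E d, ∫ p, θ p.1 * u p.1 p.2 *
        ((ψ p.2 - ψ (z + p.2)) / ‖z‖ ^ ((d : ℝ) + α)) ∂slab d T := by
    rw [← integral_prod_symm _ hi2, integral_prod _ hi2, ← integral_const_mul]
    refine integral_congr_ae (Eventually.of_forall fun p => ?_)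
    simp only [fracLap]
    rw [integral_const_mul]; ring
  -- After z ↦ -z on one side, the translation x ↦ z + x carries the increment from u over to ψ.
  rw [e1, e2, ← integral_neg_eq_self]
  congr 1
  refine integral_congr_ae (Eventually.of_forall fun z => ?_)
  have hψz : ∀ z : E d, Integrable (fun p => θ p.1 * u p.1 p.2 * ψ (z + p.2)) (slab d T) := fun z =>
    hθu.mul_bdd (c := M') (hψm.comp (measurable_snd.const_add z)).aestronglyMeasurable
      (Eventually.of_forall fun p => hψb _)
  have huz : Integrable (fun p => θ p.1 * ψ p.2 * u p.1 (-z + p.2)) (slab d T) :=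
    (hu.translate (-z)).integrable.bdd_mul (c := K * M') (by fun_prop)
      (Eventually.of_forall hθψb)
  have hu0 : Integrable (fun p => θ p.1 * ψ p.2 * u p.1 p.2) (slab d T) :=
    hu.integrable.bdd_mul (c := K * M') (by fun_prop) (Eventually.of_forall hθψb)
  have e3 : ∫ p, θ p.1 * ψ p.2 * u p.1 (-z + p.2) ∂slab d T
      = ∫ p, θ p.1 * u p.1 p.2 * ψ (z + p.2) ∂slab d T := by
    unfold slab at huz hψz ⊢
    rw [integral_prod _ huz, integral_prod _ (hψz z)]
    refine integral_congr_ae (Eventually.of_forall fun t => ?_)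
    simp only
    rw [← integral_add_left_eq_self _ z]
    refine integral_congr_ae (Eventually.of_forall fun x => ?_)
    simp only [neg_add_cancel_left]; ring
  have e4 : ∀ p : ℝ × E d, θ p.1 * ψ p.2 * ((u p.1 p.2 - u p.1 (-z + p.2)) / ‖-z‖ ^ ((d : ℝ) + α))
      = (θ p.1 * ψ p.2 * u p.1 p.2 - θ p.1 * ψ p.2 * u p.1 (-z + p.2)) / ‖z‖ ^ ((d : ℝ) + α) :=
    fun p => by rw [norm_neg]; ring
  have e5 : ∀ p : ℝ × E d, θ p.1 * u p.1 p.2 * ((ψ p.2 - ψ (z + p.2)) / ‖z‖ ^ ((d : ℝ) + α))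
      = (θ p.1 * ψ p.2 * u p.1 p.2 - θ p.1 * u p.1 p.2 * ψ (z + p.2)) / ‖z‖ ^ ((d : ℝ) + α) :=
    fun p => by ring
  simp only [e4, e5]
  rw [integral_div, integral_div, integral_sub hu0 huz, integral_sub hu0 (hψz z), e3]

/-! ### The kinetic function. -/

lemma measurable_chi : Measurable fun q : ℝ × ℝ => chi q.1 q.2 := by
  have h1 : MeasurableSet {q : ℝ × ℝ | 0 < q.2 ∧ q.2 < q.1} :=
    (measurableSet_lt measurable_const measurable_snd).inter
      (measurableSet_lt measurable_snd measurable_fst)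
  have h2 : MeasurableSet {q : ℝ × ℝ | q.1 < q.2 ∧ q.2 < 0} :=
    (measurableSet_lt measurable_fst measurable_snd).inter
      (measurableSet_lt measurable_snd measurable_const)
  exact (measurable_one.indicator h1).sub (measurable_one.indicator h2)

lemma abs_chi_le_one (r v : ℝ) : |chi r v| ≤ 1 := by
  unfold chi
  by_cases h1 : v ∈ Ioo 0 r <;> by_cases h2 : v ∈ Ioo r 0 <;> simp [h1, h2]

lemma abs_chi_eq (r v : ℝ) : |chi r v| = (Ioo (min 0 r) (max 0 r)).indicator (fun _ => 1) v := by
  unfold chi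
  rcases le_total 0 r with h | h <;> simp only [h, min_eq_left, min_eq_right, max_eq_left,
    max_eq_right, Ioo_eq_empty_of_le, indicator_empty, sub_zero, zero_sub, abs_neg] <;>
  exact abs_of_nonneg (indicator_nonneg (fun _ _ => zero_le_one) _)

lemma integral_abs_chi (r : ℝ) : ∫ v, |chi r v| = |r| := by
  simp only [abs_chi_eq]
  rw [integral_indicator measurableSet_Ioo]
  simp [max_sub_min_eq_abs]

lemma chi_mul_eq (r v : ℝ) (g : ℝ → ℝ) :
    chi r v * g v = (Ioo 0 r).indicator g v - (Ioo r 0).indicator g v := by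
  unfold chi
  by_cases h1 : v ∈ Ioo 0 r <;> by_cases h2 : v ∈ Ioo r 0 <;> simp [h1, h2]

/-- Integrating against `χ_r` amounts to taking the primitive that vanishes at `0`. -/
lemma integral_chi_mul {g : ℝ → ℝ} (hg : LocallyIntegrable g) (r : ℝ) :
    ∫ v, chi r v * g v = ∫ v in (0 : ℝ)..r, g v := by
  have hi : ∀ a b, IntegrableOn g (Ioo a b) := fun a b =>
    (hg.integrableOn_isCompact isCompact_Icc).mono_set Ioo_subset_Icc_self
  simp only [chi_mul_eq]
  rw [integral_sub ((hi _ _).integrable_indicator measurableSet_Ioo)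
    ((hi _ _).integrable_indicator measurableSet_Ioo), integral_indicator measurableSet_Ioo,
    integral_indicator measurableSet_Ioo, intervalIntegral, integral_Ioc_eq_integral_Ioo,
    integral_Ioc_eq_integral_Ioo]

lemma integrable_chi_mul {g : ℝ → ℝ} (hg : LocallyIntegrable g) (r : ℝ) :
    Integrable fun v => chi r v * g v := by
  have hi : ∀ a b, IntegrableOn g (Ioo a b) := fun a b =>
    (hg.integrableOn_isCompact isCompact_Icc).mono_set Ioo_subset_Icc_self
  simp only [chi_mul_eq]
  exact ((hi _ _).integrable_indicator measurableSet_Ioo).sub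
    ((hi _ _).integrable_indicator measurableSet_Ioo)

/-! ### Bounds on the coefficients. -/

/-- The consequences of the hypotheses on the coefficients that are used for the entropy
identities. -/
structure CoefficientBounds {d : ℕ} (F : ℝ → E d) (A B : ℝ → ℝ) (K : ℝ≥0) : Prop where
  flux : ∀ R : ℝ, ∃ c : ℝ, ∀ v, |v| ≤ R → ‖deriv F v‖ ≤ c
  source_zero : A 0 = 0
  source : ∀ a b : ℝ, AbsolutelyContinuousOnInterval A a b
  lipschitz : LipschitzWith K B
  monotone : Monotone B
  zero : B 0 = 0

namespace CoefficientBounds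

variable {d : ℕ} {F : ℝ → E d} {A B : ℝ → ℝ} {K : ℝ≥0}

lemma abs_deriv_le (h : CoefficientBounds F A B K) (v : ℝ) : |deriv B v| ≤ K :=
  norm_deriv_le_of_lipschitz h.lipschitz

lemma continuous_source (h : CoefficientBounds F A B K) : Continuous A := by
  refine continuous_iff_continuousAt.2 fun x => ?_
  refine ((h.source (x - 1) (x + 1)).continuousOn).continuousAt ?_
  rw [uIcc_of_le (by linarith)]
  exact Icc_mem_nhds (by linarith) (by linarith)

lemma locallyIntegrable_deriv_source (h : CoefficientBounds F A B K) :
    LocallyIntegrable (deriv A) := by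
  intro x
  refine ⟨Ioc (x - 1) (x + 1), Ioc_mem_nhds (by linarith) (by linarith), ?_⟩
  exact (intervalIntegrable_iff_integrableOn_Ioc_of_le (by linarith)).1
    (h.source (x - 1) (x + 1)).intervalIntegrable_deriv

end CoefficientBounds

lemma abs_le_of_mem_tsupport {η : ℝ → ℝ} (hη : HasCompactSupport η) :
    ∃ R : ℝ, 0 < R ∧ ∀ v, R < |v| → η v = 0 := by
  obtain ⟨R, hR, h⟩ := hη.isBounded.subset_closedBall_lt 0 0
  refine ⟨R, hR, fun v hv => image_eq_zero_of_notMem_tsupport fun hm => ?_⟩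
  have := h hm
  rw [mem_closedBall_zero_iff, Real.norm_eq_abs] at this
  linarith

/-- A bounded measurable function vanishing outside a bounded set is integrable. -/
lemma integrable_of_bounded_of_eq_zero {g : ℝ → ℝ} (hm : AEStronglyMeasurable g) {c R : ℝ}
    (hb : ∀ v, |g v| ≤ c) (h0 : ∀ v, R < |v| → g v = 0) : Integrable g := by
  have hs : Function.support g ⊆ Icc (-R) R := fun v hv => by
    by_contra hn
    refine hv (h0 v ?_)
    rw [mem_Icc, ← abs_le] at hn
    exact not_le.1 hn
  rw [← integrableOn_iff_integrable_of_support_subset hs]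
  exact Measure.integrableOn_of_bounded (M := c) measure_Icc_lt_top.ne hm
    (Eventually.of_forall hb)

section Bounds

variable {d : ℕ} {F : ℝ → E d} {A B : ℝ → ℝ} {K : ℝ≥0}

/-- On a bounded function vanishing outside a bounded set the flux is harmless. -/
lemma CoefficientBounds.exists_flux_bound (h : CoefficientBounds F A B K) {η : ℝ → ℝ} {c R : ℝ}
    (hb : ∀ v, |η v| ≤ c) (h0 : ∀ v, R < |v| → η v = 0) :
    ∃ c' : ℝ, 0 ≤ c' ∧ ∀ v, ‖deriv F v‖ * |η v| ≤ c' := by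
  obtain ⟨a, ha⟩ := h.flux |R|
  have ha0 : 0 ≤ a := (norm_nonneg _).trans (ha 0 (by simp))
  have hc0 : 0 ≤ c := (abs_nonneg _).trans (hb 0)
  refine ⟨a * c, mul_nonneg ha0 hc0, fun v => ?_⟩
  by_cases hv : |v| ≤ R
  · exact mul_le_mul (ha v (hv.trans (le_abs_self _))) (hb v) (abs_nonneg _) ha0
  · rw [h0 v (not_le.1 hv)]; simp; positivity

end Bounds

/-! ### The kinetic equation tested against tensor products. -/

lemma fracLap_const_mul {d : ℕ} (α c : ℝ) (g : E d → ℝ) (x : E d) :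
    fracLap α (fun y => c * g y) x = c * fracLap α g x := by
  unfold fracLap
  simp only [← mul_sub, mul_div_assoc]
  rw [integral_const_mul, mul_left_comm]

/-- The adjoint operator on a tensor product. -/
lemma adjointOp_tensor {d : ℕ} (α : ℝ) (F : ℝ → E d) (A B : ℝ → ℝ) {θ η : ℝ → ℝ} {ψ : E d → ℝ}
    (hθ : Differentiable ℝ θ) (hψ : Differentiable ℝ ψ) (hη : Differentiable ℝ η)
    (t : ℝ) (x : E d) (v : ℝ) :
    adjointOp α F A B (fun p => θ p.1 * ψ p.2.1 * η p.2.2) (t, x, v)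
      = deriv θ t * ψ x * η v + θ t * (η v * fderiv ℝ ψ x (deriv F v))
        + θ t * ψ x * (deriv A v * η v + A v * deriv η v)
        - θ t * fracLap α ψ x * (η v * deriv B v) := by
  have e1 : deriv (fun s => θ s * ψ x * η v) t = deriv θ t * ψ x * η v :=
    (((hθ t).hasDerivAt.mul_const _).mul_const _).deriv
  have e2 : deriv (fun w => θ t * ψ x * η w) v = θ t * ψ x * deriv η v :=
    ((hη v).hasDerivAt.const_mul _).deriv
  have e3 : fderiv ℝ (fun y => θ t * ψ y * η v) x (deriv F v)
      = θ t * (η v * fderiv ℝ ψ x (deriv F v)) := by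
    rw [(((hψ x).hasFDerivAt.const_mul (θ t)).mul_const (η v)).fderiv]
    simp only [smul_apply, smul_eq_mul]; ring
  have e4 : fracLap α (fun y => θ t * ψ y * η v) x = θ t * η v * fracLap α ψ x := by
    rw [← fracLap_const_mul]; congr 1; ext y; ring
  simp only [adjointOp, e1, e2, e3, e4]
  ring

lemma volume_restrict_kineticDomain (d : ℕ) (T : ℝ) :
    (volume : Measure (ℝ × E d × ℝ)).restrict (kineticDomain d T)
      = (volume.restrict (Ioo 0 T)).prod (volume : Measure (E d × ℝ)) := by
  rw [kineticDomain, Measure.volume_eq_prod, ← Measure.prod_restrict, Measure.restrict_univ]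

lemma measurePreserving_kineticDomain (d : ℕ) (T : ℝ) :
    MeasurePreserving (MeasurableEquiv.prodAssoc : (ℝ × E d) × ℝ ≃ᵐ ℝ × E d × ℝ)
      ((slab d T).prod volume) (volume.restrict (kineticDomain d T)) := by
  rw [volume_restrict_kineticDomain]
  exact measurePreserving_prodAssoc (volume.restrict (Ioo 0 T)) volume volume

lemma integrable_kineticDomain_iff {d : ℕ} {T : ℝ} {g : ℝ × E d × ℝ → ℝ} :
    Integrable g (volume.restrict (kineticDomain d T)) ↔
      Integrable (fun w : (ℝ × E d) × ℝ => g (w.1.1, w.1.2, w.2)) ((slab d T).prod volume) :=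
  ((measurePreserving_kineticDomain d T).integrable_comp_emb
    (MeasurableEquiv.measurableEmbedding _)).symm

lemma integral_kineticDomain {d : ℕ} {T : ℝ} {g : ℝ × E d × ℝ → ℝ}
    (hg : Integrable (fun w : (ℝ × E d) × ℝ => g (w.1.1, w.1.2, w.2)) ((slab d T).prod volume)) :
    ∫ p in kineticDomain d T, g p = ∫ w : ℝ × E d, (∫ v, g (w.1, w.2, v)) ∂slab d T := by
  rw [← (measurePreserving_kineticDomain d T).integral_comp
    (MeasurableEquiv.measurableEmbedding _)]
  exact integral_prod _ hg

/-- `(p, v) ↦ χ_{ρ(p)}(v)` is integrable. -/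
lemma integrable_chi_comp {β : Type*} [MeasurableSpace β] {μ : Measure β} [SFinite μ] {ρ : β → ℝ}
    (hρ : Integrable ρ μ) : Integrable (fun w : β × ℝ => chi (ρ w.1) w.2) (μ.prod volume) := by
  have hm : AEStronglyMeasurable (fun w : β × ℝ => chi (ρ w.1) w.2) (μ.prod volume) :=
    (measurable_chi.comp_aemeasurable
      (hρ.1.aemeasurable.comp_fst.prodMk measurable_snd.aemeasurable)).aestronglyMeasurable
  refine (integrable_prod_iff hm).2 ⟨Eventually.of_forall fun p => ?_, ?_⟩
  · simpa using integrable_chi_mul (g := fun _ => 1) (locallyIntegrable_const _) (ρ p)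
  · simp only [Real.norm_eq_abs, integral_abs_chi]
    exact hρ.abs

/-- The transport flux `∫₀^r η(v) ℓ(f(v)) dv` in the direction dual to `ℓ`. -/
def fluxPrimitive {d : ℕ} (F : ℝ → E d) (η : ℝ → ℝ) (ℓ : E d →L[ℝ] ℝ) (r : ℝ) : ℝ :=
  ∫ v in (0 : ℝ)..r, η v * ℓ (deriv F v)

/-- The local part of the integrand in the weak entropy formulation with multiplier `η` and test
function `θ(t)ψ(x)`. -/
def localIntegrand {d : ℕ} (F : ℝ → E d) (A : ℝ → ℝ) (ρ : ℝ → E d → ℝ)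
    (θ : ℝ → ℝ) (ψ : E d → ℝ) (η : ℝ → ℝ) (p : ℝ × E d) : ℝ :=
  deriv θ p.1 * ψ p.2 * (∫ v in (0 : ℝ)..ρ p.1 p.2, η v)
    + θ p.1 * fluxPrimitive F η (fderiv ℝ ψ p.2) (ρ p.1 p.2)
    + θ p.1 * ψ p.2 * (A (ρ p.1 p.2) * η (ρ p.1 p.2))

section Transport

variable {d : ℕ} {F : ℝ → E d} {A B : ℝ → ℝ} {K : ℝ≥0} {α T M C : ℝ} {ρ : ℝ → E d → ℝ}
  {θ η : ℝ → ℝ} {ψ : E d → ℝ}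

/-- The integrand is the derivative of the absolutely continuous product Aη, and A(0) = 0 removes
the boundary term at 0. -/
lemma CoefficientBounds.intervalIntegral_source (h : CoefficientBounds F A B K)
    (hη : ContDiff ℝ ∞ η) (r : ℝ) :
    ∫ v in (0 : ℝ)..r, (deriv A v * η v + A v * deriv η v) = A r * η r := by
  have hac : AbsolutelyContinuousOnInterval η 0 r :=
    (hη.contDiffOn.of_le (by norm_num)).absolutelyContinuousOnInterval
  rw [(h.source 0 r).integral_deriv_mul_eq_sub hac, h.source_zero]
  ring

/-- Pairing `χ_ρ` with the adjoint operator applied to a tensor product. -/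
lemma integral_chi_mul_adjointOp (h : CoefficientBounds F A B K)
    (hρ : TranslationBounded T M C ρ) (hd : 0 < d) (hα : α ∈ Ioo (0 : ℝ) 1)
    (hθ : ContDiff ℝ ∞ θ) (hθc : HasCompactSupport θ) (hψ : ContDiff ℝ ∞ ψ)
    (hψc : HasCompactSupport ψ) (hη : ContDiff ℝ ∞ η) (hηc : HasCompactSupport η) :
    Integrable (localIntegrand F A ρ θ ψ η) (slab d T) ∧
    Integrable (fun p => θ p.1 * (∫ v in (0 : ℝ)..ρ p.1 p.2, η v * deriv B v) * fracLap α ψ p.2)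
      (slab d T) ∧
    ∫ p in kineticDomain d T, chi (ρ p.1 p.2.1) p.2.2 *
        adjointOp α F A B (fun p => θ p.1 * ψ p.2.1 * η p.2.2) p
      = ∫ p, localIntegrand F A ρ θ ψ η p ∂slab d T
        - ∫ p, θ p.1 * (∫ v in (0 : ℝ)..ρ p.1 p.2, η v * deriv B v) * fracLap α ψ p.2
            ∂slab d T := by
  have hθd : Differentiable ℝ θ := hθ.differentiable (by simp)
  have hψd : Differentiable ℝ ψ := hψ.differentiable (by simp)
  have hηd : Differentiable ℝ η := hη.differentiable (by simp)
  obtain ⟨cη, hcη⟩ := hηc.exists_bound_of_continuous hη.continuous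
  obtain ⟨cθ, hcθ⟩ := hθc.exists_bound_of_continuous hθ.continuous
  obtain ⟨R, hR, hηR⟩ := abs_le_of_mem_tsupport hηc
  obtain ⟨cL, hcL⟩ := exists_bound_fracLap_test hd hα hψ hψc
  obtain ⟨cf, hcf0, hcf⟩ := h.exists_flux_bound hcη hηR
  have hθi : Integrable θ := hθ.continuous.integrable_of_hasCompactSupport hθc
  have hθi' : Integrable (deriv θ) :=
    (hθ.continuous_deriv (by simp)).integrable_of_hasCompactSupport hθc.deriv
  have hψi : Integrable ψ := hψ.continuous.integrable_of_hasCompactSupport hψc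
  have hηi : Integrable η := hη.continuous.integrable_of_hasCompactSupport hηc
  have hψf : Continuous (fderiv ℝ ψ) := hψ.continuous_fderiv (by simp)
  have hψi' : Integrable (fun x => ‖fderiv ℝ ψ x‖) :=
    (hψf.integrable_of_hasCompactSupport (hψc.fderiv (𝕜 := ℝ))).norm
  have hχm : Measurable fun w : (ℝ × E d) × ℝ => chi (ρ w.1.1 w.1.2) w.2 :=
    measurable_chi.comp ((hρ.measurable.comp measurable_fst).prodMk measurable_snd)
  have hsrc : Integrable fun v => deriv A v * η v + A v * deriv η v := by
    refine Integrable.add ?_ ?_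
    · have := h.locallyIntegrable_deriv_source.integrable_smul_left_of_hasCompactSupport
        hη.continuous hηc
      simpa [mul_comm] using this
    · exact (h.continuous_source.mul (hη.continuous_deriv (by simp))).integrable_of_hasCompactSupport
        hηc.deriv.mul_left
  have hfi : Integrable fun v => ‖deriv F v‖ * |η v| :=
    integrable_of_bounded_of_eq_zero
      ((measurable_deriv F).norm.mul hη.continuous.measurable.abs).aestronglyMeasurable
      (c := cf) (R := R) (fun v => by rw [abs_of_nonneg (by positivity)]; exact hcf v)
      (fun v hv => by simp [hηR v hv])
  have hgrad : ∀ x : E d, LocallyIntegrable fun v => η v * fderiv ℝ ψ x (deriv F v) := fun x => by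
    refine Integrable.locallyIntegrable ((hfi.const_mul ‖fderiv ℝ ψ x‖).mono' ?_
      (Eventually.of_forall fun v => ?_))
    · exact (hη.continuous.measurable.mul
        ((fderiv ℝ ψ x).continuous.measurable.comp (measurable_deriv F))).aestronglyMeasurable
    · rw [norm_mul, Real.norm_eq_abs (η v)]
      nlinarith [(fderiv ℝ ψ x).le_opNorm (deriv F v), abs_nonneg (η v)]
  have hbη : LocallyIntegrable fun v => η v * deriv B v :=
    Integrable.locallyIntegrable (hηi.mul_bdd (c := K) (measurable_deriv B).aestronglyMeasurable
      (Eventually.of_forall h.abs_deriv_le))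
  have i1 : Integrable (fun w : (ℝ × E d) × ℝ => chi (ρ w.1.1 w.1.2) w.2 *
      (deriv θ w.1.1 * ψ w.1.2 * η w.2)) ((slab d T).prod volume) :=
    ((integrable_slab_mul hθi' hψi).mul_prod hηi).bdd_mul (c := 1) hχm.aestronglyMeasurable
      (Eventually.of_forall fun w => abs_chi_le_one _ _)
  have i2 : Integrable (fun w : (ℝ × E d) × ℝ => chi (ρ w.1.1 w.1.2) w.2 *
      (θ w.1.1 * (η w.2 * fderiv ℝ ψ w.1.2 (deriv F w.2)))) ((slab d T).prod volume) := by
    refine Integrable.bdd_mul (c := 1) ?_ hχm.aestronglyMeasurable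
      (Eventually.of_forall fun w => abs_chi_le_one _ _)
    refine ((integrable_slab_mul hθi.abs hψi').mul_prod hfi).mono' ?_
      (Eventually.of_forall fun w => ?_)
    · have : Measurable fun w : (ℝ × E d) × ℝ => fderiv ℝ ψ w.1.2 (deriv F w.2) := by
        have hc : Continuous fun q : (E d →L[ℝ] ℝ) × E d => q.1 q.2 := by fun_prop
        exact hc.measurable.comp ((hψf.measurable.comp (measurable_snd.comp measurable_fst)).prodMk
          ((measurable_deriv F).comp measurable_snd))
      exact ((hθ.continuous.measurable.comp (measurable_fst.comp measurable_fst)).mul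
        ((hη.continuous.measurable.comp measurable_snd).mul this)).aestronglyMeasurable
    · rw [norm_mul, norm_mul, Real.norm_eq_abs (η w.2), Real.norm_eq_abs (θ w.1.1)]
      have h1 := (fderiv ℝ ψ w.1.2).le_opNorm (deriv F w.2)
      calc _ ≤ |θ w.1.1| * (|η w.2| * (‖fderiv ℝ ψ w.1.2‖ * ‖deriv F w.2‖)) := by gcongr
        _ = _ := by ring
  have i3 : Integrable (fun w : (ℝ × E d) × ℝ => chi (ρ w.1.1 w.1.2) w.2 *
      (θ w.1.1 * ψ w.1.2 * (deriv A w.2 * η w.2 + A w.2 * deriv η w.2)))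
      ((slab d T).prod volume) :=
    ((integrable_slab_mul hθi hψi).mul_prod hsrc).bdd_mul (c := 1) hχm.aestronglyMeasurable
      (Eventually.of_forall fun w => abs_chi_le_one _ _)
  -- Here (-Δ)^{α/2}ψ is not compactly supported and only its boundedness is used, so integrability
  -- comes from χ_ρ, whose L¹ norm is that of ρ. In the other three terms χ_ρ is the bounded factor.
  have i4 : Integrable (fun w : (ℝ × E d) × ℝ => chi (ρ w.1.1 w.1.2) w.2 *
      (θ w.1.1 * fracLap α ψ w.1.2 * (η w.2 * deriv B w.2))) ((slab d T).prod volume) := by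
    refine (integrable_chi_comp hρ.integrable).mul_bdd (c := cθ * cL * (cη * K)) ?_
      (Eventually.of_forall fun w => ?_)
    · exact (((hθ.continuous.measurable.comp (measurable_fst.comp measurable_fst)).mul
        ((measurable_fracLap_test α hψ.continuous).comp (measurable_snd.comp measurable_fst))).mul
        ((hη.continuous.measurable.comp measurable_snd).mul
          ((measurable_deriv B).comp measurable_snd))).aestronglyMeasurable
    · rw [norm_mul, norm_mul, norm_mul]
      have h1 := hcθ w.1.1; have h2 := hcL w.1.2; have h3 := hcη w.2; have h4 := h.abs_deriv_le w.2
      have h1' := (norm_nonneg _).trans h1; have h3' := (norm_nonneg _).trans h3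
      have h2' := (abs_nonneg _).trans h2
      exact mul_le_mul (mul_le_mul h1 h2 (norm_nonneg _) h1')
        (mul_le_mul h3 h4 (norm_nonneg _) h3') (by positivity) (by positivity)
  have hη1 : LocallyIntegrable η := hηi.locallyIntegrable
  have v1 : ∀ p : ℝ × E d, ∫ v, chi (ρ p.1 p.2) v * (deriv θ p.1 * ψ p.2 * η v)
      = deriv θ p.1 * ψ p.2 * (∫ v in (0 : ℝ)..ρ p.1 p.2, η v) := fun p => by
    simp only [mul_left_comm (chi _ _)]
    rw [integral_const_mul, integral_chi_mul hη1]
  have v2 : ∀ p : ℝ × E d, ∫ v, chi (ρ p.1 p.2) v * (θ p.1 * (η v * fderiv ℝ ψ p.2 (deriv F v)))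
      = θ p.1 * fluxPrimitive F η (fderiv ℝ ψ p.2) (ρ p.1 p.2) := fun p => by
    simp only [mul_left_comm (chi _ _) (θ _)]
    rw [integral_const_mul, integral_chi_mul (hgrad p.2)]; rfl
  have v3 : ∀ p : ℝ × E d, ∫ v, chi (ρ p.1 p.2) v *
        (θ p.1 * ψ p.2 * (deriv A v * η v + A v * deriv η v))
      = θ p.1 * ψ p.2 * (A (ρ p.1 p.2) * η (ρ p.1 p.2)) := fun p => by
    simp only [mul_left_comm (chi _ _) (θ _ * ψ _)]
    rw [integral_const_mul, integral_chi_mul hsrc.locallyIntegrable, h.intervalIntegral_source hη]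
  have v4 : ∀ p : ℝ × E d, ∫ v, chi (ρ p.1 p.2) v *
        (θ p.1 * fracLap α ψ p.2 * (η v * deriv B v))
      = θ p.1 * (∫ v in (0 : ℝ)..ρ p.1 p.2, η v * deriv B v) * fracLap α ψ p.2 := fun p => by
    simp only [mul_left_comm (chi _ _) (θ _ * fracLap _ _ _)]
    rw [integral_const_mul, integral_chi_mul hbη]; ring
  have j1 := i1.integral_prod_left; have j2 := i2.integral_prod_left
  have j3 := i3.integral_prod_left; have j4 := i4.integral_prod_left
  have hint : Integrable (fun w : (ℝ × E d) × ℝ => chi (ρ w.1.1 w.1.2) w.2 *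
      adjointOp α F A B (fun p => θ p.1 * ψ p.2.1 * η p.2.2) (w.1.1, w.1.2, w.2))
      ((slab d T).prod volume) := by
    simp only [adjointOp_tensor α F A B hθd hψd hηd, mul_sub, mul_add (chi _ _)]
    exact ((i1.add i2).add i3).sub i4
  simp only [v1, v2, v3, v4] at j1 j2 j3 j4
  refine ⟨(j1.add j2).add j3, j4, ?_⟩
  have jloc : Integrable (localIntegrand F A ρ θ ψ η) (slab d T) := (j1.add j2).add j3
  rw [integral_kineticDomain hint, ← integral_sub jloc j4]
  refine integral_congr_ae ?_
  filter_upwards [i1.prod_right_ae, i2.prod_right_ae, i3.prod_right_ae, i4.prod_right_ae]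
    with p k1 k2 k3 k4
  simp only [adjointOp_tensor α F A B hθd hψd hηd, mul_sub, mul_add (chi _ _)]
  have k12 := k1.add k2
  have k123 := k12.add k3
  simp only [Pi.add_def] at k12 k123
  rw [integral_sub k123 k4, integral_add k12 k3, integral_add k1 k2, v1, v2, v3, v4, localIntegrand]

end Transport

/-! ### The kernel of the nonlocal dissipation. -/

/-- The kernel of the nonlocal dissipation between the states `r` (at `x`) and `s` (at `x + z`). -/
def defectKernel (B : ℝ → ℝ) (r s v : ℝ) : ℝ :=
  (Real.sign (r - v) * (B r - B s) - (|B r - B v| - |B s - B v|)) / 2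

lemma measurable_real_sign : Measurable Real.sign := by
  unfold Real.sign
  exact Measurable.ite measurableSet_Iio measurable_const
    (Measurable.ite measurableSet_Ioi measurable_const measurable_const)

lemma abs_real_sign_le_one (r : ℝ) : |Real.sign r| ≤ 1 := by
  rcases Real.sign_apply_eq r with h | h | h <;> rw [h] <;> norm_num

section Kernel

variable {B : ℝ → ℝ}

lemma sign_sub_mul_sub (hB : Monotone B) (r v : ℝ) :
    Real.sign (r - v) * (B r - B v) = |B r - B v| := by
  rcases lt_trichotomy r v with h | h | h
  · rw [Real.sign_of_neg (by linarith), abs_of_nonpos (by linarith [hB h.le])]; ring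
  · simp [h]
  · rw [Real.sign_of_pos (by linarith), abs_of_nonneg (by linarith [hB h.le])]; ring

lemma defectKernel_eq (hB : Monotone B) (r s v : ℝ) :
    defectKernel B r s v = (|B s - B v| - Real.sign (r - v) * (B s - B v)) / 2 := by
  rw [defectKernel, ← sign_sub_mul_sub hB r v]; ring

lemma defectKernel_nonneg (hB : Monotone B) (r s v : ℝ) : 0 ≤ defectKernel B r s v := by
  rw [defectKernel_eq hB]
  have h1 : Real.sign (r - v) * (B s - B v) ≤ |B s - B v| := by
    refine (le_abs_self _).trans ?_
    rw [abs_mul]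
    exact mul_le_of_le_one_left (abs_nonneg _) (abs_real_sign_le_one _)
  linarith

/-- The bound is uniform in v, so the dissipation integral converges wherever the difference
quotients of B(ρ) are integrable. -/
lemma abs_defectKernel_le (r s v : ℝ) : |defectKernel B r s v| ≤ |B r - B s| := by
  have h1 : |Real.sign (r - v) * (B r - B s)| ≤ |B r - B s| := by
    rw [abs_mul]
    exact mul_le_of_le_one_left (abs_nonneg _) (abs_real_sign_le_one _)
  have h2 : abs (|B r - B v| - |B s - B v|) ≤ |B r - B s| := by
    refine (abs_abs_sub_abs_le_abs_sub _ _).trans (le_of_eq ?_)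
    congr 1; ring
  rw [defectKernel, abs_div, abs_two]
  have := abs_sub (Real.sign (r - v) * (B r - B s)) (|B r - B v| - |B s - B v|)
  linarith

/-- When v does not separate r from s, the numbers sgn(r-v)|B(s)-B(v)| and B(s)-B(v) agree and the
kernel vanishes; between them it equals |B(s)-B(v)|. The two signed indicators are those of the
oriented integral from r to s. The point v = r is excluded because the sign is 0 there. -/
lemma defectKernel_of_lt (hB : Monotone B) {r s v : ℝ} (hr : v ≠ r) :
    defectKernel B r s v = (Ioc r s).indicator (fun w => B s - B w) v
      - (Ioc s r).indicator (fun w => B s - B w) v := by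
  rw [defectKernel_eq hB]
  rcases lt_or_gt_of_ne hr with h | h
  · rw [Real.sign_of_pos (by linarith)]
    have h1 : v ∉ Ioc r s := fun hm => by linarith [hm.1]
    rw [indicator_of_notMem h1]
    by_cases h2 : s < v
    · rw [indicator_of_mem (show v ∈ Ioc s r from ⟨h2, h.le⟩),
        abs_of_nonpos (by linarith [hB h2.le])]; ring
    · rw [indicator_of_notMem (fun hm => h2 hm.1),
        abs_of_nonneg (by linarith [hB (not_lt.1 h2)])]; ring
  · rw [Real.sign_of_neg (by linarith)]
    have h1 : v ∉ Ioc s r := fun hm => by linarith [hm.2]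
    rw [indicator_of_notMem h1]
    by_cases h2 : v ≤ s
    · rw [indicator_of_mem (show v ∈ Ioc r s from ⟨h, h2⟩),
        abs_of_nonneg (by linarith [hB h2])]; ring
    · rw [indicator_of_notMem (fun hm => h2 hm.2),
        abs_of_nonpos (by linarith [hB (not_le.1 h2).le])]; ring

lemma LipschitzWith.absolutelyContinuous {g : ℝ → ℝ} {K : ℝ≥0} (hg : LipschitzWith K g) (a b : ℝ) :
    AbsolutelyContinuousOnInterval g a b :=
  (hg.lipschitzOnWith (s := uIcc a b)).absolutelyContinuousOnInterval

/-- Integrating the dissipation kernel in `v` against `η'`. -/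
lemma integral_deriv_mul_defectKernel {K : ℝ≥0} (hB : Monotone B) (hL : LipschitzWith K B)
    {η : ℝ → ℝ} (hη : ContDiff ℝ ∞ η) (r s : ℝ) :
    ∫ v, deriv η v * defectKernel B r s v
      = (∫ v in (0 : ℝ)..s, η v * deriv B v) - (∫ v in (0 : ℝ)..r, η v * deriv B v)
        - η r * (B s - B r) := by
  have hac : ∀ a b, AbsolutelyContinuousOnInterval η a b := fun a b =>
    (hη.contDiffOn.of_le (by norm_num)).absolutelyContinuousOnInterval
  have hBac : ∀ a b, AbsolutelyContinuousOnInterval (fun w => B s - B w) a b := fun a b =>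
    AbsolutelyContinuousOnInterval.fun_sub
      (LipschitzWith.absolutelyContinuous (LipschitzWith.const (B s)) a b)
      (LipschitzWith.absolutelyContinuous hL a b)
  have hcont : Continuous fun v => deriv η v * (B s - B v) :=
    (hη.continuous_deriv (by simp)).mul (continuous_const.sub hL.continuous)
  have hio : ∀ a b, IntegrableOn (fun v => deriv η v * (B s - B v)) (Ioc a b) := fun a b =>
    hcont.integrableOn_Ioc
  have e1 : ∫ v, deriv η v * defectKernel B r s v = ∫ v in r..s, deriv η v * (B s - B v) := by
    rw [intervalIntegral, ← integral_indicator measurableSet_Ioc,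
      ← integral_indicator measurableSet_Ioc,
      ← integral_sub ((hio _ _).integrable_indicator measurableSet_Ioc)
        ((hio _ _).integrable_indicator measurableSet_Ioc)]
    refine integral_congr_ae ?_
    filter_upwards [Measure.ae_ne volume r] with v hv
    rw [defectKernel_of_lt hB hv, mul_sub]
    by_cases h1 : v ∈ Ioc r s <;> by_cases h2 : v ∈ Ioc s r <;> simp [h1, h2]
  have hii : ∀ a b, IntervalIntegrable (fun v => η v * deriv B v) volume a b := fun a b =>
    (LipschitzWith.absolutelyContinuous hL a b).intervalIntegrable_deriv.continuousOn_mul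
      hη.continuous.continuousOn
  -- The function B(s) - B vanishes at the endpoint s, so integration by parts leaves a single
  -- boundary term, at r.
  have e2 := (hac r s).integral_mul_deriv_eq_deriv_mul (hBac r s)
  have e3 : ∫ v in r..s, η v * deriv (fun w => B s - B w) v = -∫ v in r..s, η v * deriv B v := by
    rw [← intervalIntegral.integral_neg]
    refine intervalIntegral.integral_congr fun v _ => ?_
    simp only [deriv_const_sub, mul_neg]
  rw [e3] at e2
  rw [e1, intervalIntegral.integral_interval_sub_left (hii _ _) (hii _ _)]
  linarith

end Kernel

/-! ### The defect measure and the entropy identity. -/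

section Defect

variable {d : ℕ} {F : ℝ → E d} {A B : ℝ → ℝ} {K : ℝ≥0} {α T M C : ℝ} {ρ : ℝ → E d → ℝ}
  {θ η : ℝ → ℝ} {ψ : E d → ℝ}

lemma measurable_defectDensity (hB : Continuous B) (hρ : Measurable (Function.uncurry ρ)) :
    Measurable (defectDensity α B ρ) := by
  have h1 : Measurable fun p : ℝ × E d × ℝ => ρ p.1 p.2.1 :=
    hρ.comp (measurable_fst.prodMk (measurable_fst.comp measurable_snd))
  have h2 : Measurable fun p : ℝ × E d × ℝ => fracLap α (fun y => B (ρ p.1 y)) p.2.1 :=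
    (measurable_fracLap α (u := fun t y => B (ρ t y)) (hB.measurable.comp hρ)).comp
      (measurable_fst.prodMk (measurable_fst.comp measurable_snd))
  have h3 : Measurable fun p : ℝ × E d × ℝ => fracLap α (fun y => |B (ρ p.1 y) - B p.2.2|) p.2.1 := by
    have hu : Measurable (Function.uncurry fun (q : ℝ × ℝ) (y : E d) => |B (ρ q.1 y) - B q.2|) :=
      ((hB.measurable.comp (hρ.comp ((measurable_fst.comp measurable_fst).prodMk
        measurable_snd))).sub (hB.measurable.comp (measurable_snd.comp measurable_fst))).abs
    exact (measurable_fracLap α hu).comp ((measurable_fst.prodMk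
      (measurable_snd.comp measurable_snd)).prodMk (measurable_fst.comp measurable_snd))
  exact (((measurable_real_sign.comp (h1.sub (measurable_snd.comp measurable_snd))).mul h2).sub
    h3).div_const 2

lemma measurable_defectKernel_translate (hB : Continuous B)
    (hρ : Measurable (Function.uncurry ρ)) (t r : ℝ) (x : E d) :
    Measurable fun w : ℝ × E d => defectKernel B r (ρ t (w.2 + x)) w.1 := by
  have h1 : Measurable fun w : ℝ × E d => B (ρ t (w.2 + x)) := hB.measurable.comp
    (hρ.comp (measurable_const.prodMk (measurable_snd.add_const x)))
  have h2 : Measurable fun w : ℝ × E d => B w.1 := hB.measurable.comp measurable_fst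
  exact (((measurable_real_sign.comp (measurable_const.sub measurable_fst)).mul
    (measurable_const.sub h1)).sub ((measurable_const.sub h2).abs.sub (h1.sub h2).abs)).div_const 2

/-- Since | · | is 1-Lipschitz, the singular integral of |B(ρ) - B(v)| converges absolutely wherever
that of B(ρ) does. Both can therefore be put under one integral sign, where the integrand has a sign
for monotone B. -/
lemma defectDensity_eq (hB : Continuous B) (hρ : Measurable (Function.uncurry ρ)) {t : ℝ} {x : E d}
    (hi : Integrable fun z : E d => (B (ρ t x) - B (ρ t (z + x))) / ‖z‖ ^ ((d : ℝ) + α)) (v : ℝ) :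
    defectDensity α B ρ (t, x, v)
      = fracConst d α * ∫ z : E d, defectKernel B (ρ t x) (ρ t (z + x)) v / ‖z‖ ^ ((d : ℝ) + α) := by
  have hm : Measurable fun z : E d => B (ρ t (z + x)) := hB.measurable.comp
    (hρ.comp (measurable_const.prodMk (measurable_id.add_const x)))
  have hN : Measurable fun z : E d => ‖z‖ ^ ((d : ℝ) + α) := by fun_prop
  have hi2 : Integrable fun z : E d =>
      (|B (ρ t x) - B v| - |B (ρ t (z + x)) - B v|) / ‖z‖ ^ ((d : ℝ) + α) := by
    refine hi.mono (((measurable_const.sub (hm.sub_const _).abs).div hN).aestronglyMeasurable)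
      (Eventually.of_forall fun z => ?_)
    rw [norm_div, norm_div]
    refine div_le_div_of_nonneg_right ?_ (norm_nonneg _)
    refine (abs_abs_sub_abs_le_abs_sub _ _).trans (le_of_eq ?_)
    rw [Real.norm_eq_abs]; congr 1; ring
  simp only [defectDensity, fracLap]
  rw [mul_left_comm, ← mul_sub, mul_div_assoc]
  congr 1
  rw [← integral_const_mul, ← integral_sub (hi.const_mul _) hi2, ← integral_div]
  refine integral_congr_ae (Eventually.of_forall fun z => ?_)
  simp only [defectKernel]; ring

lemma fracConst_nonneg (d : ℕ) {α : ℝ} (hα : α ∈ Ioo (0 : ℝ) 1) : 0 ≤ fracConst d α := by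
  have h1 : 0 < Real.Gamma (((d : ℝ) + α) / 2) := Real.Gamma_pos_of_pos (by
    have := hα.1; positivity)
  have h2 : 0 < Real.Gamma ((2 - α) / 2) := Real.Gamma_pos_of_pos (by linarith [hα.2])
  have := hα.1
  unfold fracConst
  positivity

lemma abs_intervalIntegral_sub_le {g : ℝ → ℝ} {c : ℝ} (hg : LocallyIntegrable g)
    (hb : ∀ v, |g v| ≤ c) (r s : ℝ) :
    |(∫ v in (0 : ℝ)..r, g v) - ∫ v in (0 : ℝ)..s, g v| ≤ c * |r - s| := by
  have hii : ∀ a b, IntervalIntegrable g volume a b := fun a b =>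
    (hg.integrableOn_isCompact isCompact_uIcc).intervalIntegrable
  rw [intervalIntegral.integral_interval_sub_left (hii _ _) (hii _ _)]
  exact intervalIntegral.norm_integral_le_of_norm_le_const (f := g) fun v _ => hb v

lemma lipschitzWith_primitive {g : ℝ → ℝ} {c : ℝ≥0} (hg : LocallyIntegrable g)
    (hb : ∀ v, |g v| ≤ c) : LipschitzWith c fun r => ∫ v in (0 : ℝ)..r, g v :=
  LipschitzWith.of_dist_le_mul fun r s => abs_intervalIntegral_sub_le hg hb r s

/-- Makes β(ρ), with β' = ηb, accessible to `TranslationBounded.comp_lipschitz`. -/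
lemma CoefficientBounds.exists_lipschitz_primitive (h : CoefficientBounds F A B K)
    (hη : ContDiff ℝ ∞ η) (hηc : HasCompactSupport η) :
    ∃ c : ℝ≥0, LipschitzWith c fun r => ∫ v in (0 : ℝ)..r, η v * deriv B v := by
  obtain ⟨cη, hcη⟩ := hηc.exists_bound_of_continuous hη.continuous
  have h0 : 0 ≤ cη := (norm_nonneg _).trans (hcη 0)
  have hηi : Integrable η := hη.continuous.integrable_of_hasCompactSupport hηc
  refine ⟨⟨cη, h0⟩ * K, lipschitzWith_primitive (Integrable.locallyIntegrable
    (hηi.mul_bdd (c := K) (measurable_deriv B).aestronglyMeasurable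
      (Eventually.of_forall h.abs_deriv_le))) fun v => ?_⟩
  rw [abs_mul]
  exact mul_le_mul (hcη v) (h.abs_deriv_le v) (abs_nonneg _) h0

/-- For almost every `(t,x)` the defect density is nonnegative and its pairing in `v` with `η'`
is the commutator of the chain rule for the fractional Laplacian. -/
lemma ae_defectDensity (h : CoefficientBounds F A B K) (hρ : TranslationBounded T M C ρ)
    (hd : 0 < d) (hT : 0 < T) (hα : α ∈ Ioo (0 : ℝ) 1) (hη : ContDiff ℝ ∞ η)
    (hηc : HasCompactSupport η) :
    ∀ᵐ p ∂slab d T, (∀ v, 0 ≤ defectDensity α B ρ (p.1, p.2, v)) ∧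
      ∫ v, deriv η v * defectDensity α B ρ (p.1, p.2, v)
        = η (ρ p.1 p.2) * fracLap α (fun y => B (ρ p.1 y)) p.2
          - fracLap α (fun y => ∫ v in (0 : ℝ)..ρ p.1 y, η v * deriv B v) p.2 := by
  have hBρ := hρ.comp_lipschitz h.lipschitz h.zero
  obtain ⟨c, hc⟩ := h.exists_lipschitz_primitive hη hηc
  have hβρ := hρ.comp_lipschitz hc (by simp)
  have hη' : Integrable (deriv η) :=
    (hη.continuous_deriv (by simp)).integrable_of_hasCompactSupport hηc.deriv
  filter_upwards [hBρ.ae_integrable_diff_div hd hT hα, hβρ.ae_integrable_diff_div hd hT hα]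
    with ⟨t, x⟩ hi hiβ
  simp only at hi hiβ ⊢
  have hN := defectDensity_eq (α := α) h.lipschitz.continuous hρ.measurable hi
  have hpos : ∀ z : E d, 0 ≤ ‖z‖ ^ ((d : ℝ) + α) := fun z => by positivity
  refine ⟨fun v => ?_, ?_⟩
  · rw [hN]
    exact mul_nonneg (fracConst_nonneg d hα) (integral_nonneg fun z =>
      div_nonneg (defectKernel_nonneg h.monotone _ _ _) (hpos z))
  simp only [hN]
  -- Fubini in (v,z), with the product of η' and the difference quotient of B(ρ) as majorant.
  have hprod : Integrable (fun w : ℝ × E d => deriv η w.1 *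
      (defectKernel B (ρ t x) (ρ t (w.2 + x)) w.1 / ‖w.2‖ ^ ((d : ℝ) + α))) := by
    refine (hη'.mul_prod hi).mono ?_ (Eventually.of_forall fun w => ?_)
    · have hN : Measurable fun w : ℝ × E d => ‖w.2‖ ^ ((d : ℝ) + α) := by fun_prop
      exact (((measurable_deriv η).comp measurable_fst).mul ((measurable_defectKernel_translate
        h.lipschitz.continuous hρ.measurable t (ρ t x) x).div hN)).aestronglyMeasurable
    · rw [norm_mul, norm_mul, norm_div, norm_div]
      exact mul_le_mul_of_nonneg_left (div_le_div_of_nonneg_right (abs_defectKernel_le _ _ _)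
        (norm_nonneg _)) (norm_nonneg _)
  calc ∫ v, deriv η v * (fracConst d α *
          ∫ z : E d, defectKernel B (ρ t x) (ρ t (z + x)) v / ‖z‖ ^ ((d : ℝ) + α))
      = fracConst d α * ∫ v, ∫ z : E d, deriv η v *
          (defectKernel B (ρ t x) (ρ t (z + x)) v / ‖z‖ ^ ((d : ℝ) + α)) := by
        rw [← integral_const_mul]
        refine integral_congr_ae (Eventually.of_forall fun v => ?_)
        simp only
        rw [integral_const_mul]; ring
    _ = fracConst d α * ∫ z : E d, ∫ v, deriv η v *
          (defectKernel B (ρ t x) (ρ t (z + x)) v / ‖z‖ ^ ((d : ℝ) + α)) := by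
        rw [integral_integral_swap hprod]
    _ = fracConst d α * ∫ z : E d,
          (η (ρ t x) * ((B (ρ t x) - B (ρ t (z + x))) / ‖z‖ ^ ((d : ℝ) + α))
          - ((∫ v in (0 : ℝ)..ρ t x, η v * deriv B v)
              - ∫ v in (0 : ℝ)..ρ t (z + x), η v * deriv B v) / ‖z‖ ^ ((d : ℝ) + α)) := by
        congr 1
        refine integral_congr_ae (Eventually.of_forall fun z => ?_)
        simp only [← mul_div_assoc]
        rw [integral_div, integral_deriv_mul_defectKernel h.monotone h.lipschitz hη]
        ring
    _ = _ := by
        rw [integral_sub (hi.const_mul _) hiβ, integral_const_mul, mul_sub, mul_left_comm]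
        rfl

/-- The defect measure tested against a tensor product. -/
lemma integral_defectMeasure (h : CoefficientBounds F A B K) (hρ : TranslationBounded T M C ρ)
    (hd : 0 < d) (hT : 0 < T) (hα : α ∈ Ioo (0 : ℝ) 1) (hη : ContDiff ℝ ∞ η)
    (hηc : HasCompactSupport η)
    (hi : Integrable (fun p : ℝ × E d × ℝ => θ p.1 * ψ p.2.1 * deriv η p.2.2)
      (defectMeasure α T B ρ)) :
    ∫ p, θ p.1 * ψ p.2.1 * deriv η p.2.2 ∂defectMeasure α T B ρ
      = ∫ p, θ p.1 * ψ p.2 * (η (ρ p.1 p.2) * fracLap α (fun y => B (ρ p.1 y)) p.2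
          - fracLap α (fun y => ∫ v in (0 : ℝ)..ρ p.1 y, η v * deriv B v) p.2) ∂slab d T := by
  have hNm : Measurable fun p => ENNReal.ofReal (defectDensity α B ρ p) :=
    (measurable_defectDensity h.lipschitz.continuous hρ.measurable).ennreal_ofReal
  have hfin : ∀ᵐ p ∂(volume : Measure (ℝ × E d × ℝ)).restrict (kineticDomain d T),
      ENNReal.ofReal (defectDensity α B ρ p) < ⊤ :=
    Eventually.of_forall fun p => ENNReal.ofReal_lt_top
  rw [defectMeasure, integrable_withDensity_iff_integrable_smul' hNm hfin,
    integrable_kineticDomain_iff] at hi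
  rw [defectMeasure, integral_withDensity_eq_integral_toReal_smul hNm hfin,
    integral_kineticDomain hi]
  refine integral_congr_ae ?_
  -- Nonnegativity of the density undoes the truncation by `ENNReal.ofReal` in the measure.
  filter_upwards [ae_defectDensity h hρ hd hT hα hη hηc] with p ⟨h0, h1⟩
  rw [← h1, ← integral_const_mul]
  refine integral_congr_ae (Eventually.of_forall fun v => ?_)
  simp only [smul_eq_mul]
  rw [ENNReal.toReal_ofReal (h0 v)]; ring

/-- The mass of a measure on bounded sets of velocities is finite. -/
def StripFinite (μ : Measure (ℝ × E d × ℝ)) : Prop :=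
  ∀ R : ℝ, μ {p | |p.2.2| ≤ R} < ⊤

lemma StripFinite.integrable {μ : Measure (ℝ × E d × ℝ)} (hμ : StripFinite μ)
    {g : ℝ × E d × ℝ → ℝ} (hg : Measurable g) {c R : ℝ} (hb : ∀ p, |g p| ≤ c)
    (h0 : ∀ p, R < |p.2.2| → g p = 0) : Integrable g μ := by
  have hs : Function.support g ⊆ {p | |p.2.2| ≤ R} := fun p hp => by
    by_contra hn
    exact hp (h0 p (not_le.1 hn))
  rw [← integrableOn_iff_integrable_of_support_subset hs]
  exact Measure.integrableOn_of_bounded (M := c) (hμ R).ne hg.aestronglyMeasurable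
    (Eventually.of_forall hb)

lemma StripFinite.mono {μ ν : Measure (ℝ × E d × ℝ)} (hμ : StripFinite μ) (h : ν ≤ μ) :
    StripFinite ν := fun R => (h _).trans_lt (hμ R)

/-- The entropy identity for the multiplier `η`, tested against `θ(t)ψ(x)`: the nonlocal part of
the defect measure turns the diffusion into `η(ρ) (-Δ)^{α/2} B(ρ)`. -/
theorem entropy_identity (h : CoefficientBounds F A B K) (hρ : TranslationBounded T M C ρ)
    (hd : 0 < d) (hT : 0 < T) (hα : α ∈ Ioo (0 : ℝ) 1) {ρ₀ : E d → ℝ} (hρ₀ : Integrable ρ₀)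
    {m : Measure (ℝ × E d × ℝ)} (hsol : SolvesKineticEq α T F A B ρ₀ ρ (m + defectMeasure α T B ρ))
    (hfin : StripFinite (m + defectMeasure α T B ρ))
    (hθ : ContDiff ℝ ∞ θ) (hθc : HasCompactSupport θ) (hθT : tsupport θ ⊆ Iio T)
    (hψ : ContDiff ℝ ∞ ψ) (hψc : HasCompactSupport ψ)
    (hη : ContDiff ℝ ∞ η) (hηc : HasCompactSupport η) :
    Integrable (localIntegrand F A ρ θ ψ η) (slab d T) ∧
    Integrable (fun p => θ p.1 * ψ p.2 * (η (ρ p.1 p.2) * fracLap α (fun y => B (ρ p.1 y)) p.2))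
      (slab d T) ∧
    ∫ p, localIntegrand F A ρ θ ψ η p ∂slab d T
        - ∫ p, θ p.1 * ψ p.2 * (η (ρ p.1 p.2) * fracLap α (fun y => B (ρ p.1 y)) p.2) ∂slab d T
        + θ 0 * ∫ x, ψ x * ∫ v in (0 : ℝ)..ρ₀ x, η v
      = ∫ p, θ p.1 * ψ p.2.1 * deriv η p.2.2 ∂m := by
  obtain ⟨cη, hcη⟩ := hηc.exists_bound_of_continuous hη.continuous
  obtain ⟨cη', hcη'⟩ := hηc.deriv.exists_bound_of_continuous (hη.continuous_deriv (by simp))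
  obtain ⟨cθ, hcθ⟩ := hθc.exists_bound_of_continuous hθ.continuous
  obtain ⟨cψ, hcψ⟩ := hψc.exists_bound_of_continuous hψ.continuous
  obtain ⟨R, hR, hηR⟩ := abs_le_of_mem_tsupport hηc.deriv
  have hθψ : ∀ p : ℝ × E d, ‖θ p.1 * ψ p.2‖ ≤ cθ * cψ := fun p => by
    rw [norm_mul]; exact mul_le_mul (hcθ _) (hcψ _) (norm_nonneg _) ((norm_nonneg _).trans (hcθ 0))
  have hθψm : Measurable fun p : ℝ × E d => θ p.1 * ψ p.2 := by
    have := hθ.continuous; have := hψ.continuous; fun_prop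
  have hηd : Differentiable ℝ η := hη.differentiable (by simp)
  set φ : ℝ × E d × ℝ → ℝ := fun p => θ p.1 * ψ p.2.1 * η p.2.2 with hφ
  have htest : IsTestFunction T φ := by
    refine ⟨((hθ.comp contDiff_fst).mul (hψ.comp (contDiff_fst.comp contDiff_snd))).mul
      (hη.comp (contDiff_snd.comp contDiff_snd)), ?_, ?_⟩
    · refine HasCompactSupport.intro (hθc.isCompact.prod (hψc.isCompact.prod hηc.isCompact))
        fun p hp => ?_
      simp only [mem_prod, not_and_or] at hp
      rcases hp with hp | hp | hp <;> simp [hφ, image_eq_zero_of_notMem_tsupport hp]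
    · have hcl : IsClosed (tsupport θ ×ˢ (univ : Set (E d × ℝ))) :=
        (isClosed_tsupport θ).prod isClosed_univ
      refine (closure_minimal (fun p hp => ?_) hcl).trans (prod_mono hθT subset_rfl)
      refine ⟨subset_tsupport θ fun h0 => hp ?_, mem_univ _⟩
      simp [hφ, h0]
  obtain ⟨jloc, jβ, eloc⟩ := integral_chi_mul_adjointOp (α := α) h hρ hd hα hθ hθc hψ hψc hη hηc
  have hL := (hρ.comp_lipschitz h.lipschitz h.zero).integrable_fracLap hd hT hα
  have jL : Integrable (fun p => θ p.1 * ψ p.2 *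
      (η (ρ p.1 p.2) * fracLap α (fun y => B (ρ p.1 y)) p.2)) (slab d T) :=
    (hL.bdd_mul (c := cη) (hη.continuous.measurable.comp hρ.measurable).aestronglyMeasurable
      (Eventually.of_forall fun p => hcη _)).bdd_mul (c := cθ * cψ) hθψm.aestronglyMeasurable
      (Eventually.of_forall hθψ)
  obtain ⟨c, hc⟩ := h.exists_lipschitz_primitive hη hηc
  have hβρ := hρ.comp_lipschitz hc (by simp)
  have jβ' := (hβρ.integrable_fracLap hd hT hα).bdd_mul (c := cθ * cψ) hθψm.aestronglyMeasurable
      (Eventually.of_forall hθψ)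
  -- Symmetry moves (-Δ)^{α/2} from ψ to β(ρ). In this form the diffusion of the kinetic equation
  -- cancels the β-part of the defect measure.
  have hsym := hβρ.integral_mul_fracLap hd hT hα hθ.continuous.measurable hcθ hψ hψc
  refine ⟨jloc, jL, ?_⟩
  have hgm : Measurable fun p : ℝ × E d × ℝ => θ p.1 * ψ p.2.1 * deriv η p.2.2 := by
    have := hθ.continuous; have := hψ.continuous; have := hη.continuous_deriv (by simp); fun_prop
  have hgi : ∀ ν : Measure (ℝ × E d × ℝ), StripFinite ν →
      Integrable (fun p : ℝ × E d × ℝ => θ p.1 * ψ p.2.1 * deriv η p.2.2) ν := fun ν hν =>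
    hν.integrable hgm (c := cθ * cψ * cη') (R := R) (fun p => by
      rw [abs_mul]
      exact mul_le_mul (hθψ (p.1, p.2.1)) (hcη' _) (abs_nonneg _)
        ((norm_nonneg _).trans (hθψ (p.1, p.2.1)))) (fun p hp => by rw [hηR _ hp, mul_zero])
  have im := hgi m (hfin.mono (Measure.le_add_right le_rfl))
  have id := hgi (defectMeasure α T B ρ) (hfin.mono (Measure.le_add_left le_rfl))
  have key := hsol φ htest
  have e1 : ∀ p : ℝ × E d × ℝ, deriv (fun w => φ (p.1, p.2.1, w)) p.2.2
      = θ p.1 * ψ p.2.1 * deriv η p.2.2 := fun p => by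
    simp only [hφ]
    exact ((hηd p.2.2).hasDerivAt.const_mul (θ p.1 * ψ p.2.1)).deriv
  simp only [e1] at key
  rw [integral_add_measure im id, integral_defectMeasure h hρ hd hT hα hη hηc id,
    eloc] at key
  have e2 : ∫ q : E d × ℝ, chi (ρ₀ q.1) q.2 * φ (0, q.1, q.2)
      = θ 0 * ∫ x, ψ x * ∫ v in (0 : ℝ)..ρ₀ x, η v := by
    have hi : Integrable (fun q : E d × ℝ => chi (ρ₀ q.1) q.2 * φ (0, q.1, q.2)) := by
      refine (integrable_chi_comp hρ₀).mul_bdd (c := cθ * cψ * cη) ?_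
        (Eventually.of_forall fun q => ?_)
      · exact (htest.1.continuous.comp (by fun_prop)).aestronglyMeasurable
      · rw [hφ, norm_mul]
        exact mul_le_mul (hθψ (0, q.1)) (hcη _) (norm_nonneg _)
          ((norm_nonneg _).trans (hθψ (0, q.1)))
    rw [Measure.volume_eq_prod, integral_prod _ hi, ← integral_const_mul]
    refine integral_congr_ae (Eventually.of_forall fun x => ?_)
    simp only [hφ, mul_left_comm (chi _ _)]
    rw [integral_const_mul, integral_chi_mul hη.continuous.locallyIntegrable]
    ring
  have e3 : ∫ p, θ p.1 * ψ p.2 * (η (ρ p.1 p.2) * fracLap α (fun y => B (ρ p.1 y)) p.2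
          - fracLap α (fun y => ∫ v in (0 : ℝ)..ρ p.1 y, η v * deriv B v) p.2) ∂slab d T
      = ∫ p, θ p.1 * ψ p.2 * (η (ρ p.1 p.2) * fracLap α (fun y => B (ρ p.1 y)) p.2) ∂slab d T
        - ∫ p, θ p.1 * (∫ v in (0 : ℝ)..ρ p.1 p.2, η v * deriv B v) * fracLap α ψ p.2
            ∂slab d T := by
    rw [← hsym, ← integral_sub jL jβ']
    simp only [mul_sub]
  rw [e2, e3] at key
  linarith

end Defect

/-! ### Velocity cutoffs and the tail of the dissipation. -/

/-- A smooth cutoff in the velocity variable at scale `R`. -/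
def cutoff (R v : ℝ) : ℝ :=
  (⟨1, 2, one_pos, one_lt_two⟩ : ContDiffBump (0 : ℝ)) (R⁻¹ * v)

lemma contDiff_cutoff (R : ℝ) : ContDiff ℝ ∞ (cutoff R) :=
  (ContDiffBump.contDiff _).comp (contDiff_const.mul contDiff_id)

lemma cutoff_nonneg (R v : ℝ) : 0 ≤ cutoff R v := ContDiffBump.nonneg _

lemma cutoff_le_one (R v : ℝ) : cutoff R v ≤ 1 := ContDiffBump.le_one _

lemma abs_cutoff_le_one (R v : ℝ) : |cutoff R v| ≤ 1 := by
  rw [abs_of_nonneg (cutoff_nonneg R v)]; exact cutoff_le_one R v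

lemma cutoff_eq_one {R v : ℝ} (hR : 0 < R) (hv : |v| ≤ R) : cutoff R v = 1 := by
  refine ContDiffBump.one_of_mem_closedBall _ ?_
  rw [mem_closedBall_zero_iff, norm_mul, norm_inv, Real.norm_of_nonneg hR.le, Real.norm_eq_abs,
    inv_mul_le_iff₀ hR]
  simpa using hv

lemma cutoff_eq_zero {R v : ℝ} (hR : 0 < R) (hv : 2 * R ≤ |v|) : cutoff R v = 0 := by
  refine ContDiffBump.zero_of_le_dist _ ?_
  rw [dist_zero_right, norm_mul, norm_inv, Real.norm_of_nonneg hR.le, Real.norm_eq_abs,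
    le_inv_mul_iff₀ hR]
  simpa [mul_comm] using hv

lemma hasCompactSupport_cutoff {R : ℝ} (hR : 0 < R) : HasCompactSupport (cutoff R) :=
  HasCompactSupport.intro (isCompact_closedBall (0 : ℝ) (2 * R)) fun v hv =>
    cutoff_eq_zero hR (by
      rw [mem_closedBall_zero_iff, not_le, Real.norm_eq_abs] at hv; exact hv.le)

/-- Scaling of one fixed bump: the constant does not depend on R, and the derivative lives on the
shell where the bump leaves 1 and reaches 0. -/
lemma exists_deriv_cutoff_bound : ∃ c : ℝ, 0 ≤ c ∧ ∀ R v : ℝ, 0 < R →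
    |deriv (cutoff R) v| ≤ c / R * {v : ℝ | R ≤ |v| ∧ |v| ≤ 2 * R}.indicator (fun _ => 1) v := by
  set f : ContDiffBump (0 : ℝ) := ⟨1, 2, one_pos, one_lt_two⟩ with hf
  have hfd : ContDiff ℝ ∞ f := f.contDiff
  obtain ⟨c, hc⟩ := f.hasCompactSupport.deriv.exists_bound_of_continuous
    (hfd.continuous_deriv (by simp))
  have hc0 : 0 ≤ c := (norm_nonneg _).trans (hc 0)
  refine ⟨c, hc0, fun R v hR => ?_⟩
  by_cases hv : R ≤ |v| ∧ |v| ≤ 2 * R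
  · rw [indicator_of_mem (by exact hv), mul_one]
    have hd : HasDerivAt (cutoff R) (deriv f (R⁻¹ * v) * R⁻¹) v := by
      have h1 : HasDerivAt (fun w : ℝ => R⁻¹ * w) R⁻¹ v := by
        simpa using (hasDerivAt_id v).const_mul R⁻¹
      exact ((hfd.differentiable (by simp)) _).hasDerivAt.comp v h1
    rw [hd.deriv, abs_mul, abs_inv, abs_of_pos hR, div_eq_mul_inv]
    exact mul_le_mul_of_nonneg_right (hc _) (by positivity)
  · rw [indicator_of_notMem (by exact hv), mul_zero]
    refine le_of_eq (abs_eq_zero.2 ?_)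
    rw [not_and_or, not_le, not_le] at hv
    rcases hv with hv | hv
    · have : cutoff R =ᶠ[𝓝 v] fun _ => 1 := by
        filter_upwards [(continuous_abs.isOpen_preimage _ isOpen_Iio).mem_nhds
          (show v ∈ abs ⁻¹' Iio R from hv)] with w hw
        exact cutoff_eq_one hR (le_of_lt hw)
      rw [this.deriv_eq]; simp
    · have : cutoff R =ᶠ[𝓝 v] fun _ => 0 := by
        filter_upwards [(continuous_abs.isOpen_preimage _ isOpen_Ioi).mem_nhds
          (show v ∈ abs ⁻¹' Ioi (2 * R) from hv)] with w hw
        exact cutoff_eq_zero hR (le_of_lt hw)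
      rw [this.deriv_eq]; simp

lemma tendsto_cutoff (v : ℝ) : Tendsto (fun n : ℕ => cutoff ((n : ℝ) + 1) v) atTop (𝓝 1) := by
  refine tendsto_const_nhds.congr' ?_
  filter_upwards [eventually_ge_atTop ⌈|v|⌉₊] with n hn
  have h1 : |v| ≤ n := (Nat.le_ceil _).trans (by exact_mod_cast hn)
  exact (cutoff_eq_one (by positivity) (by linarith)).symm

section Tail

variable {d : ℕ}

/-- The dissipation measure is finite on bounded sets of velocities and its mean density on dyadic
shells of velocities vanishes at infinity. -/
structure VanishingTail (m : Measure (ℝ × E d × ℝ)) : Prop where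
  stripFinite : StripFinite m
  tail : ∀ ε : ℝ, 0 < ε → ∃ R₀ : ℝ, ∀ R, R₀ ≤ R → 0 < R →
    m {p | R ≤ |p.2.2| ∧ |p.2.2| ≤ 2 * R} ≤ ENNReal.ofReal (ε * R)

/-- A bounded density of the velocity marginal makes strips finite; its decay makes a shell at scale
R, of length comparable to R, carry mass o(R). Both pass from the full dissipation μ to the smaller
m. -/
lemma vanishingTail_of_map {m μ : Measure (ℝ × E d × ℝ)} (hm : m ≤ μ) {g : ℝ → ℝ≥0∞}
    (hg : MemLinftyZero g) (hμ : μ.map (fun p => p.2.2) = volume.withDensity g) :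
    StripFinite μ ∧ VanishingTail m := by
  have hmeas : Measurable fun p : ℝ × E d × ℝ => p.2.2 := measurable_snd.comp measurable_snd
  have happ : ∀ s : Set ℝ, MeasurableSet s → μ {p | p.2.2 ∈ s} = ∫⁻ v in s, g v := fun s hs => by
    rw [← withDensity_apply _ hs, ← hμ, Measure.map_apply hmeas hs]; rfl
  obtain ⟨-, ⟨C, hC⟩, htail⟩ := hg
  have hfin : StripFinite μ := fun R => by
    have hs : MeasurableSet {v : ℝ | |v| ≤ R} := measurableSet_le continuous_abs.measurable measurable_const
    have e := happ _ hs
    simp only [mem_ofPred_eq] at e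
    rw [e]
    calc ∫⁻ v in {v : ℝ | |v| ≤ R}, g v ≤ ∫⁻ _ in {v : ℝ | |v| ≤ R}, (C : ℝ≥0∞) :=
          lintegral_mono_ae (ae_restrict_of_ae hC)
      _ < ⊤ := by
        rw [setLIntegral_const]
        refine ENNReal.mul_lt_top ENNReal.coe_lt_top ?_
        have : {v : ℝ | |v| ≤ R} = Icc (-R) R := by
          ext v; simp only [mem_ofPred_eq, mem_Icc, abs_le]
        rw [this]; exact measure_Icc_lt_top
  refine ⟨hfin, hfin.mono hm, fun ε hε => ?_⟩
  -- The shell lies in [-2R, 2R], of length 4R. Starting at R₀ + 1 below turns R ≤ |v| into the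
  -- strict inequality R₀ < |v|.
  obtain ⟨R₀, hR₀⟩ := htail (ε / 4).toNNReal (Real.toNNReal_pos.2 (by positivity))
  refine ⟨R₀ + 1, fun R hR hR0 => (hm _).trans ?_⟩
  have hs : MeasurableSet {v : ℝ | R ≤ |v| ∧ |v| ≤ 2 * R} :=
    (measurableSet_le measurable_const continuous_abs.measurable).inter
      (measurableSet_le continuous_abs.measurable measurable_const)
  have e := happ _ hs
  simp only [mem_ofPred_eq] at e
  rw [e]
  calc ∫⁻ v in {v : ℝ | R ≤ |v| ∧ |v| ≤ 2 * R}, g v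
      ≤ ∫⁻ _ in {v : ℝ | R ≤ |v| ∧ |v| ≤ 2 * R}, ENNReal.ofReal (ε / 4) := by
        refine lintegral_mono_ae ((ae_restrict_iff' hs).2 ?_)
        filter_upwards [hR₀] with v hv hvR
        have h1 : R ≤ |v| := hvR.1
        exact hv (by linarith)
    _ ≤ ENNReal.ofReal (ε / 4) * volume (Icc (-(2 * R)) (2 * R)) := by
        rw [setLIntegral_const]
        gcongr
        exact fun v hv => abs_le.1 hv.2
    _ = ENNReal.ofReal (ε * R) := by
        rw [Real.volume_Icc, ← ENNReal.ofReal_mul (by positivity)]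
        congr 1; ring

lemma StripFinite.integrable_velocity {m : Measure (ℝ × E d × ℝ)} (hm : StripFinite m)
    {g : ℝ → ℝ} (hg : Continuous g) (hc : HasCompactSupport g) :
    Integrable (fun p : ℝ × E d × ℝ => g p.2.2) m := by
  obtain ⟨c, hc'⟩ := hc.exists_bound_of_continuous hg
  obtain ⟨R, -, hR⟩ := abs_le_of_mem_tsupport hc
  exact hm.integrable (hg.measurable.comp (measurable_snd.comp measurable_snd)) (c := c) (R := R)
    (fun p => hc' _) fun p hp => hR _ hp

/-- Derivative of size c/R times mass at most a small multiple of R: the scale R drops out and the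
small factor remains. -/
lemma VanishingTail.tendsto_cutoff {m : Measure (ℝ × E d × ℝ)} (hm : VanishingTail m) :
    Tendsto (fun n : ℕ => ∫ p, |deriv (cutoff ((n : ℝ) + 1)) p.2.2| ∂m) atTop (𝓝 0) := by
  obtain ⟨c, hc0, hc⟩ := exists_deriv_cutoff_bound
  refine Metric.tendsto_atTop.2 fun ε hε => ?_
  -- With this choice the product with c/R is ε c/(2(c+1)) < ε; adding 1 to c covers c = 0.
  obtain ⟨R₀, hR₀⟩ := hm.tail (ε / (2 * (c + 1))) (by positivity)
  refine ⟨⌈R₀⌉₊, fun n hn => ?_⟩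
  set R : ℝ := (n : ℝ) + 1 with hR
  have hRpos : 0 < R := by positivity
  have hle : R₀ ≤ R := by
    have h1 : R₀ ≤ n := (Nat.le_ceil _).trans (by exact_mod_cast hn)
    linarith
  have hs : MeasurableSet {p : ℝ × E d × ℝ | R ≤ |p.2.2| ∧ |p.2.2| ≤ 2 * R} :=
    (measurableSet_le measurable_const (measurable_snd.comp measurable_snd).norm).inter
      (measurableSet_le (measurable_snd.comp measurable_snd).norm measurable_const)
  have hmt := hR₀ R hle hRpos
  have hi := hm.stripFinite.integrable_velocity ((contDiff_cutoff R).continuous_deriv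
    (by simp)).abs (hasCompactSupport_cutoff hRpos).deriv.abs
  have hbound : ∫ p, |deriv (cutoff R) p.2.2| ∂m ≤ c / R * (ε / (2 * (c + 1)) * R) := by
    calc ∫ p, |deriv (cutoff R) p.2.2| ∂m
        ≤ ∫ p, c / R * {p : ℝ × E d × ℝ | R ≤ |p.2.2| ∧ |p.2.2| ≤ 2 * R}.indicator
            (fun _ => (1 : ℝ)) p ∂m := by
          refine integral_mono hi (Integrable.const_mul ((integrable_indicator_iff hs).2
            (integrableOn_const (hmt.trans_lt ENNReal.ofReal_lt_top).ne)) _) fun p => ?_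
          exact hc R p.2.2 hRpos
      _ = c / R * (m {p : ℝ × E d × ℝ | R ≤ |p.2.2| ∧ |p.2.2| ≤ 2 * R}).toReal := by
          rw [integral_const_mul, integral_indicator hs]
          simp [Measure.real]
      _ ≤ _ := by
          refine mul_le_mul_of_nonneg_left ?_ (by positivity)
          exact (ENNReal.toReal_mono ENNReal.ofReal_ne_top hmt).trans_eq
            (ENNReal.toReal_ofReal (by positivity))
  rw [Real.dist_eq, sub_zero, abs_of_nonneg (integral_nonneg fun _ => abs_nonneg _)]
  refine hbound.trans_lt ?_
  have e : c / R * (ε / (2 * (c + 1)) * R) = ε * (c / (2 * (c + 1))) := by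
    field_simp
  rw [e]
  have : c / (2 * (c + 1)) < 1 := by rw [div_lt_one (by positivity)]; linarith
  nlinarith

end Tail

/-! ### Entropy solutions and step-function multipliers. -/

/-- The entropy formulation extracted from the kinetic equation: for every smooth compactly
supported multiplier the entropy identity with dissipation measure `m` holds. -/
structure EntropySolution {d : ℕ} (α T : ℝ) (F : ℝ → E d) (A B : ℝ → ℝ) (K : ℝ≥0) (M C : ℝ)
    (ρ₀ : E d → ℝ) (ρ : ℝ → E d → ℝ) (m : Measure (ℝ × E d × ℝ)) : Prop where
  dim_pos : 0 < d
  time_pos : 0 < T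
  order : α ∈ Ioo (0 : ℝ) 1
  coeff : CoefficientBounds F A B K
  bounded : TranslationBounded T M C ρ
  initial : Integrable ρ₀
  tail : VanishingTail m
  identity : ∀ (θ : ℝ → ℝ) (ψ : E d → ℝ) (η : ℝ → ℝ), ContDiff ℝ ∞ θ → HasCompactSupport θ →
    tsupport θ ⊆ Iio T → ContDiff ℝ ∞ ψ → HasCompactSupport ψ →
    ContDiff ℝ ∞ η → HasCompactSupport η →
    ∫ p, localIntegrand F A ρ θ ψ η p ∂slab d T
        - ∫ p, θ p.1 * ψ p.2 * (η (ρ p.1 p.2) * fracLap α (fun y => B (ρ p.1 y)) p.2) ∂slab d T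
        + θ 0 * ∫ x, ψ x * ∫ v in (0 : ℝ)..ρ₀ x, η v
      = ∫ p, θ p.1 * ψ p.2.1 * deriv η p.2.2 ∂m

lemma abs_primitive_le {g : ℝ → ℝ} {c : ℝ} (hb : ∀ v, |g v| ≤ c) (r : ℝ) :
    |∫ v in (0 : ℝ)..r, g v| ≤ c * |r| := by
  simpa using intervalIntegral.norm_integral_le_of_norm_le_const (f := g) (a := 0) (b := r)
    fun v _ => hb v

section Inequality

variable {d : ℕ} {F : ℝ → E d} {A B : ℝ → ℝ} {K : ℝ≥0} {α T M C : ℝ} {ρ₀ : E d → ℝ}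
  {ρ : ℝ → E d → ℝ} {m : Measure (ℝ × E d × ℝ)} {θ H : ℝ → ℝ} {ψ : E d → ℝ}

/-- A majorant common to all multipliers dominated by one compactly supported H, as dominated
convergence requires. The source contributes a bounded multiple of θψ, because A is bounded on the
support of H; no growth condition on A enters. -/
lemma CoefficientBounds.exists_localIntegrand_bound (h : CoefficientBounds F A B K)
    (ρ : ℝ → E d → ℝ) (hθ : ContDiff ℝ ∞ θ) (hθc : HasCompactSupport θ) (hψ : ContDiff ℝ ∞ ψ)
    (hψc : HasCompactSupport ψ) (hH : Continuous H) (hHc : HasCompactSupport H) :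
    ∃ c : ℝ, ∀ η : ℝ → ℝ, (∀ v, |η v| ≤ |H v|) → ∀ p,
      |localIntegrand F A ρ θ ψ η p| ≤ c * |ρ p.1 p.2| + c * |θ p.1 * ψ p.2| := by
  obtain ⟨cH, hcH⟩ := hHc.exists_bound_of_continuous hH
  obtain ⟨R, hR, hHR⟩ := abs_le_of_mem_tsupport hHc
  obtain ⟨cθ, hcθ⟩ := hθc.exists_bound_of_continuous hθ.continuous
  obtain ⟨cθ', hcθ'⟩ := hθc.deriv.exists_bound_of_continuous (hθ.continuous_deriv (by simp))
  obtain ⟨cψ, hcψ⟩ := hψc.exists_bound_of_continuous hψ.continuous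
  obtain ⟨cψ', hcψ'⟩ := (hψc.fderiv (𝕜 := ℝ)).exists_bound_of_continuous
    (hψ.continuous_fderiv (by simp))
  obtain ⟨cf, hcf0, hcf⟩ := h.exists_flux_bound hcH hHR
  obtain ⟨cA, hcA⟩ := (hHc.mul_left (f := A)).exists_bound_of_continuous
    (h.continuous_source.mul hH)
  have hcH0 := (norm_nonneg _).trans (hcH 0)
  have hcθ0 := (norm_nonneg _).trans (hcθ 0)
  have hcθ0' := (norm_nonneg _).trans (hcθ' 0)
  have hcψ0 := (norm_nonneg _).trans (hcψ 0)
  have hcψ0' := (norm_nonneg _).trans (hcψ' 0)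
  have hcA0 := (norm_nonneg _).trans (hcA 0)
  refine ⟨cθ' * cψ * cH + cθ * (cψ' * cf) + cA, fun η hη p => ?_⟩
  have b1 : |∫ v in (0 : ℝ)..ρ p.1 p.2, η v| ≤ cH * |ρ p.1 p.2| :=
    abs_primitive_le (fun v => (hη v).trans (hcH v)) _
  have b2 : |fluxPrimitive F η (fderiv ℝ ψ p.2) (ρ p.1 p.2)| ≤ cψ' * cf * |ρ p.1 p.2| := by
    refine abs_primitive_le (fun v => ?_) _
    rw [abs_mul]
    calc |η v| * |fderiv ℝ ψ p.2 (deriv F v)|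
        ≤ |H v| * (cψ' * ‖deriv F v‖) := by
          refine mul_le_mul (hη v) ?_ (abs_nonneg _) (abs_nonneg _)
          exact ((fderiv ℝ ψ p.2).le_opNorm _).trans
            (mul_le_mul_of_nonneg_right (hcψ' _) (norm_nonneg _))
      _ = cψ' * (‖deriv F v‖ * |H v|) := by ring
      _ ≤ cψ' * cf := mul_le_mul_of_nonneg_left (hcf v) hcψ0'
  have b3 : |A (ρ p.1 p.2) * η (ρ p.1 p.2)| ≤ cA := by
    refine le_trans ?_ (hcA (ρ p.1 p.2))
    rw [abs_mul, Pi.mul_apply, norm_mul]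
    exact mul_le_mul_of_nonneg_left (hη _) (abs_nonneg _)
  have c1 : |deriv θ p.1 * ψ p.2| ≤ cθ' * cψ := by
    rw [abs_mul]; exact mul_le_mul (hcθ' _) (hcψ _) (abs_nonneg _) hcθ0'
  have t1 := mul_le_mul c1 b1 (abs_nonneg _) (by positivity)
  have t2 := mul_le_mul (hcθ p.1) b2 (abs_nonneg _) hcθ0
  have t3 := mul_le_mul_of_nonneg_left b3 (abs_nonneg (θ p.1 * ψ p.2))
  rw [← abs_mul] at t1 t3
  rw [Real.norm_eq_abs, ← abs_mul] at t2
  unfold localIntegrand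
  have tri := abs_add_three (deriv θ p.1 * ψ p.2 * ∫ v in (0 : ℝ)..ρ p.1 p.2, η v)
    (θ p.1 * fluxPrimitive F η (fderiv ℝ ψ p.2) (ρ p.1 p.2))
    (θ p.1 * ψ p.2 * (A (ρ p.1 p.2) * η (ρ p.1 p.2)))
  have p1 : 0 ≤ cA * |ρ p.1 p.2| := by positivity
  have p2 : 0 ≤ (cθ' * cψ * cH + cθ * (cψ' * cf)) * |θ p.1 * ψ p.2| := by positivity
  nlinarith

end Inequality

/-- The transport field truncated by `H`, integrated from `0` to `r`. -/
def fluxField {d : ℕ} (F : ℝ → E d) (H : ℝ → ℝ) (r : ℝ) : E d := ∫ v in (0 : ℝ)..r, H v • deriv F v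

lemma integral_fderiv_eq_zero {d : ℕ} {ψ : E d → ℝ} (hψ : ContDiff ℝ ∞ ψ)
    (hψc : HasCompactSupport ψ) (e : E d) : ∫ x, fderiv ℝ ψ x e = 0 := by
  have hc : Continuous fun x => fderiv ℝ ψ x e :=
    (hψ.continuous_fderiv (by simp)).clm_apply continuous_const
  have hcs : HasCompactSupport fun x => fderiv ℝ ψ x e :=
    (hψc.fderiv (𝕜 := ℝ)).comp_left (g := fun L : E d →L[ℝ] ℝ => L e) (by simp)
  have := integral_mul_fderiv_eq_neg_fderiv_mul_of_integrable (μ := volume)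
    (f := fun _ : E d => (1 : ℝ)) (g := ψ) (v := e) (by simp)
    (by simpa using hc.integrable_of_hasCompactSupport hcs)
    (by simpa using hψ.continuous.integrable_of_hasCompactSupport hψc)
    (fun _ _ => differentiableAt_const _) (fun _ _ => hψ.differentiable (by simp) _)
  simpa using this

section Step

lemma Ioc_inter_Ioi' (a b k : ℝ) : Ioc a b ∩ Ioi k = Ioc (max a k) (max b k) := by
  ext v
  simp only [mem_inter_iff, mem_Ioc, mem_Ioi, max_lt_iff, le_max_iff]
  constructor
  · rintro ⟨⟨h1, h2⟩, h3⟩; exact ⟨⟨h1, h3⟩, Or.inl h2⟩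
  · rintro ⟨⟨h1, h2⟩, h3 | h3⟩
    · exact ⟨⟨h1, h3⟩, h2⟩
    · exact absurd h3 (not_le.2 h2)

variable {V : Type*} [NormedAddCommGroup V] [NormedSpace ℝ V]

lemma intervalIntegral_indicator_Ioi (g : ℝ → V) (a b k : ℝ) :
    ∫ v in a..b, (Ioi k).indicator g v = ∫ v in (max a k)..(max b k), g v := by
  simp only [intervalIntegral, setIntegral_indicator measurableSet_Ioi, Ioc_inter_Ioi']

/-- The indicator of `(k,∞)`. -/
def upperStep (k v : ℝ) : ℝ := (Ioi k).indicator (fun _ => 1) v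

/-- Minus the indicator of `(-∞,k)`. -/
def lowerStep (k v : ℝ) : ℝ := -(Iio k).indicator (fun _ => 1) v

/-- Cutting the integrand off below k replaces both endpoints by their maximum with k, so r enters
only through max(r,k). The remaining constant is harmless by `integral_constant_terms`. -/
lemma integral_upperStep_mul {g : ℝ → ℝ} (hg : LocallyIntegrable g) (r k : ℝ) :
    ∫ v in (0 : ℝ)..r, upperStep k v * g v
      = (∫ v in (0 : ℝ)..max r k, g v) - ∫ v in (0 : ℝ)..max 0 k, g v := by
  have hii : ∀ a b, IntervalIntegrable g volume a b := fun a b =>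
    (hg.integrableOn_isCompact isCompact_uIcc).intervalIntegrable
  rw [intervalIntegral.integral_interval_sub_left (hii _ _) (hii _ _),
    ← intervalIntegral_indicator_Ioi]
  refine intervalIntegral.integral_congr fun v _ => ?_
  by_cases hv : v ∈ Ioi k <;> simp [upperStep, hv]

lemma integral_lowerStep_mul {g : ℝ → ℝ} (hg : LocallyIntegrable g) (r k : ℝ) :
    ∫ v in (0 : ℝ)..r, lowerStep k v * g v
      = (∫ v in (0 : ℝ)..max r k, g v) - (∫ v in (0 : ℝ)..r, g v)
        - ∫ v in (0 : ℝ)..max 0 k, g v := by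
  have hii : ∀ a b, IntervalIntegrable g volume a b := fun a b =>
    (hg.integrableOn_isCompact isCompact_uIcc).intervalIntegrable
  have hiu : IntervalIntegrable (fun v => upperStep k v * g v) volume 0 r := by
    have : (fun v => upperStep k v * g v) = (Ioi k).indicator g := by
      ext v; by_cases hv : v ∈ Ioi k <;> simp [upperStep, hv]
    rw [this, intervalIntegrable_iff]
    exact (intervalIntegrable_iff.1 (hii 0 r)).indicator measurableSet_Ioi
  have e : ∫ v in (0 : ℝ)..r, lowerStep k v * g v
      = (∫ v in (0 : ℝ)..r, upperStep k v * g v) - ∫ v in (0 : ℝ)..r, g v := by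
    rw [← intervalIntegral.integral_sub hiu (hii 0 r)]
    refine intervalIntegral.integral_congr_ae ?_
    filter_upwards [Measure.ae_ne volume k] with v hv _
    rcases lt_or_gt_of_ne hv with h | h
    · simp [upperStep, lowerStep, h, h.le]
    · simp [upperStep, lowerStep, h, h.le]
  rw [e, integral_upperStep_mul hg]; ring

lemma tendsto_upperStep (k v : ℝ) :
    Tendsto (fun n : ℕ => Real.smoothTransition (n * (v - k))) atTop (𝓝 (upperStep k v)) := by
  by_cases hv : k < v
  · have : upperStep k v = 1 := by simp [upperStep, hv]
    rw [this]
    refine tendsto_const_nhds.congr' ?_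
    filter_upwards [eventually_ge_atTop ⌈(v - k)⁻¹⌉₊] with n hn
    refine (Real.smoothTransition.one_of_one_le ?_).symm
    have h1 : (v - k)⁻¹ ≤ n := (Nat.le_ceil _).trans (by exact_mod_cast hn)
    have h2 : 0 < v - k := by linarith
    rwa [inv_le_iff_one_le_mul₀ h2] at h1
  · have : upperStep k v = 0 := by simp [upperStep, hv]
    rw [this]
    refine tendsto_const_nhds.congr fun n => ?_
    refine (Real.smoothTransition.zero_of_nonpos ?_).symm
    exact mul_nonpos_of_nonneg_of_nonpos (Nat.cast_nonneg _) (by linarith [not_lt.1 hv])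

/-- The shift by 1 places the transition layer to the left of k, whereas `tendsto_upperStep` has it
to the right. Both limits are thus 0 at v = k, and the two steps match without a convention on ties.
-/
lemma tendsto_lowerStep (k v : ℝ) :
    Tendsto (fun n : ℕ => Real.smoothTransition (1 + n * (v - k)) - 1) atTop
      (𝓝 (lowerStep k v)) := by
  by_cases hv : v < k
  · have : lowerStep k v = -1 := by simp [lowerStep, hv]
    rw [this]
    refine tendsto_const_nhds.congr' ?_
    filter_upwards [eventually_ge_atTop ⌈(k - v)⁻¹⌉₊] with n hn
    have h1 : (k - v)⁻¹ ≤ n := (Nat.le_ceil _).trans (by exact_mod_cast hn)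
    have h2 : 0 < k - v := by linarith
    rw [inv_le_iff_one_le_mul₀ h2] at h1
    rw [Real.smoothTransition.zero_of_nonpos (by linarith), zero_sub]
  · have : lowerStep k v = 0 := by simp [lowerStep, hv]
    rw [this]
    refine tendsto_const_nhds.congr fun n => ?_
    have : (0 : ℝ) ≤ n * (v - k) := mul_nonneg (Nat.cast_nonneg _) (by linarith [not_lt.1 hv])
    rw [Real.smoothTransition.one_of_one_le (by linarith), sub_self]

lemma abs_upperStep_le_one (k v : ℝ) : |upperStep k v| ≤ 1 := by
  by_cases hv : k < v <;> simp [upperStep, hv]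

lemma measurable_upperStep (k : ℝ) : Measurable (upperStep k) :=
  measurable_const.indicator measurableSet_Ioi

end Step

section Inequality

variable {d : ℕ} {F : ℝ → E d} {A B : ℝ → ℝ} {K : ℝ≥0} {α T M C : ℝ} {ρ₀ : E d → ℝ}
  {ρ : ℝ → E d → ℝ} {m : Measure (ℝ × E d × ℝ)} {θ H : ℝ → ℝ} {ψ : E d → ℝ}

lemma EntropySolution.integrable_diffusion (hs : EntropySolution α T F A B K M C ρ₀ ρ m) :
    Integrable (fun p => fracLap α (fun y => B (ρ p.1 y)) p.2) (slab d T) :=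
  (hs.bounded.comp_lipschitz hs.coeff.lipschitz hs.coeff.zero).integrable_fracLap hs.dim_pos
    hs.time_pos hs.order

/-- Passing to the limit in the entropy identity along multipliers `H jₙ` with `jₙ` nondecreasing:
only the part of the dissipation caused by the truncation `H` remains. -/
theorem EntropySolution.inequality (hs : EntropySolution α T F A B K M C ρ₀ ρ m)
    (hθ : ContDiff ℝ ∞ θ) (hθc : HasCompactSupport θ) (hθT : tsupport θ ⊆ Ioo 0 T)
    (hθ0 : ∀ t, 0 ≤ θ t) (hψ : ContDiff ℝ ∞ ψ) (hψc : HasCompactSupport ψ) (hψ0 : ∀ x, 0 ≤ ψ x)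
    (hH : ContDiff ℝ ∞ H) (hHc : HasCompactSupport H) (hH0 : ∀ v, 0 ≤ H v)
    {j : ℕ → ℝ → ℝ} {J : ℝ → ℝ} (hj : ∀ n, ContDiff ℝ ∞ (j n)) (hjm : ∀ n, Monotone (j n))
    (hj1 : ∀ n v, |j n v| ≤ 1) (hJ : ∀ v, Tendsto (fun n => j n v) atTop (𝓝 (J v))) :
    Integrable (localIntegrand F A ρ θ ψ fun v => J v * H v) (slab d T) ∧
    Integrable (fun p => θ p.1 * ψ p.2 * (J (ρ p.1 p.2) * H (ρ p.1 p.2) *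
      fracLap α (fun y => B (ρ p.1 y)) p.2)) (slab d T) ∧
    -∫ p, θ p.1 * ψ p.2.1 * |deriv H p.2.2| ∂m ≤
      ∫ p, localIntegrand F A ρ θ ψ (fun v => J v * H v) p ∂slab d T
        - ∫ p, θ p.1 * ψ p.2 * (J (ρ p.1 p.2) * H (ρ p.1 p.2) *
            fracLap α (fun y => B (ρ p.1 y)) p.2) ∂slab d T := by
  have h := hs.coeff
  have hη : ∀ n, ContDiff ℝ ∞ (fun v => j n v * H v) := fun n => (hj n).mul hH
  have hηc : ∀ n, HasCompactSupport (fun v => j n v * H v) := fun n => hHc.mul_left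
  have hηb : ∀ n v, |j n v * H v| ≤ |H v| := fun n v => by
    rw [abs_mul]; exact mul_le_of_le_one_left (abs_nonneg _) (hj1 n v)
  have hJ1 : ∀ v, |J v| ≤ 1 := fun v =>
    le_of_tendsto (hJ v).abs (Eventually.of_forall fun n => hj1 n v)
  obtain ⟨cH, hcH⟩ := hHc.exists_bound_of_continuous hH.continuous
  obtain ⟨cθ, hcθ⟩ := hθc.exists_bound_of_continuous hθ.continuous
  obtain ⟨cψ, hcψ⟩ := hψc.exists_bound_of_continuous hψ.continuous
  obtain ⟨R, hR, hHR⟩ := abs_le_of_mem_tsupport hHc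
  obtain ⟨c, hc⟩ := h.exists_localIntegrand_bound ρ hθ hθc hψ hψc hH.continuous hHc
  obtain ⟨cf, hcf0, hcf⟩ := h.exists_flux_bound hcH hHR
  have hcθ0 := (norm_nonneg _).trans (hcθ 0)
  have hcψ0 := (norm_nonneg _).trans (hcψ 0)
  have hcH0 := (norm_nonneg _).trans (hcH 0)
  have hθi : Integrable θ := hθ.continuous.integrable_of_hasCompactSupport hθc
  have hψi : Integrable ψ := hψ.continuous.integrable_of_hasCompactSupport hψc
  have hbi : Integrable (fun p : ℝ × E d => c * |ρ p.1 p.2| + c * |θ p.1 * ψ p.2|) (slab d T) :=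
    (hs.bounded.integrable.abs.const_mul _).add ((integrable_slab_mul hθi hψi).abs.const_mul _)
  have hmeas : ∀ n, AEStronglyMeasurable (localIntegrand F A ρ θ ψ fun v => j n v * H v)
      (slab d T) := fun n =>
    (integral_chi_mul_adjointOp h hs.bounded hs.dim_pos hs.order hθ hθc hψ hψc (hη n) (hηc n)).1.1
  have hlim : ∀ p, Tendsto (fun n => localIntegrand F A ρ θ ψ (fun v => j n v * H v) p) atTop
      (𝓝 (localIntegrand F A ρ θ ψ (fun v => J v * H v) p)) := fun p => by
    have hHm := hH.continuous.measurable
    have hjm' : ∀ n, Measurable (j n) := fun n => (hj n).continuous.measurable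
    refine Tendsto.add (Tendsto.add (Tendsto.const_mul _ ?_) (Tendsto.const_mul _ ?_))
      (Tendsto.const_mul _ (Tendsto.const_mul _ ((hJ _).mul_const _)))
    · refine intervalIntegral.tendsto_integral_filter_of_dominated_convergence (fun _ => cH)
        (Eventually.of_forall fun n => ((hjm' n).mul hHm).aestronglyMeasurable)
        (Eventually.of_forall fun n => Eventually.of_forall fun v _ => (hηb n v).trans (hcH v))
        intervalIntegrable_const (Eventually.of_forall fun v _ => (hJ v).mul_const _)
    · refine intervalIntegral.tendsto_integral_filter_of_dominated_convergence
        (fun _ => ‖fderiv ℝ ψ p.2‖ * cf)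
        (Eventually.of_forall fun n => (((hjm' n).mul hHm).mul
          ((fderiv ℝ ψ p.2).continuous.measurable.comp (measurable_deriv F))).aestronglyMeasurable)
        (Eventually.of_forall fun n => Eventually.of_forall fun v _ => ?_)
        intervalIntegrable_const
        (Eventually.of_forall fun v _ => ((hJ v).mul_const _).mul_const _)
      rw [norm_mul]
      calc ‖j n v * H v‖ * ‖fderiv ℝ ψ p.2 (deriv F v)‖
          ≤ |H v| * (‖fderiv ℝ ψ p.2‖ * ‖deriv F v‖) :=
            mul_le_mul (hηb n v) ((fderiv ℝ ψ p.2).le_opNorm _) (norm_nonneg _) (abs_nonneg _)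
        _ = ‖fderiv ℝ ψ p.2‖ * (‖deriv F v‖ * |H v|) := by ring
        _ ≤ _ := mul_le_mul_of_nonneg_left (hcf v) (norm_nonneg _)
  have hJH : ∀ v, |J v * H v| ≤ |H v| := fun v => by
    rw [abs_mul]; exact mul_le_of_le_one_left (abs_nonneg _) (hJ1 v)
  have hi1 : Integrable (localIntegrand F A ρ θ ψ fun v => J v * H v) (slab d T) :=
    hbi.mono' (aestronglyMeasurable_of_tendsto_ae atTop hmeas (Eventually.of_forall hlim))
      (Eventually.of_forall fun p => hc _ hJH p)
  have t1 := tendsto_integral_of_dominated_convergence _ hmeas hbi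
    (fun n => Eventually.of_forall fun p => hc _ (hηb n) p) (Eventually.of_forall hlim)
  have hL := hs.integrable_diffusion
  have hθψm : Measurable fun p : ℝ × E d => θ p.1 * ψ p.2 := by
    have := hθ.continuous; have := hψ.continuous; fun_prop
  have hθψ : ∀ p : ℝ × E d, |θ p.1 * ψ p.2| ≤ cθ * cψ := fun p => by
    rw [abs_mul]; exact mul_le_mul (hcθ _) (hcψ _) (abs_nonneg _) hcθ0
  have hbL : Integrable (fun p => cθ * cψ * (cH * |fracLap α (fun y => B (ρ p.1 y)) p.2|))
      (slab d T) := (hL.abs.const_mul _).const_mul _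
  have hmeas2 : ∀ n, AEStronglyMeasurable (fun p : ℝ × E d => θ p.1 * ψ p.2 *
      (j n (ρ p.1 p.2) * H (ρ p.1 p.2) * fracLap α (fun y => B (ρ p.1 y)) p.2)) (slab d T) :=
    fun n => hθψm.aestronglyMeasurable.mul ((((hη n).continuous.measurable.comp
      hs.bounded.measurable).aestronglyMeasurable).mul hL.1)
  have hbd2 : ∀ g : ℝ → ℝ, (∀ v, |g v| ≤ |H v|) → ∀ p : ℝ × E d, ‖θ p.1 * ψ p.2 *
      (g (ρ p.1 p.2) * fracLap α (fun y => B (ρ p.1 y)) p.2)‖ ≤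
      cθ * cψ * (cH * |fracLap α (fun y => B (ρ p.1 y)) p.2|) := fun g hg p => by
    rw [norm_mul, norm_mul (g _)]
    exact mul_le_mul (hθψ p) (mul_le_mul_of_nonneg_right ((hg _).trans (hcH _)) (abs_nonneg _))
      (by positivity) (by positivity)
  have hlim2 : ∀ p : ℝ × E d, Tendsto (fun n => θ p.1 * ψ p.2 *
      (j n (ρ p.1 p.2) * H (ρ p.1 p.2) * fracLap α (fun y => B (ρ p.1 y)) p.2)) atTop
      (𝓝 (θ p.1 * ψ p.2 * (J (ρ p.1 p.2) * H (ρ p.1 p.2) *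
        fracLap α (fun y => B (ρ p.1 y)) p.2))) := fun p =>
    (((hJ _).mul_const _).mul_const _).const_mul _
  have t2 := tendsto_integral_of_dominated_convergence _ hmeas2 hbL
    (fun n => Eventually.of_forall fun p => hbd2 (fun v => j n v * H v) (hηb n) p)
    (Eventually.of_forall hlim2)
  have hi2 : Integrable (fun p => θ p.1 * ψ p.2 * (J (ρ p.1 p.2) * H (ρ p.1 p.2) *
      fracLap α (fun y => B (ρ p.1 y)) p.2)) (slab d T) :=
    hbL.mono' (aestronglyMeasurable_of_tendsto_ae atTop hmeas2 (Eventually.of_forall hlim2))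
      (Eventually.of_forall fun p => hbd2 (fun v => J v * H v) hJH p)
  refine ⟨hi1, hi2, ge_of_tendsto (t1.sub t2) (Eventually.of_forall fun n => ?_)⟩
  have hid := hs.identity θ ψ (fun v => j n v * H v) hθ hθc
    (hθT.trans Ioo_subset_Iio_self) hψ hψc (hη n) (hηc n)
  have hz : θ 0 = 0 := image_eq_zero_of_notMem_tsupport fun hm => lt_irrefl _ (hθT hm).1
  rw [hz, zero_mul, add_zero] at hid
  -- The limit is taken last: for each n the left-hand side is an integral against m, and the
  -- inequality to prove is pointwise in its integrand.
  rw [hid, ← integral_neg]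
  have hθψm' : Measurable fun p : ℝ × E d × ℝ => θ p.1 * ψ p.2.1 := by
    have := hθ.continuous; have := hψ.continuous; fun_prop
  have hint : ∀ g : ℝ → ℝ, Continuous g → HasCompactSupport g →
      Integrable (fun p : ℝ × E d × ℝ => θ p.1 * ψ p.2.1 * g p.2.2) m := fun g hg hgc =>
    (hs.tail.stripFinite.integrable_velocity hg hgc).bdd_mul (c := cθ * cψ)
      hθψm'.aestronglyMeasurable (Eventually.of_forall fun p => hθψ (p.1, p.2.1))
  refine integral_mono (hint _ (hH.continuous_deriv (by simp)).abs hHc.deriv.abs).neg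
    (hint _ ((hη n).continuous_deriv (by simp)) (hηc n).deriv) fun p => ?_
  -- The first summand is nonnegative by monotonicity of j and is discarded; the second is at least
  -- -|H'|, uniformly in n. This keeps the steepening of j out of the estimate.
  have hd : deriv (fun v => j n v * H v) p.2.2
      = deriv (j n) p.2.2 * H p.2.2 + j n p.2.2 * deriv H p.2.2 :=
    (((hj n).differentiable (by simp) _).hasDerivAt.mul
      (hH.differentiable (by simp) _).hasDerivAt).deriv
  simp only [hd]
  rw [← mul_neg]
  refine mul_le_mul_of_nonneg_left ?_ (mul_nonneg (hθ0 _) (hψ0 _))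
  have h1 : 0 ≤ deriv (j n) p.2.2 * H p.2.2 := mul_nonneg ((hjm n).deriv_nonneg) (hH0 _)
  have h2 : |j n p.2.2 * deriv H p.2.2| ≤ |deriv H p.2.2| := by
    rw [abs_mul]; exact mul_le_of_le_one_left (abs_nonneg _) (hj1 n _)
  linarith [neg_abs_le (j n p.2.2 * deriv H p.2.2)]

end Inequality

/-! ### Kruzhkov inequalities with a frozen state. -/

section Comparison

variable {d : ℕ} {F : ℝ → E d} {A B : ℝ → ℝ} {K : ℝ≥0} {α T M C : ℝ} {ρ₀ : E d → ℝ}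
  {ρ : ℝ → E d → ℝ} {m : Measure (ℝ × E d × ℝ)} {θ H : ℝ → ℝ} {ψ : E d → ℝ}

lemma CoefficientBounds.locallyIntegrable_smul_deriv (h : CoefficientBounds F A B K)
    (hH : Continuous H) (hHc : HasCompactSupport H) :
    LocallyIntegrable fun v => H v • deriv F v := by
  obtain ⟨cH, hcH⟩ := hHc.exists_bound_of_continuous hH
  obtain ⟨R, hR, hHR⟩ := abs_le_of_mem_tsupport hHc
  obtain ⟨cf, hcf0, hcf⟩ := h.exists_flux_bound hcH hHR
  have hi : Integrable fun v => ‖deriv F v‖ * |H v| :=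
    integrable_of_bounded_of_eq_zero
      ((measurable_deriv F).norm.mul hH.measurable.abs).aestronglyMeasurable
      (c := cf) (R := R) (fun v => by rw [abs_of_nonneg (by positivity)]; exact hcf v)
      (fun v hv => by simp [hHR v hv])
  refine (hi.mono' (hH.measurable.smul (measurable_deriv F)).aestronglyMeasurable
    (Eventually.of_forall fun v => ?_)).locallyIntegrable
  simp [norm_smul, mul_comm]

lemma CoefficientBounds.exists_fluxField_lipschitz (h : CoefficientBounds F A B K)
    (hH : Continuous H) (hHc : HasCompactSupport H) :
    ∃ c : ℝ, 0 ≤ c ∧ ∀ r s, ‖fluxField F H r - fluxField F H s‖ ≤ c * |r - s| := by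
  obtain ⟨cH, hcH⟩ := hHc.exists_bound_of_continuous hH
  obtain ⟨R, hR, hHR⟩ := abs_le_of_mem_tsupport hHc
  obtain ⟨cf, hcf0, hcf⟩ := h.exists_flux_bound hcH hHR
  have hii : ∀ a b, IntervalIntegrable (fun v => H v • deriv F v) volume a b := fun a b =>
    ((h.locallyIntegrable_smul_deriv hH hHc).integrableOn_isCompact
      isCompact_uIcc).intervalIntegrable
  refine ⟨cf, hcf0, fun r s => ?_⟩
  rw [fluxField, fluxField, intervalIntegral.integral_interval_sub_left (hii _ _) (hii _ _)]
  refine intervalIntegral.norm_integral_le_of_norm_le_const fun v _ => ?_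
  rw [norm_smul, mul_comm]; exact hcf v

lemma CoefficientBounds.apply_fluxField (h : CoefficientBounds F A B K) (hH : Continuous H)
    (hHc : HasCompactSupport H) (ℓ : E d →L[ℝ] ℝ) (r : ℝ) :
    ∫ v in (0 : ℝ)..r, H v * ℓ (deriv F v) = ℓ (fluxField F H r) := by
  have hii : IntervalIntegrable (fun v => H v • deriv F v) volume 0 r :=
    ((h.locallyIntegrable_smul_deriv hH hHc).integrableOn_isCompact
      isCompact_uIcc).intervalIntegrable
  rw [fluxField, ← ContinuousLinearMap.intervalIntegral_comp_comm _ hii]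
  simp

/-- The derivatives θ' and ∇ψ integrate to zero, so entropy and flux may be normalised at any state
instead of at 0. -/
lemma integral_constant_terms (hT : 0 < T) (hθ : ContDiff ℝ ∞ θ) (hθc : HasCompactSupport θ)
    (hθT : tsupport θ ⊆ Ioo 0 T) (hψ : ContDiff ℝ ∞ ψ) (hψc : HasCompactSupport ψ)
    (c : ℝ) (w : E d) :
    Integrable (fun p : ℝ × E d => deriv θ p.1 * ψ p.2 * c + θ p.1 * fderiv ℝ ψ p.2 w)
      (slab d T) ∧
    ∫ p : ℝ × E d, deriv θ p.1 * ψ p.2 * c + θ p.1 * fderiv ℝ ψ p.2 w ∂slab d T = 0 := by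
  have hθd := hθ.continuous_deriv (by simp)
  have hθi : Integrable θ := hθ.continuous.integrable_of_hasCompactSupport hθc
  have hθi' : Integrable (deriv θ) := hθd.integrable_of_hasCompactSupport hθc.deriv
  have hψi : Integrable ψ := hψ.continuous.integrable_of_hasCompactSupport hψc
  have hψi' : Integrable (fun x => fderiv ℝ ψ x w) :=
    ((hψ.continuous_fderiv (by simp)).clm_apply continuous_const).integrable_of_hasCompactSupport
      ((hψc.fderiv (𝕜 := ℝ)).comp_left (g := fun L : E d →L[ℝ] ℝ => L w) (by simp))
  have i1 := (integrable_slab_mul (T := T) hθi' hψi).mul_const c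
  have i2 := integrable_slab_mul (T := T) hθi hψi'
  refine ⟨i1.add i2, ?_⟩
  have e0 : ∀ t, t ∉ Ioo 0 T → θ t = 0 := fun t ht =>
    image_eq_zero_of_notMem_tsupport fun hm => ht (hθT hm)
  have e1 : ∫ t in Ioo 0 T, deriv θ t = 0 := by
    rw [← integral_Ioc_eq_integral_Ioo, ← intervalIntegral.integral_of_le hT.le,
      intervalIntegral.integral_deriv_eq_sub (fun t _ => hθ.differentiable (by simp) t)
        (hθd.intervalIntegrable _ _), e0 T (by simp), e0 0 (by simp), sub_zero]
  rw [integral_add i1 i2, integral_mul_const, slab, integral_prod_mul,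
    integral_prod_mul θ (fun x => fderiv ℝ ψ x w), e1,
    integral_fderiv_eq_zero hψ hψc]
  simp

/-- Time derivative and transport part of the doubled entropy inequality for the states `a ≥ b`. -/
def comparisonIntegrand (F : ℝ → E d) (H θ : ℝ → ℝ) (ψ : E d → ℝ) (a b : ℝ) (p : ℝ × E d) : ℝ :=
  deriv θ p.1 * ψ p.2 * ((∫ v in (0 : ℝ)..a, H v) - ∫ v in (0 : ℝ)..b, H v)
    + θ p.1 * fderiv ℝ ψ p.2 (fluxField F H a - fluxField F H b)

/-- Source minus diffusion, truncated in the velocity variable. -/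
def truncatedSource (α : ℝ) (A B H : ℝ → ℝ) (ρ : ℝ → E d → ℝ) (p : ℝ × E d) : ℝ :=
  H (ρ p.1 p.2) * (A (ρ p.1 p.2) - fracLap α (fun y => B (ρ p.1 y)) p.2)

/-- The primitive of J g is prescribed for every locally integrable g, because it is needed both for
H and for H times a component of the flux. The terms in c and e are constants in (t,x), so they are
removed by `integral_constant_terms`. -/
lemma EntropySolution.inequality_of_step (hs : EntropySolution α T F A B K M C ρ₀ ρ m)
    (hθ : ContDiff ℝ ∞ θ) (hθc : HasCompactSupport θ) (hθT : tsupport θ ⊆ Ioo 0 T)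
    (hθ0 : ∀ t, 0 ≤ θ t) (hψ : ContDiff ℝ ∞ ψ) (hψc : HasCompactSupport ψ) (hψ0 : ∀ x, 0 ≤ ψ x)
    (hH : ContDiff ℝ ∞ H) (hHc : HasCompactSupport H) (hH0 : ∀ v, 0 ≤ H v)
    {j : ℕ → ℝ → ℝ} {J : ℝ → ℝ} (hj : ∀ n, ContDiff ℝ ∞ (j n)) (hjm : ∀ n, Monotone (j n))
    (hj1 : ∀ n v, |j n v| ≤ 1) (hJ : ∀ v, Tendsto (fun n => j n v) atTop (𝓝 (J v)))
    {a b : ℝ → ℝ} {c e : ℝ}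
    (hJi : ∀ g : ℝ → ℝ, LocallyIntegrable g → ∀ r, ∫ v in (0 : ℝ)..r, J v * g v
      = (∫ v in (0 : ℝ)..a r, g v) - (∫ v in (0 : ℝ)..b r, g v)
        - ((∫ v in (0 : ℝ)..c, g v) - ∫ v in (0 : ℝ)..e, g v)) :
    -∫ p, θ p.1 * ψ p.2.1 * |deriv H p.2.2| ∂m ≤
      ∫ p, comparisonIntegrand F H θ ψ (a (ρ p.1 p.2)) (b (ρ p.1 p.2)) p
        + θ p.1 * ψ p.2 * (J (ρ p.1 p.2) * truncatedSource α A B H ρ p) ∂slab d T := by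
  obtain ⟨i1, i2, h3⟩ := hs.inequality hθ hθc hθT hθ0 hψ hψc hψ0 hH hHc hH0 hj hjm hj1 hJ
  obtain ⟨i4, h4⟩ := integral_constant_terms hs.time_pos hθ hθc hθT hψ hψc
    ((∫ v in (0 : ℝ)..c, H v) - ∫ v in (0 : ℝ)..e, H v) (fluxField F H c - fluxField F H e)
  have i12 := i1.sub i2
  simp only [Pi.sub_def] at i12
  rw [← integral_sub i1 i2, ← add_zero (∫ _, _ ∂slab d T), ← h4, ← integral_add i12 i4] at h3
  refine h3.trans (le_of_eq (integral_congr_ae (Eventually.of_forall fun p => ?_)))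
  have e1 := hJi H hH.continuous.locallyIntegrable (ρ p.1 p.2)
  have e2 : fluxPrimitive F (fun v => J v * H v) (fderiv ℝ ψ p.2) (ρ p.1 p.2)
      = fderiv ℝ ψ p.2 (fluxField F H (a (ρ p.1 p.2)))
        - fderiv ℝ ψ p.2 (fluxField F H (b (ρ p.1 p.2)))
        - (fderiv ℝ ψ p.2 (fluxField F H c) - fderiv ℝ ψ p.2 (fluxField F H e)) := by
    have hg : LocallyIntegrable fun v => H v * fderiv ℝ ψ p.2 (deriv F v) := by
      have h1 := hs.coeff.locallyIntegrable_smul_deriv hH.continuous hHc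
      intro v
      obtain ⟨U, hU, hU'⟩ := h1 v
      refine ⟨U, hU, ?_⟩
      simpa [IntegrableOn] using (fderiv ℝ ψ p.2).integrable_comp hU'
    simp only [fluxPrimitive, mul_assoc]
    rw [hJi _ hg]
    simp only [hs.coeff.apply_fluxField hH.continuous hHc]
  simp only [localIntegrand, comparisonIntegrand, truncatedSource, e1, e2, map_sub]
  ring

/-- Up to the truncation H, the entropy is (ρ - k)⁺ = max(ρ,k) - k. -/
lemma EntropySolution.inequality_upper (hs : EntropySolution α T F A B K M C ρ₀ ρ m)
    (hθ : ContDiff ℝ ∞ θ) (hθc : HasCompactSupport θ) (hθT : tsupport θ ⊆ Ioo 0 T)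
    (hθ0 : ∀ t, 0 ≤ θ t) (hψ : ContDiff ℝ ∞ ψ) (hψc : HasCompactSupport ψ) (hψ0 : ∀ x, 0 ≤ ψ x)
    (hH : ContDiff ℝ ∞ H) (hHc : HasCompactSupport H) (hH0 : ∀ v, 0 ≤ H v) (k : ℝ) :
    -∫ p, θ p.1 * ψ p.2.1 * |deriv H p.2.2| ∂m ≤
      ∫ p, comparisonIntegrand F H θ ψ (max (ρ p.1 p.2) k) k p
        + θ p.1 * ψ p.2 * (upperStep k (ρ p.1 p.2) * truncatedSource α A B H ρ p) ∂slab d T := by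
  have hm : ∀ n : ℕ, Monotone fun v : ℝ => Real.smoothTransition (n * (v - k)) := fun n v w hvw =>
    Real.smoothTransition.monotone (mul_le_mul_of_nonneg_left (by linarith) (Nat.cast_nonneg _))
  exact hs.inequality_of_step hθ hθc hθT hθ0 hψ hψc hψ0 hH hHc hH0
    (j := fun n v => Real.smoothTransition (n * (v - k))) (J := upperStep k)
    (a := fun r => max r k) (b := fun _ => k) (c := max 0 k) (e := k)
    (fun n => Real.smoothTransition.contDiff.comp
      (contDiff_const.mul (contDiff_id.sub contDiff_const))) hm
    (fun n v => by
      rw [abs_of_nonneg (Real.smoothTransition.nonneg _)]; exact Real.smoothTransition.le_one _)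
    (tendsto_upperStep k) (fun g hg r => by rw [integral_upperStep_mul hg]; ring)

/-- Up to the truncation H, the entropy is (k - ρ)⁺ = max(ρ,k) - ρ. It is expressed through the same
maximum as the upper inequality, so the two can be added after freezing. -/
lemma EntropySolution.inequality_lower (hs : EntropySolution α T F A B K M C ρ₀ ρ m)
    (hθ : ContDiff ℝ ∞ θ) (hθc : HasCompactSupport θ) (hθT : tsupport θ ⊆ Ioo 0 T)
    (hθ0 : ∀ t, 0 ≤ θ t) (hψ : ContDiff ℝ ∞ ψ) (hψc : HasCompactSupport ψ) (hψ0 : ∀ x, 0 ≤ ψ x)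
    (hH : ContDiff ℝ ∞ H) (hHc : HasCompactSupport H) (hH0 : ∀ v, 0 ≤ H v) (k : ℝ) :
    -∫ p, θ p.1 * ψ p.2.1 * |deriv H p.2.2| ∂m ≤
      ∫ p, comparisonIntegrand F H θ ψ (max (ρ p.1 p.2) k) (ρ p.1 p.2) p
        + θ p.1 * ψ p.2 * (lowerStep k (ρ p.1 p.2) * truncatedSource α A B H ρ p) ∂slab d T := by
  refine hs.inequality_of_step hθ hθc hθT hθ0 hψ hψc hψ0 hH hHc hH0
    (j := fun n v => Real.smoothTransition (1 + n * (v - k)) - 1) (J := lowerStep k)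
    (a := fun r => max r k) (b := id) (c := max 0 k) (e := 0)
    (fun n => (Real.smoothTransition.contDiff.comp (contDiff_const.add
      (contDiff_const.mul (contDiff_id.sub contDiff_const)))).sub contDiff_const) (fun n v w hvw => ?_)
    (fun n v => ?_) (tendsto_lowerStep k) (fun g hg r => by simp [integral_lowerStep_mul hg])
  · refine sub_le_sub_right (Real.smoothTransition.monotone ?_) _
    have : (n : ℝ) * (v - k) ≤ n * (w - k) :=
      mul_le_mul_of_nonneg_left (by linarith) (Nat.cast_nonneg _)
    linarith
  · rw [abs_le]
    constructor <;> linarith [Real.smoothTransition.nonneg (1 + n * (v - k)),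
      Real.smoothTransition.le_one (1 + n * (v - k))]

end Comparison

/-! ### Spatial cutoffs and integrability of the source. -/

/-- A smooth spatial cutoff at scale `R`. -/
def spaceCutoff {d : ℕ} (R : ℝ) (x : E d) : ℝ :=
  (⟨1, 2, one_pos, one_lt_two⟩ : ContDiffBump (0 : E d)) (R⁻¹ • x)

section SpaceCutoff

variable {d : ℕ}

lemma contDiff_spaceCutoff (R : ℝ) : ContDiff ℝ ∞ (spaceCutoff (d := d) R) :=
  (ContDiffBump.contDiff _).comp (contDiff_id.const_smul R⁻¹)

lemma spaceCutoff_nonneg (R : ℝ) (x : E d) : 0 ≤ spaceCutoff R x := ContDiffBump.nonneg _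

lemma spaceCutoff_le_one (R : ℝ) (x : E d) : spaceCutoff R x ≤ 1 := ContDiffBump.le_one _

lemma hasCompactSupport_spaceCutoff {R : ℝ} (hR : 0 < R) :
    HasCompactSupport (spaceCutoff (d := d) R) :=
  (ContDiffBump.hasCompactSupport _).comp_homeomorph
    (Homeomorph.smulOfNeZero R⁻¹ (inv_ne_zero hR.ne'))

lemma tendsto_spaceCutoff {R : ℕ → ℝ} (hR : Tendsto R atTop atTop) (x : E d) :
    Tendsto (fun n => spaceCutoff (R n) x) atTop (𝓝 1) := by
  refine tendsto_const_nhds.congr' ?_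
  filter_upwards [hR.eventually_ge_atTop (‖x‖ + 1)] with n hn
  have hpos : 0 < R n := by linarith [norm_nonneg x]
  refine (ContDiffBump.one_of_mem_closedBall _ ?_).symm
  rw [mem_closedBall_zero_iff, norm_smul, norm_inv, Real.norm_of_nonneg hpos.le,
    inv_mul_le_iff₀ hpos]
  simp only [mul_one]; linarith

lemma exists_fderiv_spaceCutoff_bound : ∃ c : ℝ, 0 ≤ c ∧ ∀ (R : ℝ) (x : E d), 0 < R →
    ‖fderiv ℝ (spaceCutoff (d := d) R) x‖ ≤ c / R := by
  set f : ContDiffBump (0 : E d) := ⟨1, 2, one_pos, one_lt_two⟩ with hf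
  have hfd : ContDiff ℝ ∞ f := f.contDiff
  obtain ⟨c, hc⟩ := (f.hasCompactSupport.fderiv (𝕜 := ℝ)).exists_bound_of_continuous
    (hfd.continuous_fderiv (by simp))
  refine ⟨c, (norm_nonneg _).trans (hc 0), fun R x hR => ?_⟩
  have hd : HasFDerivAt (spaceCutoff (d := d) R)
      ((fderiv ℝ f (R⁻¹ • x)).comp (R⁻¹ • ContinuousLinearMap.id ℝ (E d))) x :=
    ((hfd.differentiable (by simp)) _).hasFDerivAt.comp x ((hasFDerivAt_id x).const_smul R⁻¹)
  rw [hd.fderiv, ContinuousLinearMap.comp_smul, ContinuousLinearMap.comp_id, norm_smul, norm_inv,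
    Real.norm_of_nonneg hR.le, inv_mul_eq_div]
  exact div_le_div_of_nonneg_right (hc _) hR.le

end SpaceCutoff

section Source

variable {d : ℕ} {F : ℝ → E d} {A B : ℝ → ℝ} {K : ℝ≥0} {α T M C : ℝ} {ρ₀ : E d → ℝ}
  {ρ : ℝ → E d → ℝ} {m : Measure (ℝ × E d × ℝ)} {θ : ℝ → ℝ}

/-- The source term of an entropy solution is integrable, even though the dissipative part of the
source may grow arbitrarily fast. -/
theorem EntropySolution.integrable_source (hs : EntropySolution α T F A B K M C ρ₀ ρ m)
    (hθ : ContDiff ℝ ∞ θ) (hθc : HasCompactSupport θ) (hθT : tsupport θ ⊆ Ioo 0 T)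
    (hθ0 : ∀ t, 0 ≤ θ t) {a : ℝ} (ha0 : 0 ≤ a) (ha : ∀ v, A v ≤ a * |v|)
    (ha' : ∀ v ≤ 0, -(a * |v|) ≤ A v) :
    Integrable (fun p => θ p.1 * A (ρ p.1 p.2)) (slab d T) := by
  obtain ⟨cθ, hcθ⟩ := hθc.exists_bound_of_continuous hθ.continuous
  obtain ⟨cθ', hcθ'⟩ := hθc.deriv.exists_bound_of_continuous (hθ.continuous_deriv (by simp))
  have hcθ0 := (norm_nonneg _).trans (hcθ 0)
  have hcθ0' := (norm_nonneg _).trans (hcθ' 0)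
  obtain ⟨cψ, hcψ0, hcψ⟩ := exists_fderiv_spaceCutoff_bound (d := d)
  have hflux : ∀ n : ℕ, ∃ c : ℝ, 0 ≤ c ∧ ∀ v, ‖deriv F v‖ * |cutoff ((n : ℝ) + 1) v| ≤ c :=
    fun n => hs.coeff.exists_flux_bound (abs_cutoff_le_one _)
      (R := 2 * ((n : ℝ) + 1)) fun v hv => cutoff_eq_zero (by positivity) hv.le
  choose cf hcf0 hcf using hflux
  -- the spatial scale is chosen so large that the flux is harmless
  set R : ℕ → ℝ := fun n => n + 1 + cψ * cf n with hR
  have hRpos : ∀ n, 0 < R n := fun n => by have := hcf0 n; positivity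
  have hRt : Tendsto R atTop atTop := by
    refine tendsto_atTop_mono (fun n => ?_) tendsto_natCast_atTop_atTop
    have := hcf0 n
    have : 0 ≤ cψ * cf n := by positivity
    simp only [hR]; linarith
  have hA := hs.coeff.continuous_source
  have hρm := hs.bounded.measurable
  have hρi := hs.bounded.integrable
  have hL := hs.integrable_diffusion
  -- The weight keeps only ρ > 0: where ρ ≤ 0 the two-sided bound on A is available, so only the
  -- unbounded absorption on the positive side has to be estimated.
  set w : ℕ → ℝ × E d → ℝ := fun n p => θ p.1 * spaceCutoff (R n) p.2 *
    (upperStep 0 (ρ p.1 p.2) * cutoff ((n : ℝ) + 1) (ρ p.1 p.2)) with hw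
  have hw0 : ∀ n p, 0 ≤ w n p := fun n p => by
    have h1 : 0 ≤ upperStep 0 (ρ p.1 p.2) := indicator_nonneg (fun _ _ => zero_le_one) _
    exact mul_nonneg (mul_nonneg (hθ0 _) (spaceCutoff_nonneg _ _))
      (mul_nonneg h1 (cutoff_nonneg _ _))
  have hwm : ∀ n, Measurable (w n) := fun n => by
    have := hθ.continuous; have := (contDiff_spaceCutoff (d := d) (R n)).continuous
    exact Measurable.mul (by fun_prop) (((measurable_upperStep 0).comp hρm).mul
      ((contDiff_cutoff _).continuous.measurable.comp hρm))
  have hwθ : ∀ n p, w n p ≤ θ p.1 := fun n p => by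
    have h1 : 0 ≤ upperStep 0 (ρ p.1 p.2) := indicator_nonneg (fun _ _ => zero_le_one) _
    have h2 := (le_abs_self _).trans (abs_upperStep_le_one 0 (ρ p.1 p.2))
    have h3 : upperStep 0 (ρ p.1 p.2) * cutoff ((n : ℝ) + 1) (ρ p.1 p.2) ≤ 1 :=
      mul_le_one₀ h2 (cutoff_nonneg _ _) (cutoff_le_one _ _)
    have h4 : θ p.1 * spaceCutoff (R n) p.2 ≤ θ p.1 :=
      mul_le_of_le_one_right (hθ0 _) (spaceCutoff_le_one _ _)
    exact (mul_le_of_le_one_right (mul_nonneg (hθ0 _) (spaceCutoff_nonneg _ _)) h3).trans h4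
  have hneg : ∀ v, 0 ≤ a * |v| - A v := fun v => by linarith [ha v]
  -- uniform bound for the truncated dissipative part
  obtain ⟨cm, hcm⟩ := hs.tail.tendsto_cutoff.bddAbove_range
  set D : ℝ := cθ * cm + (cθ' + cθ + cθ * a) * (∫ p, |ρ p.1 p.2| ∂slab d T)
    + cθ * ∫ p, |fracLap α (fun y => B (ρ p.1 y)) p.2| ∂slab d T with hD
  have hint : ∀ n, Integrable (fun p => w n p * (a * |ρ p.1 p.2| - A (ρ p.1 p.2))) (slab d T) ∧
      ∫ p, w n p * (a * |ρ p.1 p.2| - A (ρ p.1 p.2)) ∂slab d T ≤ D := fun n => by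
    have hψ := contDiff_spaceCutoff (d := d) (R n)
    have hψc := hasCompactSupport_spaceCutoff (d := d) (hRpos n)
    have hH := contDiff_cutoff ((n : ℝ) + 1)
    have hHc := hasCompactSupport_cutoff (R := (n : ℝ) + 1) (by positivity)
    have hmono : ∀ n : ℕ, Monotone fun v : ℝ => Real.smoothTransition (n * (v - 0)) :=
      fun n v w hvw => Real.smoothTransition.monotone
        (mul_le_mul_of_nonneg_left (by linarith) (Nat.cast_nonneg _))
    obtain ⟨i1, i2, h3⟩ := hs.inequality hθ hθc hθT hθ0 hψ hψc (spaceCutoff_nonneg _) hH hHc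
      (cutoff_nonneg _) (j := fun n v => Real.smoothTransition (n * (v - 0))) (J := upperStep 0)
      (fun n => Real.smoothTransition.contDiff.comp
        (contDiff_const.mul (contDiff_id.sub contDiff_const))) hmono
      (fun n v => by
        rw [abs_of_nonneg (Real.smoothTransition.nonneg _)]
        exact Real.smoothTransition.le_one _) (tendsto_upperStep 0)
    have ρw : Integrable (fun p => w n p * (a * |ρ p.1 p.2|)) (slab d T) :=
      (hρi.abs.const_mul a).bdd_mul (c := cθ) (hwm n).aestronglyMeasurable
        (Eventually.of_forall fun p => by
          rw [Real.norm_of_nonneg (hw0 n p)]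
          exact (hwθ n p).trans ((le_abs_self _).trans (hcθ _)))
    have Aw : Integrable (fun p => w n p * A (ρ p.1 p.2)) (slab d T) := by
      obtain ⟨cA, hcA⟩ := (hHc.mul_left (f := A)).exists_bound_of_continuous
        (hA.mul hH.continuous)
      have hi : Integrable (fun p : ℝ × E d => θ p.1 * spaceCutoff (R n) p.2) (slab d T) :=
        integrable_slab_mul (hθ.continuous.integrable_of_hasCompactSupport hθc)
          (hψ.continuous.integrable_of_hasCompactSupport hψc)
      refine (hi.norm.mul_const cA).mono' ((hwm n).mul
        (hA.measurable.comp hρm)).aestronglyMeasurable (Eventually.of_forall fun p => ?_)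
      have h1 := hcA (ρ p.1 p.2)
      have h2 := abs_upperStep_le_one 0 (ρ p.1 p.2)
      simp only [hw, Pi.mul_apply] at h1 ⊢
      calc _ = ‖θ p.1 * spaceCutoff (R n) p.2‖ * (|upperStep 0 (ρ p.1 p.2)| *
            ‖A (ρ p.1 p.2) * cutoff ((n : ℝ) + 1) (ρ p.1 p.2)‖) := by
              rw [← Real.norm_eq_abs, ← norm_mul, ← norm_mul]; congr 1; ring
        _ ≤ _ := mul_le_mul_of_nonneg_left ((mul_le_of_le_one_left (norm_nonneg _) h2).trans h1)
            (norm_nonneg _)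
    have hsub : Integrable (fun p => w n p * (a * |ρ p.1 p.2| - A (ρ p.1 p.2))) (slab d T) := by
      simp only [mul_sub]; exact ρw.sub Aw
    refine ⟨hsub, ?_⟩
    have hmm : ∫ p, θ p.1 * spaceCutoff (R n) p.2.1 * |deriv (cutoff ((n : ℝ) + 1)) p.2.2| ∂m
        ≤ cθ * cm := by
      have hi := hs.tail.stripFinite.integrable_velocity (hH.continuous_deriv (by simp)).abs
        hHc.deriv.abs
      have hb : ∀ p : ℝ × E d × ℝ, |θ p.1 * spaceCutoff (R n) p.2.1| ≤ cθ := fun p => by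
        rw [abs_mul, abs_of_nonneg (spaceCutoff_nonneg _ _)]
        exact (mul_le_of_le_one_right (abs_nonneg _) (spaceCutoff_le_one _ _)).trans (hcθ _)
      have hmeas : Measurable fun p : ℝ × E d × ℝ => θ p.1 * spaceCutoff (R n) p.2.1 := by
        have := hθ.continuous; have := hψ.continuous; fun_prop
      calc _ ≤ ∫ p, cθ * |deriv (cutoff ((n : ℝ) + 1)) p.2.2| ∂m :=
            integral_mono (hi.bdd_mul hmeas.aestronglyMeasurable (Eventually.of_forall hb))
              (hi.const_mul _) fun p => mul_le_mul_of_nonneg_right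
                ((le_abs_self _).trans (hb p)) (abs_nonneg _)
        _ ≤ _ := by
            rw [integral_const_mul]
            exact mul_le_mul_of_nonneg_left (hcm ⟨n, rfl⟩) hcθ0
    -- The source inside the entropy inequality is w A(ρ), which cancels the A in the quantity to be
    -- bounded. What is left involves only |ρ| and the diffusion, both integrable, with constants
    -- independent of n.
    have hloc : ∫ p, w n p * (a * |ρ p.1 p.2| - A (ρ p.1 p.2)) ∂slab d T
        + (∫ p, localIntegrand F A ρ θ (spaceCutoff (R n))
            (fun v => upperStep 0 v * cutoff ((n : ℝ) + 1) v) p ∂slab d T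
          - ∫ p, θ p.1 * spaceCutoff (R n) p.2 * (upperStep 0 (ρ p.1 p.2) *
              cutoff ((n : ℝ) + 1) (ρ p.1 p.2) * fracLap α (fun y => B (ρ p.1 y)) p.2) ∂slab d T)
        ≤ (cθ' + cθ + cθ * a) * (∫ p, |ρ p.1 p.2| ∂slab d T)
          + cθ * ∫ p, |fracLap α (fun y => B (ρ p.1 y)) p.2| ∂slab d T := by
      have i12 := i1.sub i2
      simp only [Pi.sub_def] at i12
      rw [← integral_sub i1 i2, ← integral_add hsub i12, ← integral_const_mul, ← integral_const_mul,
        ← integral_add (hρi.abs.const_mul _) (hL.abs.const_mul _)]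
      refine integral_mono (hsub.add i12) ((hρi.abs.const_mul _).add (hL.abs.const_mul _))
        fun p => ?_
      set r := ρ p.1 p.2
      set Lp := fracLap α (fun y => B (ρ p.1 y)) p.2
      set ψp := spaceCutoff (R n) p.2
      have hη : ∀ v, |upperStep 0 v * cutoff ((n : ℝ) + 1) v| ≤ 1 := fun v => by
        rw [abs_mul]
        exact mul_le_one₀ (abs_upperStep_le_one _ _) (abs_nonneg _) (abs_cutoff_le_one _ _)
      have b1 : |∫ v in (0 : ℝ)..r, upperStep 0 v * cutoff ((n : ℝ) + 1) v| ≤ 1 * |r| :=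
        abs_primitive_le hη r
      have b2 : |fluxPrimitive F (fun v => upperStep 0 v * cutoff ((n : ℝ) + 1) v)
          (fderiv ℝ (spaceCutoff (R n)) p.2) r| ≤ 1 * |r| := by
        refine abs_primitive_le (fun v => ?_) r
        rw [abs_mul, abs_mul]
        have h1 := (fderiv ℝ (spaceCutoff (R n)) p.2).le_opNorm (deriv F v)
        have h2 := hcψ (R n) p.2 (hRpos n)
        have h3 : cψ / R n * cf n ≤ 1 := by
          rw [div_mul_eq_mul_div, div_le_one (hRpos n)]
          simp only [hR]; linarith [(Nat.cast_nonneg n : (0 : ℝ) ≤ n)]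
        calc |upperStep 0 v| * |cutoff ((n : ℝ) + 1) v| *
              |fderiv ℝ (spaceCutoff (R n)) p.2 (deriv F v)|
            ≤ 1 * |cutoff ((n : ℝ) + 1) v| * (cψ / R n * ‖deriv F v‖) := by
              refine mul_le_mul (mul_le_mul_of_nonneg_right (abs_upperStep_le_one _ _)
                (abs_nonneg _)) (h1.trans (mul_le_mul_of_nonneg_right h2 (norm_nonneg _)))
                (abs_nonneg _) (by positivity)
          _ = cψ / R n * (‖deriv F v‖ * |cutoff ((n : ℝ) + 1) v|) := by ring
          _ ≤ cψ / R n * cf n := mul_le_mul_of_nonneg_left (hcf n v)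
              (div_nonneg hcψ0 (hRpos n).le)
          _ ≤ 1 := h3
      have hψ1 : |ψp| ≤ 1 := by
        rw [abs_of_nonneg (spaceCutoff_nonneg _ _)]; exact spaceCutoff_le_one _ _
      have c1 : deriv θ p.1 * ψp * (∫ v in (0 : ℝ)..r, upperStep 0 v * cutoff ((n : ℝ) + 1) v)
          ≤ cθ' * |r| := by
        refine (le_abs_self _).trans ?_
        rw [abs_mul, abs_mul]
        calc _ ≤ cθ' * 1 * (1 * |r|) := by gcongr; exact hcθ' _
          _ = _ := by ring
      have c2 : θ p.1 * fluxPrimitive F (fun v => upperStep 0 v * cutoff ((n : ℝ) + 1) v)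
          (fderiv ℝ (spaceCutoff (R n)) p.2) r ≤ cθ * |r| := by
        refine (le_abs_self _).trans ?_
        rw [abs_mul]
        calc _ ≤ cθ * (1 * |r|) := by gcongr; exact hcθ _
          _ = _ := by ring
      have hwc : w n p ≤ cθ := (hwθ n p).trans ((le_abs_self _).trans (hcθ _))
      have c3 : w n p * (a * |r|) ≤ cθ * a * |r| := by
        exact (mul_le_mul_of_nonneg_right hwc (by positivity)).trans_eq (by ring)
      have c4 : -(w n p * Lp) ≤ cθ * |Lp| := by
        calc -(w n p * Lp) = w n p * (-Lp) := by ring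
          _ ≤ w n p * |Lp| := mul_le_mul_of_nonneg_left (neg_le_abs _) (hw0 n p)
          _ ≤ _ := mul_le_mul_of_nonneg_right hwc (abs_nonneg _)
      have e : w n p = θ p.1 * ψp * (upperStep 0 r * cutoff ((n : ℝ) + 1) r) := rfl
      simp only [localIntegrand]
      calc _ = w n p * (a * |r|) + (deriv θ p.1 * ψp *
              (∫ v in (0 : ℝ)..r, upperStep 0 v * cutoff ((n : ℝ) + 1) v)
            + θ p.1 * fluxPrimitive F (fun v => upperStep 0 v * cutoff ((n : ℝ) + 1) v)
              (fderiv ℝ (spaceCutoff (R n)) p.2) r) + -(w n p * Lp) := by rw [e]; ring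
        _ ≤ _ := by linarith
    rw [hD]
    linarith
  have hlim : ∀ p, Tendsto (fun n => w n p) atTop (𝓝 (θ p.1 * upperStep 0 (ρ p.1 p.2))) :=
    fun p => by
      have h1 := ((tendsto_spaceCutoff hRt p.2).const_mul (θ p.1)).mul
        ((tendsto_cutoff (ρ p.1 p.2)).const_mul (upperStep 0 (ρ p.1 p.2)))
      simpa only [mul_one] using h1
  set g : ℝ × E d → ℝ := fun p => θ p.1 * upperStep 0 (ρ p.1 p.2) *
    (a * |ρ p.1 p.2| - A (ρ p.1 p.2)) with hg
  have hgm : Measurable g := ((hθ.continuous.measurable.comp measurable_fst).mul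
    ((measurable_upperStep 0).comp hρm)).mul ((hρm.abs.const_mul a).sub (hA.measurable.comp hρm))
  have hg0 : ∀ p, 0 ≤ g p := fun p => mul_nonneg (mul_nonneg (hθ0 _)
    (indicator_nonneg (fun _ _ => zero_le_one) _)) (hneg _)
  -- Fatou: a|ρ| - A(ρ) is nonnegative and its weighted integrals are bounded by D, independently of
  -- the truncations.
  have hgi : Integrable g (slab d T) := by
    refine ⟨hgm.aestronglyMeasurable, ?_⟩
    rw [hasFiniteIntegral_iff_ofReal (Eventually.of_forall hg0)]
    have hf := lintegral_liminf_le (μ := slab d T) (u := atTop)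
      (f := fun n p => ENNReal.ofReal (w n p * (a * |ρ p.1 p.2| - A (ρ p.1 p.2))))
      fun n => ((hwm n).mul ((hρm.abs.const_mul a).sub (hA.measurable.comp hρm))).ennreal_ofReal
    have he : ∀ p, liminf (fun n => ENNReal.ofReal
        (w n p * (a * |ρ p.1 p.2| - A (ρ p.1 p.2)))) atTop = ENNReal.ofReal (g p) := fun p =>
      (ENNReal.tendsto_ofReal ((hlim p).mul_const _)).liminf_eq
    simp only [he] at hf
    refine hf.trans_lt (lt_of_le_of_lt ?_ (ENNReal.ofReal_lt_top (r := D)))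
    refine liminf_le_of_le (by isBoundedDefault) fun b hb => ?_
    obtain ⟨n, hn⟩ := hb.exists
    refine hn.trans ?_
    rw [← ofReal_integral_eq_lintegral_ofReal (hint n).1
      (Eventually.of_forall fun p => mul_nonneg (hw0 n p) (hneg _))]
    exact ENNReal.ofReal_le_ofReal (hint n).2
  refine (hgi.add (hρi.abs.const_mul (cθ * a))).mono'
    ((hθ.continuous.measurable.comp measurable_fst).mul
      (hA.measurable.comp hρm)).aestronglyMeasurable (Eventually.of_forall fun p => ?_)
  simp only [Pi.add_apply]
  have hθ1 : θ p.1 * (a * |ρ p.1 p.2|) ≤ cθ * a * |ρ p.1 p.2| := by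
    rw [mul_assoc]
    exact mul_le_mul_of_nonneg_right ((le_abs_self _).trans (hcθ _)) (by positivity)
  rw [Real.norm_eq_abs, abs_mul, abs_of_nonneg (hθ0 _)]
  rcases le_or_gt (ρ p.1 p.2) 0 with h | h
  · have h1 : |A (ρ p.1 p.2)| ≤ a * |ρ p.1 p.2| := abs_le.2 ⟨ha' _ h, ha _⟩
    have := mul_le_mul_of_nonneg_left h1 (hθ0 p.1)
    linarith [hg0 p]
  · have h1 : |A (ρ p.1 p.2)| ≤ (a * |ρ p.1 p.2| - A (ρ p.1 p.2)) + a * |ρ p.1 p.2| := by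
      have := mul_nonneg ha0 (abs_nonneg (ρ p.1 p.2))
      rw [abs_le]; constructor <;> linarith [ha (ρ p.1 p.2)]
    have h2 : g p = θ p.1 * (a * |ρ p.1 p.2| - A (ρ p.1 p.2)) := by
      simp [hg, upperStep, h]
    have := mul_le_mul_of_nonneg_left h1 (hθ0 p.1)
    rw [h2]; linarith

end Source

/-! ### Concentration in time and attainment of the initial datum. -/

section TimeConcentration

/-- A smooth step function in time, rising from `0` to `1` on `[a, a + 1/n]`. -/
def timeStep (a : ℝ) (n : ℕ) (t : ℝ) : ℝ := Real.smoothTransition (n * (t - a))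

lemma contDiff_timeStep (a : ℝ) (n : ℕ) : ContDiff ℝ ∞ (timeStep a n) :=
  Real.smoothTransition.contDiff.comp (contDiff_const.mul (contDiff_id.sub contDiff_const))

lemma timeStep_nonneg (a : ℝ) (n : ℕ) (t : ℝ) : 0 ≤ timeStep a n t :=
  Real.smoothTransition.nonneg _

lemma timeStep_le_one (a : ℝ) (n : ℕ) (t : ℝ) : timeStep a n t ≤ 1 :=
  Real.smoothTransition.le_one _

lemma timeStep_eq_zero {a t : ℝ} {n : ℕ} (h : t ≤ a) : timeStep a n t = 0 :=
  Real.smoothTransition.zero_of_nonpos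
    (mul_nonpos_of_nonneg_of_nonpos (Nat.cast_nonneg _) (by linarith))

lemma timeStep_eq_one {a t : ℝ} {n : ℕ} (hn : 0 < n) (h : a + 1 / n ≤ t) : timeStep a n t = 1 := by
  refine Real.smoothTransition.one_of_one_le ?_
  have hn' : (0 : ℝ) < n := Nat.cast_pos.2 hn
  calc (1 : ℝ) = n * (1 / n) := by field_simp
    _ ≤ n * (t - a) := mul_le_mul_of_nonneg_left (by linarith) hn'.le

lemma monotone_timeStep (a : ℝ) (n : ℕ) : Monotone (timeStep a n) := fun s t hst =>
  Real.smoothTransition.monotone (mul_le_mul_of_nonneg_left (by linarith) (Nat.cast_nonneg _))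

lemma deriv_timeStep_eq_zero {a t : ℝ} {n : ℕ} (hn : 0 < n) (h : t ∉ Icc a (a + 1 / n)) :
    deriv (timeStep a n) t = 0 := by
  rcases lt_or_ge t a with h1 | h1
  · have : timeStep a n =ᶠ[𝓝 t] fun _ => 0 := by
      filter_upwards [gt_mem_nhds h1] with s hs using timeStep_eq_zero hs.le
    rw [this.deriv_eq, deriv_const]
  · have h2 : a + 1 / n < t := by
      by_contra! h3
      exact h ⟨h1, h3⟩
    have : timeStep a n =ᶠ[𝓝 t] fun _ => 1 := by
      filter_upwards [lt_mem_nhds h2] with s hs using timeStep_eq_one hn hs.le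
    rw [this.deriv_eq, deriv_const]

lemma integral_deriv_timeStep {a : ℝ} {n : ℕ} (hn : 0 < n) :
    ∫ t in a..(a + 1 / n), deriv (timeStep a n) t = 1 := by
  rw [intervalIntegral.integral_deriv_eq_sub
      (fun t _ => (contDiff_timeStep a n).differentiable (by simp) t)
      (((contDiff_timeStep a n).continuous_deriv (by simp)).intervalIntegrable _ _),
    timeStep_eq_one hn le_rfl, timeStep_eq_zero le_rfl, sub_zero]

/-- The derivatives of the time steps concentrate at `a⁺`. -/
lemma tendsto_integral_deriv_timeStep {G : ℝ → ℝ} {a T l : ℝ} (ha : 0 ≤ a) (haT : a < T)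
    (hGi : IntegrableOn G (Ioo 0 T)) (hG : Tendsto G (𝓝[>] a) (𝓝 l)) :
    Tendsto (fun n => ∫ t in Ioo 0 T, deriv (timeStep a n) t * G t) atTop (𝓝 l) := by
  rw [Metric.tendsto_atTop]
  intro ε hε
  obtain ⟨δ, hδ, hδG⟩ := Metric.tendsto_nhdsWithin_nhds.1 hG (ε / 2) (by positivity)
  obtain ⟨N, hN⟩ := exists_nat_one_div_lt (lt_min hδ (sub_pos.2 haT))
  refine ⟨N + 1, fun n hn => ?_⟩
  have hn0 : 0 < n := by omega
  have hn' : (0 : ℝ) < n := Nat.cast_pos.2 hn0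
  have hnN : 1 / (n : ℝ) < min δ (T - a) := by
    refine lt_of_le_of_lt (one_div_le_one_div_of_le (by positivity) ?_) hN
    exact_mod_cast hn
  have hn1 : 1 / (n : ℝ) < δ := hnN.trans_le (min_le_left _ _)
  have hn2 : a + 1 / (n : ℝ) < T := by linarith [hnN.trans_le (min_le_right δ (T - a))]
  have hle : a ≤ a + 1 / (n : ℝ) := by linarith [one_div_pos.2 hn']
  have hdc := (contDiff_timeStep a n).continuous_deriv (by simp)
  have hsub : Ioc a (a + 1 / (n : ℝ)) ⊆ Ioo 0 T := fun t ht =>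
    ⟨ha.trans_lt ht.1, ht.2.trans_lt hn2⟩
  have e1 : ∫ t in Ioo 0 T, deriv (timeStep a n) t * G t
      = ∫ t in a..(a + 1 / n), deriv (timeStep a n) t * G t := by
    rw [intervalIntegral.integral_of_le hle]
    refine setIntegral_eq_of_subset_of_ae_sdiff_eq_zero measurableSet_Ioo.nullMeasurableSet hsub ?_
    filter_upwards [compl_mem_ae_iff.2 (measure_singleton a)] with t hta ht
    rw [deriv_timeStep_eq_zero hn0, zero_mul]
    intro hm
    exact ht.2 ⟨lt_of_le_of_ne hm.1 (Ne.symm hta), hm.2⟩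
  have hii : IntervalIntegrable (fun t => deriv (timeStep a n) t * G t) volume a (a + 1 / n) := by
    refine IntervalIntegrable.continuousOn_mul ?_ hdc.continuousOn
    rw [intervalIntegrable_iff_integrableOn_Ioc_of_le hle]
    exact hGi.mono_set hsub
  -- The derivative has integral 1 and is nonnegative, so the limit l can be subtracted inside and
  -- the average is controlled by the oscillation of G on a δ-interval.
  have e2 : (∫ t in a..(a + 1 / n), deriv (timeStep a n) t * G t) - l
      = ∫ t in a..(a + 1 / n), deriv (timeStep a n) t * (G t - l) := by
    simp only [mul_sub]
    rw [intervalIntegral.integral_sub hii ((hdc.intervalIntegrable _ _).mul_const l),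
      intervalIntegral.integral_mul_const, integral_deriv_timeStep hn0, one_mul]
  rw [dist_eq_norm, e1, e2]
  have hb : ∀ t ∈ Ioc a (a + 1 / (n : ℝ)), ‖deriv (timeStep a n) t * (G t - l)‖
      ≤ deriv (timeStep a n) t * (ε / 2) := fun t ht => by
    have h0 := (monotone_timeStep a n).deriv_nonneg (x := t)
    rw [norm_mul, Real.norm_of_nonneg h0]
    refine mul_le_mul_of_nonneg_left ?_ h0
    have := hδG ht.1 (by rw [Real.dist_eq, abs_of_nonneg (by linarith [ht.1])]; linarith [ht.2])
    rw [dist_eq_norm] at this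
    exact this.le
  calc _ ≤ ∫ t in a..(a + 1 / n), deriv (timeStep a n) t * (ε / 2) :=
        intervalIntegral.norm_integral_le_of_norm_le hle (Eventually.of_forall hb)
          ((hdc.intervalIntegrable _ _).mul_const _)
    _ = ε / 2 := by
        rw [intervalIntegral.integral_mul_const, integral_deriv_timeStep hn0, one_mul]
    _ < ε := by linarith

end TimeConcentration

/-- Uniform continuity of `ρ` on `[0,T]` with values in `L¹`. -/
structure L1Continuous {d : ℕ} (T : ℝ) (ρ : ℝ → E d → ℝ) : Prop where
  integrable : ∀ t ∈ Icc 0 T, Integrable (ρ t)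
  modulus : ∀ ε > 0, ∃ δ > 0, ∀ s ∈ Icc 0 T, ∀ t ∈ Icc 0 T, |s - t| < δ →
    ∫ x, |ρ s x - ρ t x| ≤ ε

lemma L1Continuous.tendsto {d : ℕ} {T : ℝ} {ρ : ℝ → E d → ℝ} (hρ : L1Continuous T ρ) {t : ℝ}
    (ht : t ∈ Icc 0 T) : Tendsto (fun s => ∫ x, |ρ s x - ρ t x|) (𝓝[Icc 0 T] t) (𝓝 0) := by
  rw [Metric.tendsto_nhdsWithin_nhds]
  intro ε hε
  obtain ⟨δ, hδ, h⟩ := hρ.modulus (ε / 2) (by positivity)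
  refine ⟨δ, hδ, fun s hs hst => ?_⟩
  rw [Real.dist_eq, sub_zero, abs_of_nonneg (integral_nonneg fun _ => abs_nonneg _)]
  exact (h s hs t ht hst).trans_lt (by linarith)

/-- A function of `ρ` which is Lipschitz in `L¹` is continuous in time. -/
lemma L1Continuous.tendsto_of_lipschitz {d : ℕ} {T : ℝ} {ρ : ℝ → E d → ℝ} (hρ : L1Continuous T ρ)
    {G : ℝ → ℝ} {c : ℝ} (hG : ∀ s ∈ Icc 0 T, ∀ t ∈ Icc 0 T, |G s - G t| ≤ c * ∫ x, |ρ s x - ρ t x|)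
    {t : ℝ} (ht : t ∈ Icc 0 T) : Tendsto G (𝓝[Icc 0 T] t) (𝓝 (G t)) := by
  rw [tendsto_iff_norm_sub_tendsto_zero]
  refine squeeze_zero' (Eventually.of_forall fun _ => norm_nonneg _) ?_
    (by simpa using (hρ.tendsto ht).const_mul c)
  filter_upwards [self_mem_nhdsWithin] with s hs using hG s hs t ht

section Initial

variable {d : ℕ} {F : ℝ → E d} {A B : ℝ → ℝ} {K : ℝ≥0} {α T M C : ℝ} {ρ₀ : E d → ℝ}
  {ρ : ℝ → E d → ℝ} {m : Measure (ℝ × E d × ℝ)}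

set_option maxHeartbeats 800000 in
/-- The initial time trace of an entropy solution, tested against a truncation. -/
lemma EntropySolution.abs_initial_le (hs : EntropySolution α T F A B K M C ρ₀ ρ m)
    (hρ : L1Continuous T ρ) {ψ : E d → ℝ} {η : ℝ → ℝ} (hψ : ContDiff ℝ ∞ ψ)
    (hψc : HasCompactSupport ψ) {cψ : ℝ} (hcψ : ∀ x, |ψ x| ≤ cψ) (hη : ContDiff ℝ ∞ η)
    (hηc : HasCompactSupport η) :
    |(∫ x, ψ x * ∫ v in (0 : ℝ)..ρ₀ x, η v) - ∫ x, ψ x * ∫ v in (0 : ℝ)..ρ 0 x, η v|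
      ≤ cψ * ∫ p, |deriv η p.2.2| ∂m := by
  have hT := hs.time_pos
  have hcψ0 := (abs_nonneg _).trans (hcψ 0)
  obtain ⟨cη, hcη⟩ := hηc.exists_bound_of_continuous hη.continuous
  have hcη0 := (norm_nonneg _).trans (hcη 0)
  have hηl := hη.continuous.locallyIntegrable (μ := volume)
  set S : ℝ → ℝ := fun r => ∫ v in (0 : ℝ)..r, η v with hS
  have hSl : ∀ r s, |S r - S s| ≤ cη * |r - s| := abs_intervalIntegral_sub_le hηl hcη
  have hSb : ∀ r, |S r| ≤ cη * |r| := abs_primitive_le hcη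
  have hSm : Measurable S := (intervalIntegral.continuous_primitive
    (fun a b => hη.continuous.intervalIntegrable a b) 0).measurable
  have hρm := hs.bounded.measurable
  have hρi := hs.bounded.integrable
  have hψm := hψ.continuous.measurable
  -- the part of the integrand without time derivative
  set ζ : ℝ → ℝ := fun t => timeStep (-2) 1 t - timeStep (T + 1) 1 t with hζ
  have hζs : ContDiff ℝ ∞ ζ := (contDiff_timeStep _ _).sub (contDiff_timeStep _ _)
  have hζc : HasCompactSupport ζ := HasCompactSupport.intro (isCompact_Icc (a := -2) (b := T + 2))
    fun t ht => by
      rw [mem_Icc, not_and_or, not_le, not_le] at ht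
      rcases ht with ht | ht
      · simp only [hζ]
        rw [timeStep_eq_zero ht.le, timeStep_eq_zero (by linarith), sub_zero]
      · simp only [hζ]
        rw [timeStep_eq_one one_pos (by norm_num; linarith),
          timeStep_eq_one one_pos (by norm_num; linarith), sub_self]
  have hζ1 : ∀ t ∈ Ioo 0 T, ζ =ᶠ[𝓝 t] fun _ => 1 := fun t ht => by
    filter_upwards [Ioo_mem_nhds ht.1 ht.2] with s hs
    simp only [hζ]
    rw [timeStep_eq_one one_pos (by norm_num; linarith [hs.1]),
      timeStep_eq_zero (by linarith [hs.2]), sub_zero]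
  have hslab : ∀ᵐ p ∂slab d T, p.1 ∈ Ioo 0 T :=
    Measure.quasiMeasurePreserving_fst.ae (ae_restrict_mem measurableSet_Ioo)
  set X : ℝ × E d → ℝ := fun p => fluxPrimitive F η (fderiv ℝ ψ p.2) (ρ p.1 p.2)
    + ψ p.2 * (A (ρ p.1 p.2) * η (ρ p.1 p.2)) with hX
  -- Read off from the tensor-product lemma: ζ is an admissible time factor equal to 1 on (0,T), so
  -- its local integrand coincides with X on the strip.
  have hXi : Integrable X (slab d T) := by
    refine (integral_chi_mul_adjointOp hs.coeff hs.bounded hs.dim_pos hs.order hζs hζc hψ hψc hη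
      hηc).1.congr ?_
    filter_upwards [hslab] with p hp
    rw [localIntegrand, (hζ1 _ hp).deriv_eq, (hζ1 _ hp).eq_of_nhds, deriv_const]
    simp only [hX]; ring
  set Y : ℝ × E d → ℝ := fun p => ψ p.2 * (η (ρ p.1 p.2) *
    fracLap α (fun y => B (ρ p.1 y)) p.2) with hY
  have hYi : Integrable Y (slab d T) :=
    (hs.integrable_diffusion.bdd_mul (c := cη)
      ((hη.continuous.measurable.comp hρm).aestronglyMeasurable)
      (Eventually.of_forall fun p => hcη _)).bdd_mul (c := cψ)
      ((hψm.comp measurable_snd).aestronglyMeasurable) (Eventually.of_forall fun p => hcψ _)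
  have hGi : Integrable (fun p : ℝ × E d => ψ p.2 * S (ρ p.1 p.2)) (slab d T) := by
    refine Integrable.bdd_mul (c := cψ) ?_ ((hψm.comp measurable_snd).aestronglyMeasurable)
      (Eventually.of_forall fun p => hcψ _)
    exact (hρi.abs.const_mul cη).mono' (hSm.comp hρm).aestronglyMeasurable
      (Eventually.of_forall fun p => hSb _)
  have hSi : ∀ t ∈ Icc 0 T, Integrable fun x => ψ x * S (ρ t x) := fun t ht => by
    refine Integrable.bdd_mul (c := cψ) ?_ hψm.aestronglyMeasurable (Eventually.of_forall hcψ)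
    have := hρ.integrable t ht
    exact (this.abs.const_mul cη).mono' (hSm.comp_aemeasurable this.1.aemeasurable).aestronglyMeasurable
      (Eventually.of_forall fun p => hSb _)
  set G : ℝ → ℝ := fun t => ∫ x, ψ x * S (ρ t x) with hG
  have h0T : (0 : ℝ) ∈ Icc 0 T := ⟨le_rfl, hT.le⟩
  have hGt : Tendsto G (𝓝[>] 0) (𝓝 (G 0)) := by
    have h1 := hρ.tendsto_of_lipschitz (G := G) (c := cψ * cη) (fun s hs' t ht => by
      simp only [hG]
      rw [← integral_sub (hSi s hs') (hSi t ht), ← integral_const_mul]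
      refine norm_integral_le_of_norm_le (f := fun x => ψ x * S (ρ s x) - ψ x * S (ρ t x))
        (((hρ.integrable s hs').sub (hρ.integrable t ht)).abs.const_mul _)
        (Eventually.of_forall fun x => ?_)
      rw [← mul_sub, norm_mul, mul_assoc]
      exact mul_le_mul (hcψ x) (hSl _ _) (norm_nonneg _) hcψ0) h0T
    rw [← nhdsWithin_Ioo_eq_nhdsGT hT]
    exact h1.mono_left (nhdsWithin_mono _ Ioo_subset_Icc_self)
  have hGI : IntegrableOn G (Ioo 0 T) := hGi.integral_prod_left
  have hlim1 := tendsto_integral_deriv_timeStep le_rfl hT hGI hGt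
  have hlim2 : Tendsto (fun n => ∫ p, (1 - timeStep 0 n p.1) * (X p - Y p) ∂slab d T) atTop
      (𝓝 0) := by
    suffices h : Tendsto (fun n => ∫ p, (1 - timeStep 0 n p.1) * (X p - Y p) ∂slab d T) atTop
        (𝓝 (∫ _, (0 : ℝ) ∂slab d T)) by simpa only [integral_zero] using h
    refine tendsto_integral_of_dominated_convergence (fun p => |X p - Y p|)
      (fun n => ?_) (hXi.sub hYi).abs (fun n => Eventually.of_forall fun p => ?_) ?_
    · have := (contDiff_timeStep 0 n).continuous
      exact (by fun_prop : Continuous fun p : ℝ × E d => 1 - timeStep 0 n p.1).aestronglyMeasurable.mul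
        (hXi.sub hYi).1
    · rw [norm_mul]
      refine mul_le_of_le_one_left (abs_nonneg _) ?_
      rw [Real.norm_eq_abs, abs_le]
      constructor <;> linarith [timeStep_nonneg 0 n p.1, timeStep_le_one 0 n p.1]
    · filter_upwards [hslab] with p hp
      refine tendsto_const_nhds.congr' ?_
      obtain ⟨N, hN⟩ := exists_nat_one_div_lt hp.1
      filter_upwards [eventually_ge_atTop (N + 1)] with n hn
      rw [timeStep_eq_one (by omega), sub_self, zero_mul]
      rw [zero_add]
      exact (one_div_le_one_div_of_le (by positivity) (by exact_mod_cast hn)).trans hN.le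
  have key : ∀ᶠ n : ℕ in atTop,
      |-(∫ t in Ioo 0 T, deriv (timeStep 0 n) t * G t)
        + (∫ p, (1 - timeStep 0 n p.1) * (X p - Y p) ∂slab d T) + ∫ x, ψ x * S (ρ₀ x)|
      ≤ cψ * ∫ p, |deriv η p.2.2| ∂m := by
    obtain ⟨N, hN⟩ := exists_nat_one_div_lt hT
    filter_upwards [eventually_ge_atTop (N + 1)] with n hn
    have hn0 : 0 < n := by omega
    have hnT : 0 + 1 / (n : ℝ) < T := by
      rw [zero_add]
      exact (one_div_le_one_div_of_le (by positivity) (by exact_mod_cast hn)).trans_lt hN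
    -- This θ equals 1 at time 0 and falls to 0 on [0, 1/n]. Its derivative concentrates at 0⁺ and
    -- produces the trace of ρ, while the terms without time derivative live on a vanishing time
    -- interval.
    set θ : ℝ → ℝ := fun t => timeStep (-2) 1 t - timeStep 0 n t with hθ
    have hθs : ContDiff ℝ ∞ θ := (contDiff_timeStep _ _).sub (contDiff_timeStep _ _)
    have hθ0 : ∀ t, t ∉ Icc (-2) (0 + 1 / (n : ℝ)) → θ t = 0 := fun t ht => by
      have : 0 < 1 / (n : ℝ) := by positivity
      rw [mem_Icc, not_and_or, not_le, not_le] at ht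
      rcases ht with ht | ht
      · simp only [hθ]
        rw [timeStep_eq_zero ht.le, timeStep_eq_zero (by linarith), sub_zero]
      · simp only [hθ]
        rw [timeStep_eq_one one_pos (by norm_num; linarith), timeStep_eq_one hn0 ht.le, sub_self]
    have hθc : HasCompactSupport θ := HasCompactSupport.intro isCompact_Icc hθ0
    have hθT : tsupport θ ⊆ Iio T := by
      refine (closure_minimal (fun t ht => ?_) isClosed_Icc :
        tsupport θ ⊆ Icc (-2) (0 + 1 / (n : ℝ))).trans fun t ht => ht.2.trans_lt hnT
      by_contra h
      exact ht (hθ0 t h)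
    have hθ1 : ∀ t ∈ Ioo 0 T, θ =ᶠ[𝓝 t] fun t => 1 - timeStep 0 n t := fun t ht => by
      filter_upwards [Ioo_mem_nhds ht.1 ht.2] with s hs
      simp only [hθ]
      rw [timeStep_eq_one one_pos (by norm_num; linarith [hs.1])]
    have hθb : ∀ t, |θ t| ≤ 1 := fun t => by
      have h1 := timeStep_nonneg (-2) 1 t
      have h2 := timeStep_le_one (-2) 1 t
      have h3 := timeStep_nonneg 0 n t
      have h4 := timeStep_le_one 0 n t
      simp only [hθ]
      rw [abs_le]; constructor <;> linarith
    have hid := hs.identity θ ψ η hθs hθc hθT hψ hψc hη hηc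
    have hli := (integral_chi_mul_adjointOp hs.coeff hs.bounded hs.dim_pos hs.order hθs hθc hψ hψc
      hη hηc).1
    have hθm : Measurable fun p : ℝ × E d => θ p.1 := hθs.continuous.measurable.comp measurable_fst
    have hθY : Integrable (fun p => θ p.1 * Y p) (slab d T) :=
      hYi.bdd_mul (c := 1) hθm.aestronglyMeasurable (Eventually.of_forall fun p => hθb p.1)
    have hYθ : Integrable (fun p => θ p.1 * ψ p.2 * (η (ρ p.1 p.2) *
        fracLap α (fun y => B (ρ p.1 y)) p.2)) (slab d T) :=
      hθY.congr (Eventually.of_forall fun p => (mul_assoc _ _ _).symm)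
    have hd1 : Continuous (deriv (timeStep 0 n)) :=
      (contDiff_timeStep 0 n).continuous_deriv (by simp)
    have hDi : Integrable (fun p : ℝ × E d => deriv (timeStep 0 n) p.1 * (ψ p.2 * S (ρ p.1 p.2)))
        (slab d T) := by
      obtain ⟨c, hc⟩ := (isCompact_Icc (a := 0) (b := T)).exists_bound_of_continuousOn
        hd1.continuousOn
      refine hGi.bdd_mul (c := c) ((hd1.measurable.comp measurable_fst).aestronglyMeasurable) ?_
      filter_upwards [hslab] with p hp using hc _ (Ioo_subset_Icc_self hp)
    have hZi : Integrable (fun p : ℝ × E d => (1 - timeStep 0 n p.1) * (X p - Y p)) (slab d T) := by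
      have := (contDiff_timeStep 0 n).continuous
      refine (hXi.sub hYi).bdd_mul (c := 1)
        (by fun_prop : Continuous fun p : ℝ × E d => 1 - timeStep 0 n p.1).aestronglyMeasurable
        (Eventually.of_forall fun p => ?_)
      rw [Real.norm_eq_abs, abs_le]
      constructor <;> linarith [timeStep_nonneg 0 n p.1, timeStep_le_one 0 n p.1]
    have e0 : θ 0 = 1 := by
      simp only [hθ]
      rw [timeStep_eq_one one_pos (by norm_num), timeStep_eq_zero le_rfl, sub_zero]
    have e1 : ∫ t in Ioo 0 T, deriv (timeStep 0 n) t * G t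
        = ∫ p : ℝ × E d, deriv (timeStep 0 n) p.1 * (ψ p.2 * S (ρ p.1 p.2)) ∂slab d T := by
      rw [slab, integral_prod _ hDi]
      simp only [hG, integral_const_mul]
    rw [← integral_sub hli hYθ, e0, one_mul] at hid
    have e2 : -(∫ t in Ioo 0 T, deriv (timeStep 0 n) t * G t)
        + (∫ p, (1 - timeStep 0 n p.1) * (X p - Y p) ∂slab d T) + ∫ x, ψ x * S (ρ₀ x)
        = ∫ p, θ p.1 * ψ p.2.1 * deriv η p.2.2 ∂m := by
      rw [← hid, e1, ← integral_neg, ← integral_add (show Integrable (fun p : ℝ × E d =>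
        -(deriv (timeStep 0 n) p.1 * (ψ p.2 * S (ρ p.1 p.2)))) (slab d T) from hDi.neg) hZi]
      congr 1
      refine integral_congr_ae ?_
      filter_upwards [hslab] with p hp
      rw [localIntegrand, (hθ1 _ hp).deriv_eq, (hθ1 _ hp).eq_of_nhds, deriv_const_sub]
      simp only [hX, hY, hS]; ring
    rw [e2, ← integral_const_mul]
    refine norm_integral_le_of_norm_le
      (f := fun p : ℝ × E d × ℝ => θ p.1 * ψ p.2.1 * deriv η p.2.2)
      ((hs.tail.stripFinite.integrable_velocity (hη.continuous_deriv (by simp)).abs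
        hηc.deriv.abs).const_mul cψ) (Eventually.of_forall fun p => ?_)
    rw [norm_mul, norm_mul, Real.norm_eq_abs, Real.norm_eq_abs, Real.norm_eq_abs]
    refine mul_le_mul_of_nonneg_right ?_ (abs_nonneg _)
    exact (mul_le_of_le_one_left (abs_nonneg _) (hθb _)).trans (hcψ _)
  have hlim := ((hlim1.neg.add hlim2).add_const (∫ x, ψ x * S (ρ₀ x))).abs
  have := le_of_tendsto hlim key
  rw [add_zero, neg_add_eq_sub] at this
  exact this

/-- Entropy solutions attain their initial datum. -/
theorem EntropySolution.initial_eq (hs : EntropySolution α T F A B K M C ρ₀ ρ m)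
    (hρ : L1Continuous T ρ) : ρ 0 =ᵐ[volume] ρ₀ := by
  have h0 := hρ.integrable 0 ⟨le_rfl, hs.time_pos.le⟩
  refine ae_eq_of_integral_contDiff_smul_eq h0.locallyIntegrable hs.initial.locallyIntegrable
    fun ψ hψ hψc => ?_
  obtain ⟨cψ, hcψ⟩ := hψc.exists_bound_of_continuous hψ.continuous
  have hlim : ∀ u : E d → ℝ, Integrable u → Tendsto (fun n : ℕ =>
      ∫ x, ψ x * ∫ v in (0 : ℝ)..u x, cutoff ((n : ℝ) + 1) v) atTop (𝓝 (∫ x, ψ x * u x)) :=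
    fun u hu => by
    refine tendsto_integral_of_dominated_convergence (fun x => cψ * |u x|) (fun n => ?_)
      (hu.abs.const_mul _) (fun n => Eventually.of_forall fun x => ?_)
      (Eventually.of_forall fun x => Tendsto.const_mul _ ?_)
    · have hc : Continuous fun r => ∫ v in (0 : ℝ)..r, cutoff ((n : ℝ) + 1) v :=
        intervalIntegral.continuous_primitive
          (fun a b => (contDiff_cutoff _).continuous.intervalIntegrable a b) 0
      exact hψ.continuous.aestronglyMeasurable.mul (hc.comp_aestronglyMeasurable hu.1)
    · rw [norm_mul]
      have := abs_primitive_le (abs_cutoff_le_one ((n : ℝ) + 1)) (u x)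
      rw [one_mul] at this
      exact mul_le_mul (hcψ x) this (norm_nonneg _) ((norm_nonneg _).trans (hcψ 0))
    · have h1 : ∫ _ in (0 : ℝ)..u x, (1 : ℝ) = u x := by simp
      nth_rewrite 2 [← h1]
      refine intervalIntegral.tendsto_integral_filter_of_dominated_convergence (fun _ => 1)
        (Eventually.of_forall fun n => (contDiff_cutoff _).continuous.aestronglyMeasurable)
        (Eventually.of_forall fun n => Eventually.of_forall fun v _ => abs_cutoff_le_one _ v)
        intervalIntegrable_const (Eventually.of_forall fun v _ => tendsto_cutoff v)
  -- The measure m may charge t = 0, but it is felt only through η'. With η a velocity cutoff the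
  -- primitives tend to ρ₀ and ρ(0), and the contribution of m tends to 0.
  have hb := le_of_tendsto_of_tendsto ((hlim ρ₀ hs.initial).sub (hlim _ h0)).abs
    (hs.tail.tendsto_cutoff.const_mul cψ) (Eventually.of_forall fun n =>
      hs.abs_initial_le hρ hψ hψc hcψ (contDiff_cutoff _) (hasCompactSupport_cutoff (by positivity)))
  rw [mul_zero] at hb
  have := abs_nonpos_iff.1 hb
  simp only [smul_eq_mul]
  linarith

end Initial

/-! ### Integrating the almost-everywhere bounds on the coefficients. -/

section Coefficients

variable {A B g : ℝ → ℝ}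

lemma sub_le_of_ae_deriv_le (hg : ∀ a b : ℝ, AbsolutelyContinuousOnInterval g a b) {s r c : ℝ}
    (hsr : s ≤ r) (hb : ∀ᵐ v : ℝ, v ∈ Ioc s r → deriv g v ≤ c) : g r - g s ≤ c * (r - s) := by
  rw [← (hg s r).integral_deriv_eq_sub]
  calc ∫ v in s..r, deriv g v ≤ ∫ _ in s..r, c := by
        rw [intervalIntegral.integral_of_le hsr, intervalIntegral.integral_of_le hsr]
        refine integral_mono_ae ((intervalIntegrable_iff_integrableOn_Ioc_of_le hsr).1
          (hg s r).intervalIntegrable_deriv) (integrableOn_const (by simp)) ?_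
        exact (ae_restrict_iff' measurableSet_Ioc).2 hb
    _ = c * (r - s) := by simp [mul_comm]

lemma le_sub_of_ae_le_deriv (hg : ∀ a b : ℝ, AbsolutelyContinuousOnInterval g a b) {s r c : ℝ}
    (hsr : s ≤ r) (hb : ∀ᵐ v : ℝ, v ∈ Ioc s r → c ≤ deriv g v) : c * (r - s) ≤ g r - g s := by
  have h := sub_le_of_ae_deriv_le (g := -g) (c := -c) (fun a b => (hg a b).neg) hsr (by
    filter_upwards [hb] with v hv hvs
    rw [deriv.neg]
    exact neg_le_neg (hv hvs))
  simp only [Pi.neg_apply] at h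
  linarith

lemma LocallyLipschitz.absolutelyContinuous (hB : LocallyLipschitz B) (a b : ℝ) :
    AbsolutelyContinuousOnInterval B a b := by
  obtain ⟨K, hK⟩ := (hB.locallyLipschitzOn (s := uIcc a b)).exists_lipschitzOnWith_of_compact
    isCompact_uIcc
  exact hK.absolutelyContinuousOnInterval

/-- One-sided growth and Lipschitz bounds for the source. -/
structure SourceBounds (A : ℝ → ℝ) (a M₁ : ℝ) : Prop where
  nonneg : 0 ≤ a
  upper : ∀ v, A v ≤ a * |v|
  lower : ∀ v ≤ 0, -(a * |v|) ≤ A v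
  one_sided : ∀ s r, s ≤ r → A r - A s ≤ M₁ * (r - s)

/-- Integrate A' from or to 0. The constant M₂ serves only to bound A from above on v ≤ 0; nothing
bounds A from below on v > 0. Absolute values appear since M₁ and M₂ may be negative. -/
lemma exists_sourceBounds {M₁ M₂ : ℝ} (hA0 : A 0 = 0)
    (hA : ∀ a b : ℝ, AbsolutelyContinuousOnInterval A a b)
    (hA_pos : ∀ᵐ v : ℝ, 0 < v → deriv A v ≤ M₁)
    (hA_neg : ∀ᵐ v : ℝ, v ≤ 0 → -M₂ ≤ deriv A v ∧ deriv A v ≤ M₁) :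
    SourceBounds A (|M₁| + |M₂|) M₁ := by
  have hone : ∀ s r, s ≤ r → A r - A s ≤ M₁ * (r - s) := fun s r hsr => by
    refine sub_le_of_ae_deriv_le hA hsr ?_
    filter_upwards [hA_pos, hA_neg] with v h1 h2 _
    rcases lt_or_ge 0 v with h | h
    · exact h1 h
    · exact (h2 h).2
  have hm1 : ∀ v : ℝ, |M₁ * v| ≤ (|M₁| + |M₂|) * |v| := fun v => by
    rw [abs_mul]; gcongr; linarith [abs_nonneg M₂]
  have hm2 : ∀ v : ℝ, |M₂ * v| ≤ (|M₁| + |M₂|) * |v| := fun v => by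
    rw [abs_mul]; gcongr; linarith [abs_nonneg M₁]
  refine ⟨by positivity, fun v => ?_, fun v hv => ?_, hone⟩
  · rcases le_total 0 v with h | h
    · have := hone 0 v h
      linarith [(le_abs_self _).trans (hm1 v)]
    · have := le_sub_of_ae_le_deriv (c := -M₂) hA h (by
        filter_upwards [hA_neg] with w hw hwv using (hw hwv.2).1)
      linarith [(neg_le_abs _).trans (hm2 v)]
  · have := hone v 0 hv
    linarith [(neg_le_abs _).trans (hm1 v)]

lemma exists_coefficientBounds {d : ℕ} {F : ℝ → E d} (hF : LocallyLipschitz F) (hA0 : A 0 = 0)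
    (hA : ∀ a b : ℝ, AbsolutelyContinuousOnInterval A a b) (hB0 : B 0 = 0)
    (hB : LocallyLipschitz B) (hB_nonneg : ∀ᵐ v : ℝ, 0 ≤ deriv B v)
    (hB_bdd : ∃ K : ℝ, ∀ᵐ v : ℝ, |deriv B v| ≤ K) : ∃ K : ℝ≥0, CoefficientBounds F A B K := by
  obtain ⟨K, hK⟩ := hB_bdd
  have hac := LocallyLipschitz.absolutelyContinuous hB
  have h1 : ∀ s r, s ≤ r → 0 ≤ B r - B s := fun s r hsr => by
    have := le_sub_of_ae_le_deriv (c := 0) hac hsr (by filter_upwards [hB_nonneg] with v hv _ using hv)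
    linarith
  have h2 : ∀ s r, s ≤ r → B r - B s ≤ K.toNNReal * (r - s) := fun s r hsr => by
    refine sub_le_of_ae_deriv_le hac hsr ?_
    filter_upwards [hK] with v hv _
    exact ((le_abs_self _).trans hv).trans (Real.le_coe_toNNReal K)
  refine ⟨K.toNNReal, fun R => ?_, hA0, hA, ?_, fun s r hsr => by linarith [h1 s r hsr], hB0⟩
  -- One unit of margin makes the interval a neighbourhood of every v with |v| ≤ R, so the Lipschitz
  -- constant bounds `deriv F` there.
  · obtain ⟨c, hc⟩ := (hF.locallyLipschitzOn (s := Icc (-(R + 1)) (R + 1))).exists_lipschitzOnWith_of_compact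
      isCompact_Icc
    refine ⟨c, fun v hv => norm_deriv_le_of_lipschitzOn (Icc_mem_nhds ?_ ?_) hc⟩ <;>
      linarith [(abs_le.1 hv).1, (abs_le.1 hv).2]
  · refine LipschitzWith.of_dist_le_mul fun r s => ?_
    rw [Real.dist_eq, Real.dist_eq]
    rcases le_total s r with h | h
    · rw [abs_of_nonneg (h1 _ _ h), abs_of_nonneg (sub_nonneg.2 h)]; exact h2 _ _ h
    · rw [abs_sub_comm, abs_sub_comm r s, abs_of_nonneg (h1 _ _ h), abs_of_nonneg (sub_nonneg.2 h)]
      exact h2 _ _ h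

end Coefficients

/-! ### From kinetic to entropy solutions. -/

section Regularity

variable {d : ℕ} {F : ℝ → E d} {A B : ℝ → ℝ} {K : ℝ≥0} {α T : ℝ} {ρ₀ : E d → ℝ} {ρ : ℝ → E d → ℝ}

lemma integral_abs_eq_toReal_eLpNorm {g : E d → ℝ} (hg : AEStronglyMeasurable g) :
    ∫ x, |g x| = (eLpNorm g 1 volume).toReal := by
  rw [eLpNorm_one_eq_lintegral_enorm, ← integral_norm_eq_lintegral_enorm hg]
  rfl

/-- A continuous map from the compact interval [0,T] into the metric space L¹ is uniformly
continuous and bounded. -/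
lemma IsKineticSolution.l1Continuous_and_bounded (h : IsKineticSolution α T F A B ρ₀ ρ) :
    L1Continuous T ρ ∧ ∃ M, 0 ≤ M ∧ ∀ t ∈ Icc 0 T, ∫ x, |ρ t x| ≤ M := by
  set Φ : Icc 0 T → Lp ℝ 1 (volume : Measure (E d)) :=
    fun t => (memLp_one_iff_integrable.2 (h.integrable t t.2)).toLp (ρ t) with hΦ
  have hd : ∀ s t : Icc 0 T, ∫ x, |ρ s x - ρ t x| = dist (Φ s) (Φ t) := fun s t => by
    rw [dist_edist, hΦ, Lp.edist_toLp_toLp]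
    exact integral_abs_eq_toReal_eLpNorm ((h.integrable s s.2).sub (h.integrable t t.2)).1
  have hcont : Continuous Φ := by
    refine continuous_iff_continuousAt.2 fun t => ?_
    rw [ContinuousAt, tendsto_iff_edist_tendsto_0]
    simp only [hΦ, Lp.edist_toLp_toLp]
    have := h.continuous t t.2
    rw [nhdsWithin_eq_map_subtype_coe t.2] at this
    exact tendsto_map'_iff.1 this
  refine ⟨⟨h.integrable, fun ε hε => ?_⟩, ?_⟩
  · obtain ⟨δ, hδ, hu⟩ := Metric.uniformContinuous_iff.1
      (CompactSpace.uniformContinuous_of_continuous hcont) ε hε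
    refine ⟨δ, hδ, fun s hs t ht hst => ?_⟩
    have := hu (a := ⟨s, hs⟩) (b := ⟨t, ht⟩) (by rw [Subtype.dist_eq, Real.dist_eq]; exact hst)
    rw [← hd] at this
    exact this.le
  · obtain ⟨M, hM⟩ := (isCompact_univ (X := Icc 0 T)).exists_bound_of_continuousOn hcont.continuousOn
    refine ⟨|M|, abs_nonneg _, fun t ht => ?_⟩
    have := hM ⟨t, ht⟩ (mem_univ _)
    rw [hΦ, Lp.norm_toLp] at this
    rw [integral_abs_eq_toReal_eLpNorm (h.integrable t ht).1]
    exact this.trans (le_abs_self _)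

lemma IsKineticSolution.exists_entropySolution (h : IsKineticSolution α T F A B ρ₀ ρ) (hd : 0 < d)
    (hT : 0 < T) (hα : α ∈ Ioo (0 : ℝ) 1) (hc : CoefficientBounds F A B K)
    (hρ₀ : Integrable ρ₀) :
    L1Continuous T ρ ∧ ∃ M C m, EntropySolution α T F A B K M C ρ₀ ρ m := by
  obtain ⟨hL, M, hM0, hM⟩ := h.l1Continuous_and_bounded
  obtain ⟨C, hC⟩ := h.bounded_variation
  obtain ⟨m, -, hsol, g, hg, hmap⟩ := h.kinetic
  have hb : TranslationBounded T M C ρ := by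
    refine ⟨h.measurable, ⟨hM0, C.2⟩, ?_⟩
    filter_upwards [ae_restrict_of_ae hC, ae_restrict_mem measurableSet_Ioo] with t ht htT
    have hti := h.integrable t (Ioo_subset_Icc_self htT)
    refine ⟨hti, hM t (Ioo_subset_Icc_self htT), fun z => ?_⟩
    exact integral_abs_translate_sub_le (h.measurable.comp measurable_prodMk_left) hti
      (ht ⟨htT.1.le, htT.2⟩) z
  obtain ⟨hfin, htail⟩ := vanishingTail_of_map (Measure.le_add_right le_rfl) hg hmap
  exact ⟨hL, M, C, m, hd, hT, hα, hc, hb, hρ₀, htail, fun θ ψ η hθ hθc hθT hψ hψc hη hηc =>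
    (entropy_identity hc hb hd hT hα hρ₀ hsol hfin hθ hθc hθT hψ hψc hη hηc).2.2⟩

end Regularity

/-! ### Integrals over pairs of points; the sign of the nonlocal term. -/

section ProductSpace

variable {d : ℕ} {T : ℝ}

/-- For fixed u the second point enters only through κ(ξ(u) - y), which integrates to T ‖κ‖₁. The
space X is general because u ranges over the strip in one use and over the phase space of the
dissipation measure in another. -/
lemma integrable_kernel_mul {X : Type*} [MeasurableSpace X] {μ : Measure X} [SFinite μ]
    (hT : 0 < T) {ξ : X → E d} (hξ : Measurable ξ) {κ : E d → ℝ} (hκm : Measurable κ)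
    (hκ : Integrable κ) {g : X → ℝ} (hg : Integrable g μ) :
    Integrable (fun π : X × (ℝ × E d) => κ (ξ π.1 - π.2.2) * g π.1) (μ.prod (slab d T)) ∧
    ∫ π : X × (ℝ × E d), |κ (ξ π.1 - π.2.2) * g π.1| ∂μ.prod (slab d T)
      = T * (∫ x, |κ x|) * ∫ u, |g u| ∂μ := by
  have hm : AEStronglyMeasurable (fun π : X × (ℝ × E d) => κ (ξ π.1 - π.2.2) * g π.1)
      (μ.prod (slab d T)) :=
    (hκm.comp ((hξ.comp measurable_fst).sub
      (measurable_snd.comp measurable_snd))).aestronglyMeasurable.mul hg.1.comp_fst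
  have e : ∀ u, ∫ q : ℝ × E d, ‖κ (ξ u - q.2) * g u‖ ∂slab d T = T * (∫ x, |κ x|) * |g u| :=
    fun u => by
    simp only [norm_mul, Real.norm_eq_abs]
    rw [integral_mul_const, slab, integral_fun_snd (fun y => |κ (ξ u - y)|),
      integral_sub_left_eq_self (fun y => |κ y|)]
    simp [hT.le]
  have hi : Integrable (fun π : X × (ℝ × E d) => κ (ξ π.1 - π.2.2) * g π.1)
      (μ.prod (slab d T)) := by
    refine (integrable_prod_iff hm).2 ⟨Eventually.of_forall fun u => ?_, ?_⟩
    · exact ((hκ.comp_sub_left (ξ u)).comp_snd (volume.restrict (Ioo 0 T))).mul_const (g u)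
    · simp only [e]
      exact hg.abs.const_mul _
  refine ⟨hi, ?_⟩
  rw [integral_prod _ hi.abs, ← integral_const_mul]
  exact integral_congr_ae (Eventually.of_forall e)

/-- The doubled integrals carry no cutoff in x + y. It is enough that κ localises x - y and that
each of g₁, g₂ is integrable in its own variable. -/
lemma integrable_of_abs_le_kernel (hT : 0 < T) {κ : E d → ℝ} (hκm : Measurable κ)
    (hκ : Integrable κ) {g₁ g₂ : ℝ × E d → ℝ} (h₁ : Integrable g₁ (slab d T))
    (h₂ : Integrable g₂ (slab d T)) {f : (ℝ × E d) × (ℝ × E d) → ℝ}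
    (hf : AEStronglyMeasurable f ((slab d T).prod (slab d T)))
    (hb : ∀ π, |f π| ≤ κ (π.1.2 - π.2.2) * (g₁ π.1 + g₂ π.2)) :
    Integrable f ((slab d T).prod (slab d T)) ∧
    ∫ π, |f π| ∂(slab d T).prod (slab d T)
      ≤ T * (∫ x, |κ x|) * ((∫ p, |g₁ p| ∂slab d T) + ∫ p, |g₂ p| ∂slab d T) := by
  obtain ⟨i1, e1⟩ := integrable_kernel_mul hT measurable_snd hκm hκ h₁
  obtain ⟨i2, e2⟩ := integrable_kernel_mul hT measurable_snd (hκm.comp measurable_neg)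
    hκ.comp_neg h₂
  have i3 : Integrable (fun π : (ℝ × E d) × (ℝ × E d) => κ (π.1.2 - π.2.2) * g₂ π.2)
      ((slab d T).prod (slab d T)) := by
    refine i2.swap.congr (Eventually.of_forall fun π => ?_)
    simp
  have e3 : ∫ π : (ℝ × E d) × (ℝ × E d), |κ (π.1.2 - π.2.2) * g₂ π.2|
      ∂(slab d T).prod (slab d T) = T * (∫ x, |κ x|) * ∫ u, |g₂ u| ∂slab d T := by
    rw [← integral_prod_swap]
    simp only [Function.comp_apply, neg_sub] at e2
    simp only [Prod.fst_swap, Prod.snd_swap]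
    rw [e2, integral_neg_eq_self (fun x => |κ x|)]
  have hbi : ∀ π, ‖f π‖ ≤ |κ (π.1.2 - π.2.2) * g₁ π.1| + |κ (π.1.2 - π.2.2) * g₂ π.2| := fun π => by
    refine (hb π).trans ?_
    rw [mul_add]
    exact add_le_add (le_abs_self _) (le_abs_self _)
  have hi : Integrable f ((slab d T).prod (slab d T)) :=
    (i1.abs.add i3.abs).mono' hf (Eventually.of_forall hbi)
  refine ⟨hi, ?_⟩
  rw [mul_add, ← e1, ← e3, ← integral_add i1.abs i3.abs]
  exact integral_mono hi.abs (i1.abs.add i3.abs) hbi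

lemma measurePreserving_translate (z : E d) :
    MeasurePreserving (fun π : (ℝ × E d) × (ℝ × E d) => ((π.1.1, z + π.1.2), (π.2.1, z + π.2.2)))
      ((slab d T).prod (slab d T)) ((slab d T).prod (slab d T)) := by
  have h : MeasurePreserving (fun p : ℝ × E d => (p.1, z + p.2)) (slab d T) (slab d T) :=
    (MeasurePreserving.id _).prod (measurePreserving_add_left volume z)
  exact h.prod h

/-- The nonlocal term dissipates the positive part of the difference of two functions. -/
theorem integral_nonlocal_nonneg {M₁ C₁ M₂ C₂ α : ℝ} {u₁ u₂ : ℝ → E d → ℝ}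
    (h₁ : TranslationBounded T M₁ C₁ u₁) (h₂ : TranslationBounded T M₂ C₂ u₂) (hd : 0 < d)
    (hT : 0 < T) (hα : α ∈ Ioo (0 : ℝ) 1) {w : ℝ → ℝ → ℝ} (hw : Measurable (Function.uncurry w))
    (hw0 : ∀ t s, 0 ≤ w t s) {c : ℝ} (hwc : ∀ t s, w t s ≤ c) {κ : E d → ℝ}
    (hκm : Measurable κ) (hκ : Integrable κ) (hκ0 : ∀ x, 0 ≤ κ x)
    {σ : (ℝ × E d) × (ℝ × E d) → ℝ} (hσm : Measurable σ) (hσ0 : ∀ π, 0 ≤ σ π) (hσ1 : ∀ π, σ π ≤ 1)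
    (hσ : ∀ π, σ π * (u₁ π.1.1 π.1.2 - u₂ π.2.1 π.2.2)
      = max (u₁ π.1.1 π.1.2 - u₂ π.2.1 π.2.2) 0) :
    0 ≤ ∫ π, w π.1.1 π.2.1 * κ (π.1.2 - π.2.2) * (σ π *
      (fracLap α (u₁ π.1.1) π.1.2 - fracLap α (u₂ π.2.1) π.2.2)) ∂(slab d T).prod (slab d T) := by
  have hc0 : 0 ≤ c := (hw0 0 0).trans (hwc 0 0)
  set N : E d → ℝ := fun z => ‖z‖ ^ ((d : ℝ) + α) with hN
  have hN0 : ∀ z, 0 ≤ N z := fun z => by positivity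
  have hNm : Measurable N := by fun_prop
  set D₁ : (ℝ × E d) × E d → ℝ :=
    fun q => (u₁ q.1.1 q.1.2 - u₁ q.1.1 (q.2 + q.1.2)) / N q.2 with hD₁
  set D₂ : (ℝ × E d) × E d → ℝ :=
    fun q => (u₂ q.1.1 q.1.2 - u₂ q.1.1 (q.2 + q.1.2)) / N q.2 with hD₂
  have i₁ : Integrable D₁ ((slab d T).prod volume) := h₁.integrable_diff_div hd hT hα
  have i₂ : Integrable D₂ ((slab d T).prod volume) := h₂.integrable_diff_div hd hT hα
  have m₁ : Measurable D₁ :=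
    ((h₁.measurable.comp measurable_fst).sub h₁.measurable_translate).div (hNm.comp measurable_snd)
  have m₂ : Measurable D₂ :=
    ((h₂.measurable.comp measurable_fst).sub h₂.measurable_translate).div (hNm.comp measurable_snd)
  set W : (ℝ × E d) × (ℝ × E d) → ℝ := fun π => w π.1.1 π.2.1 * κ (π.1.2 - π.2.2) with hW
  have hWm : Measurable W := (hw.comp ((measurable_fst.comp measurable_fst).prodMk
    (measurable_fst.comp measurable_snd))).mul (hκm.comp ((measurable_snd.comp measurable_fst).sub
      (measurable_snd.comp measurable_snd)))
  have hW0 : ∀ π, 0 ≤ W π := fun π => mul_nonneg (hw0 _ _) (hκ0 _)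
  have hWc : ∀ π, W π ≤ c * κ (π.1.2 - π.2.2) := fun π =>
    mul_le_mul_of_nonneg_right (hwc _ _) (hκ0 _)
  have hcκm : Measurable fun x => c * κ x := hκm.const_mul c
  -- integrability on the triple product of any function controlled by the difference quotients
  have htriple : ∀ Q : ((ℝ × E d) × (ℝ × E d)) × E d → ℝ, Measurable Q →
      (∀ π z, |Q (π, z)| ≤ W π * (|D₁ (π.1, z)| + |D₂ (π.2, z)|)) →
      Integrable Q (((slab d T).prod (slab d T)).prod volume) := fun Q hQm hQ => by
    have hz : ∀ᵐ z, Integrable (fun π => Q (π, z)) ((slab d T).prod (slab d T)) ∧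
        ∫ π, ‖Q (π, z)‖ ∂(slab d T).prod (slab d T) ≤ T * (∫ x, |c * κ x|) *
          ((∫ p, |D₁ (p, z)| ∂slab d T) + ∫ p, |D₂ (p, z)| ∂slab d T) := by
      filter_upwards [i₁.prod_left_ae, i₂.prod_left_ae] with z hz1 hz2
      have h := integrable_of_abs_le_kernel hT hcκm (hκ.const_mul c) hz1.abs hz2.abs
        (f := fun π => Q (π, z)) (hQm.comp measurable_prodMk_right).aestronglyMeasurable
        fun π => (hQ π z).trans (mul_le_mul_of_nonneg_right (hWc π) (by positivity))
      simpa only [abs_abs, Real.norm_eq_abs] using h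
    refine (integrable_prod_iff' hQm.aestronglyMeasurable).2 ⟨hz.mono fun z h => h.1, ?_⟩
    refine ((i₁.abs.integral_prod_right.add i₂.abs.integral_prod_right).const_mul
      (T * (∫ x, |c * κ x|))).mono'
      (hQm.norm.stronglyMeasurable.integral_prod_left').aestronglyMeasurable (hz.mono fun z h => ?_)
    rw [Real.norm_of_nonneg (integral_nonneg fun _ => norm_nonneg _)]
    exact h.2
  set G : (ℝ × E d) × (ℝ × E d) → ℝ := fun π => max (u₁ π.1.1 π.1.2 - u₂ π.2.1 π.2.2) 0 with hG
  have hGm : Measurable G := ((h₁.measurable.comp measurable_fst).sub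
    (h₂.measurable.comp measurable_snd)).max measurable_const
  set τ : E d → (ℝ × E d) × (ℝ × E d) → (ℝ × E d) × (ℝ × E d) :=
    fun z π => ((π.1.1, z + π.1.2), (π.2.1, z + π.2.2)) with hτ
  have hτm : Measurable fun r : ((ℝ × E d) × (ℝ × E d)) × E d => τ r.2 r.1 := by
    simp only [hτ]; fun_prop
  set Q : ((ℝ × E d) × (ℝ × E d)) × E d → ℝ :=
    fun r => W r.1 * (σ r.1 * (D₁ (r.1.1, r.2) - D₂ (r.1.2, r.2))) with hQ
  set R : ((ℝ × E d) × (ℝ × E d)) × E d → ℝ :=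
    fun r => W r.1 * ((G r.1 - G (τ r.2 r.1)) / N r.2) with hR
  have hQi : Integrable Q (((slab d T).prod (slab d T)).prod volume) := by
    refine htriple Q ?_ fun π z => ?_
    · exact (hWm.comp measurable_fst).mul ((hσm.comp measurable_fst).mul
        ((m₁.comp ((measurable_fst.comp measurable_fst).prodMk measurable_snd)).sub
          (m₂.comp ((measurable_snd.comp measurable_fst).prodMk measurable_snd))))
    · simp only [hQ]
      rw [abs_mul, abs_of_nonneg (hW0 π), abs_mul, abs_of_nonneg (hσ0 π)]
      exact mul_le_mul_of_nonneg_left ((mul_le_of_le_one_left (abs_nonneg _) (hσ1 π)).trans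
        (abs_sub _ _)) (hW0 π)
  have hRi : Integrable R (((slab d T).prod (slab d T)).prod volume) := by
    refine htriple R ?_ fun π z => ?_
    · exact (hWm.comp measurable_fst).mul (((hGm.comp measurable_fst).sub
        (hGm.comp hτm)).div (hNm.comp measurable_snd))
    · simp only [hR, hD₁, hD₂]
      rw [abs_mul, abs_of_nonneg (hW0 π), abs_div, abs_div, abs_div, abs_of_nonneg (hN0 z),
        ← add_div]
      refine mul_le_mul_of_nonneg_left (div_le_div_of_nonneg_right ?_ (hN0 z)) (hW0 π)
      refine (abs_max_sub_max_le_abs _ _ _).trans ?_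
      rw [show u₁ π.1.1 π.1.2 - u₂ π.2.1 π.2.2 - (u₁ (τ z π).1.1 (τ z π).1.2
        - u₂ (τ z π).2.1 (τ z π).2.2) = (u₁ π.1.1 π.1.2 - u₁ π.1.1 (z + π.1.2))
        - (u₂ π.2.1 π.2.2 - u₂ π.2.1 (z + π.2.2)) by simp only [hτ]; ring]
      exact abs_sub _ _
  -- Convexity of the positive part: σ is a subgradient at u₁ - u₂, so the increment of the positive
  -- part from the translated pair to the original one is at most σ times the increment of the
  -- difference.
  have hRQ : ∀ r, R r ≤ Q r := fun r => by
    refine mul_le_mul_of_nonneg_left ?_ (hW0 r.1)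
    simp only [hD₁, hD₂]
    rw [← sub_div, ← mul_div_assoc]
    refine div_le_div_of_nonneg_right ?_ (hN0 r.2)
    have e1 := hσ r.1
    have e2 : σ r.1 * (u₁ r.1.1.1 (r.2 + r.1.1.2) - u₂ r.1.2.1 (r.2 + r.1.2.2))
        ≤ G (τ r.2 r.1) := by
      refine (mul_le_mul_of_nonneg_left (le_max_left _ 0) (hσ0 r.1)).trans ?_
      exact mul_le_of_le_one_left (le_max_right _ _) (hσ1 r.1)
    simp only [hG] at e2 ⊢
    linarith
  -- For every z, moving x and y together by z preserves the measure and κ(x-y), so the integral of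
  -- W G does not change. This is done for fixed z, where no singularity is present.
  have hR0 : ∫ r, R r ∂((slab d T).prod (slab d T)).prod volume = 0 := by
    rw [integral_prod_symm _ hRi]
    refine integral_eq_zero_of_ae (Eventually.of_forall fun z => ?_)
    have hGi : Integrable (fun π => W π * G π) ((slab d T).prod (slab d T)) := by
      refine (integrable_of_abs_le_kernel hT hcκm (hκ.const_mul c) h₁.integrable.abs
        h₂.integrable.abs (hWm.mul hGm).aestronglyMeasurable fun π => ?_).1
      rw [Pi.mul_apply, abs_mul, abs_of_nonneg (hW0 π)]
      refine mul_le_mul (hWc π) ?_ (abs_nonneg _) (mul_nonneg hc0 (hκ0 _))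
      rw [abs_of_nonneg (le_max_right _ _)]
      exact max_le ((le_abs_self _).trans (abs_sub _ _)) (by positivity)
    have hp := measurePreserving_translate (d := d) (T := T) z
    have hWτ : ∀ π, W (τ z π) = W π := fun π => by simp [hW, hτ]
    have hGτ : Integrable (fun π => W π * G (τ z π)) ((slab d T).prod (slab d T)) :=
      (hp.integrable_comp_of_integrable hGi).congr
        (Eventually.of_forall fun π => congrArg (· * G (τ z π)) (hWτ π))
    have e1 : ∫ π, W π * G (τ z π) ∂(slab d T).prod (slab d T)
        = ∫ π, W π * G π ∂(slab d T).prod (slab d T) := by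
      have h := integral_map (f := fun π => W π * G π) hp.measurable.aemeasurable
        (by rw [hp.map_eq]; exact hGi.1)
      rw [hp.map_eq] at h
      rw [h]
      exact integral_congr_ae (Eventually.of_forall fun π =>
        congrArg (· * G (τ z π)) (hWτ π).symm)
    simp only [hR, Pi.zero_apply, ← mul_div_assoc, mul_sub]
    rw [integral_div, integral_sub hGi hGτ, e1, sub_self, zero_div]
  have hQ0 : 0 ≤ ∫ r, Q r ∂((slab d T).prod (slab d T)).prod volume := by
    rw [← hR0]; exact integral_mono hRi hQi hRQ
  rw [integral_prod _ hQi] at hQ0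
  refine (mul_nonneg (fracConst_nonneg d hα) hQ0).trans_eq ?_
  rw [← integral_const_mul]
  refine integral_congr_ae ?_
  have a₁ := Measure.quasiMeasurePreserving_fst (μ := slab d T) (ν := slab d T) |>.ae
    (h₁.ae_integrable_diff_div hd hT hα)
  have a₂ := Measure.quasiMeasurePreserving_snd (μ := slab d T) (ν := slab d T) |>.ae
    (h₂.ae_integrable_diff_div hd hT hα)
  filter_upwards [a₁, a₂] with π hπ1 hπ2
  simp only [hQ, integral_const_mul]
  rw [integral_sub hπ1 hπ2]
  simp only [fracLap, hW]
  ring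

end ProductSpace

/-! ### Doubling of variables. -/

section Doubling

variable {d : ℕ} {T : ℝ}

/-- Localisation in time (`θ`), and regularisation of the diagonal in time (`γ`) and space (`κ`). -/
structure DoublingWeights (T a b : ℝ) (θ γ : ℝ → ℝ) (κ : E d → ℝ) : Prop where
  pos : 0 < a
  lt : b < T
  smooth_time : ContDiff ℝ ∞ θ
  compact_time : HasCompactSupport θ
  nonneg_time : ∀ t, 0 ≤ θ t
  smooth_diag : ContDiff ℝ ∞ γ
  compact_diag : HasCompactSupport γ
  nonneg_diag : ∀ r, 0 ≤ γ r
  smooth_space : ContDiff ℝ ∞ κ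
  compact_space : HasCompactSupport κ
  nonneg_space : ∀ x, 0 ≤ κ x
  mem : ∀ t s, θ t * γ (t - s) ≠ 0 → t ∈ Icc a b ∧ s ∈ Icc a b

/-- The parameter integrals of the truncation defect are controlled by its total mass. -/
lemma StripFinite.integral_defect_le {m : Measure (ℝ × E d × ℝ)} (hm : StripFinite m) (hT : 0 < T)
    {h : ℝ → ℝ} (hh : Continuous h) (hhc : HasCompactSupport h) {w : ℝ → ℝ → ℝ}
    (hw : Measurable (Function.uncurry w)) {c : ℝ} (hwc : ∀ t s, |w t s| ≤ c) {κ : E d → ℝ}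
    (hκm : Measurable κ) (hκ : Integrable κ) :
    Integrable (fun q : ℝ × E d => ∫ u, w u.1 q.1 * κ (u.2.1 - q.2) * |h u.2.2| ∂m) (slab d T) ∧
    ∫ q, (∫ u, w u.1 q.1 * κ (u.2.1 - q.2) * |h u.2.2| ∂m) ∂slab d T
      ≤ c * (T * ∫ x, |κ x|) * ∫ u, |h u.2.2| ∂m := by
  have hc0 : 0 ≤ c := (abs_nonneg _).trans (hwc 0 0)
  obtain ⟨R, -, hR⟩ := abs_le_of_mem_tsupport hhc
  -- Restricted to the strip containing the support of h, m is a finite measure, to which Fubini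
  -- applies.
  set s : Set (ℝ × E d × ℝ) := {u | |u.2.2| ≤ R} with hs
  have hout : ∀ u, u ∉ s → |h u.2.2| = 0 := fun u hu => by rw [hR _ (not_le.1 hu), abs_zero]
  have : IsFiniteMeasure (m.restrict s) := ⟨by rw [Measure.restrict_apply_univ]; exact hm R⟩
  have hg : Integrable (fun u : ℝ × E d × ℝ => |h u.2.2|) (m.restrict s) :=
    (hm.integrable_velocity hh hhc).abs.restrict
  obtain ⟨i1, e1⟩ := integrable_kernel_mul (μ := m.restrict s) hT
    (measurable_fst.comp measurable_snd) hκm hκ hg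
  set f : (ℝ × E d × ℝ) × (ℝ × E d) → ℝ :=
    fun r => w r.1.1 r.2.1 * (κ (r.1.2.1 - r.2.2) * |h r.1.2.2|) with hf
  have hwm : Measurable fun r : (ℝ × E d × ℝ) × (ℝ × E d) => w r.1.1 r.2.1 :=
    hw.comp ((measurable_fst.comp measurable_fst).prodMk (measurable_fst.comp measurable_snd))
  have hfi : Integrable f ((m.restrict s).prod (slab d T)) :=
    i1.bdd_mul (c := c) hwm.aestronglyMeasurable (Eventually.of_forall fun r => hwc _ _)
  have e : ∀ q : ℝ × E d, ∫ u, f (u, q) ∂m.restrict s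
      = ∫ u, w u.1 q.1 * κ (u.2.1 - q.2) * |h u.2.2| ∂m := fun q => by
    simp only [hf, mul_assoc]
    refine setIntegral_eq_integral_of_forall_compl_eq_zero fun u hu => ?_
    rw [hout u hu]; simp
  have e' : ∫ u, |h u.2.2| ∂m.restrict s = ∫ u, |h u.2.2| ∂m :=
    setIntegral_eq_integral_of_forall_compl_eq_zero fun u hu => hout u hu
  have hir := hfi.integral_prod_right
  have hsymm := integral_prod_symm f hfi
  simp only [e] at hir hsymm
  refine ⟨hir, ?_⟩
  rw [← hsymm]
  simp only [abs_abs, e'] at e1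
  rw [mul_assoc c, ← e1, ← integral_const_mul]
  refine integral_mono hfi (i1.abs.const_mul c) fun r => ?_
  refine (le_abs_self _).trans ?_
  simp only [hf]
  rw [abs_mul]
  exact mul_le_mul_of_nonneg_right (hwc _ _) (abs_nonneg _)

/-- With states interchanged, both inequalities carry the same indicator of ρ₂ < ρ₁, also on the set
where ρ₁ = ρ₂. -/
lemma lowerStep_eq (k v : ℝ) : lowerStep k v = -upperStep v k := by
  by_cases h : v < k <;> simp [lowerStep, upperStep, h]

lemma upperStep_nonneg (k v : ℝ) : 0 ≤ upperStep k v := indicator_nonneg (fun _ _ => zero_le_one) _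

lemma upperStep_le_one (k v : ℝ) : upperStep k v ≤ 1 :=
  (le_abs_self _).trans (abs_upperStep_le_one k v)

lemma measurable_upperStep_uncurry : Measurable fun r : ℝ × ℝ => upperStep r.1 r.2 := by
  have : (fun r : ℝ × ℝ => upperStep r.1 r.2) = {r : ℝ × ℝ | r.1 < r.2}.indicator fun _ => 1 := by
    ext r; by_cases h : r.1 < r.2 <;> simp [upperStep, h]
  rw [this]
  exact measurable_const.indicator (measurableSet_lt measurable_fst measurable_snd)

variable {F : ℝ → E d} {A B : ℝ → ℝ} {K : ℝ≥0} {α M₁ C₁ M₂ C₂ a b : ℝ} {ρ₀₁ ρ₀₂ : E d → ℝ}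
  {ρ₁ ρ₂ : ℝ → E d → ℝ} {m₁ m₂ : Measure (ℝ × E d × ℝ)} {θ γ : ℝ → ℝ} {κ : E d → ℝ}

/-- Source minus diffusion, localised in time. -/
def localSource (α : ℝ) (A B : ℝ → ℝ) (a b : ℝ) (ρ : ℝ → E d → ℝ) (p : ℝ × E d) : ℝ :=
  (Icc a b).indicator (fun _ => 1) p.1 *
    (A (ρ p.1 p.2) - fracLap α (fun y => B (ρ p.1 y)) p.2)

set_option maxHeartbeats 1000000 in
/-- Doubling of variables for the truncated inequalities. -/
theorem doubling_truncated (hs₁ : EntropySolution α T F A B K M₁ C₁ ρ₀₁ ρ₁ m₁)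
    (hs₂ : EntropySolution α T F A B K M₂ C₂ ρ₀₂ ρ₂ m₂) (hw : DoublingWeights T a b θ γ κ)
    (hS₁ : Integrable (localSource α A B a b ρ₁) (slab d T))
    (hS₂ : Integrable (localSource α A B a b ρ₂) (slab d T)) {c : ℝ}
    (hc : ∀ t r, θ t * γ r ≤ c) {H : ℝ → ℝ} (hH : ContDiff ℝ ∞ H) (hHc : HasCompactSupport H)
    (hH0 : ∀ v, 0 ≤ H v) :
    -(c * (T * ∫ x, |κ x|) * ((∫ u, |deriv H u.2.2| ∂m₁) + ∫ u, |deriv H u.2.2| ∂m₂)) ≤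
    ∫ π, (deriv θ π.1.1 * γ (π.1.1 - π.2.1) * κ (π.1.2 - π.2.2)
          * ((∫ v in (0 : ℝ)..max (ρ₁ π.1.1 π.1.2) (ρ₂ π.2.1 π.2.2), H v)
            - ∫ v in (0 : ℝ)..ρ₂ π.2.1 π.2.2, H v)
        + θ π.1.1 * γ (π.1.1 - π.2.1) * κ (π.1.2 - π.2.2)
          * (upperStep (ρ₂ π.2.1 π.2.2) (ρ₁ π.1.1 π.1.2)
            * (H (ρ₁ π.1.1 π.1.2) * localSource α A B a b ρ₁ π.1
              - H (ρ₂ π.2.1 π.2.2) * localSource α A B a b ρ₂ π.2)))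
      ∂(slab d T).prod (slab d T) := by
  have hT := hs₁.time_pos
  have hθ := hw.smooth_time
  have hγ := hw.smooth_diag
  have hκ := hw.smooth_space
  have hθd : Differentiable ℝ θ := hθ.differentiable (by simp)
  have hγd : Differentiable ℝ γ := hγ.differentiable (by simp)
  have hκd : Differentiable ℝ κ := hκ.differentiable (by simp)
  have hθ' : Continuous (deriv θ) := hθ.continuous_deriv (by simp)
  have hγ' : Continuous (deriv γ) := hγ.continuous_deriv (by simp)
  have hκ' : Continuous (fderiv ℝ κ) := hκ.continuous_fderiv (by simp)
  have hθm := hθ.continuous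
  have hγm := hγ.continuous
  have hκm := hκ.continuous
  have hκi : Integrable κ := hκm.integrable_of_hasCompactSupport hw.compact_space
  have hκi' : Integrable (fun x => ‖fderiv ℝ κ x‖) :=
    (hκ'.integrable_of_hasCompactSupport (hw.compact_space.fderiv (𝕜 := ℝ))).norm
  obtain ⟨cθ, hcθ⟩ := hw.compact_time.exists_bound_of_continuous hθm
  obtain ⟨cθ', hcθ'⟩ := hw.compact_time.deriv.exists_bound_of_continuous hθ'
  obtain ⟨cγ, hcγ⟩ := hw.compact_diag.exists_bound_of_continuous hγm
  obtain ⟨cγ', hcγ'⟩ := hw.compact_diag.deriv.exists_bound_of_continuous hγ'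
  obtain ⟨cH, hcH⟩ := hHc.exists_bound_of_continuous hH.continuous
  have hcθ0 := (norm_nonneg _).trans (hcθ 0)
  have hcθ0' := (norm_nonneg _).trans (hcθ' 0)
  have hcγ0 := (norm_nonneg _).trans (hcγ 0)
  have hcγ0' := (norm_nonneg _).trans (hcγ' 0)
  have hcH0 := (norm_nonneg _).trans (hcH 0)
  obtain ⟨cΨ, hcΨ0, hcΨ⟩ := hs₁.coeff.exists_fluxField_lipschitz hH.continuous hHc
  have hΨc : Continuous (fluxField F H) := by
    refine (LipschitzWith.of_dist_le_mul (K := ⟨cΨ, hcΨ0⟩) fun r s => ?_).continuous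
    rw [dist_eq_norm, Real.dist_eq]; exact hcΨ r s
  have hρ₁ : Measurable fun π : (ℝ × E d) × (ℝ × E d) => ρ₁ π.1.1 π.1.2 :=
    hs₁.bounded.measurable.comp measurable_fst
  have hρ₂ : Measurable fun π : (ℝ × E d) × (ℝ × E d) => ρ₂ π.2.1 π.2.2 :=
    hs₂.bounded.measurable.comp measurable_snd
  set S : ℝ → ℝ := fun r => ∫ v in (0 : ℝ)..r, H v with hS
  have hSl : ∀ r s, |S r - S s| ≤ cH * |r - s| :=
    abs_intervalIntegral_sub_le hH.continuous.locallyIntegrable hcH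
  have hSm : Measurable S := (intervalIntegral.continuous_primitive
    (fun a b => hH.continuous.intervalIntegrable a b) 0).measurable
  have hmax : ∀ r s : ℝ, |max r s - s| ≤ |r| + |s| := fun r s => by
    rw [abs_of_nonneg (sub_nonneg.2 (le_max_right _ _))]
    rcases max_cases r s with h | h <;> rw [h.1]
    · exact (le_abs_self _).trans (abs_sub _ _)
    · rw [sub_self]; positivity
  set Δ : (ℝ × E d) × (ℝ × E d) → ℝ := fun π =>
    S (max (ρ₁ π.1.1 π.1.2) (ρ₂ π.2.1 π.2.2)) - S (ρ₂ π.2.1 π.2.2) with hΔ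
  have hΔm : Measurable Δ := (hSm.comp (hρ₁.max hρ₂)).sub (hSm.comp hρ₂)
  have hΔb : ∀ π, |Δ π| ≤ cH * (|ρ₁ π.1.1 π.1.2| + |ρ₂ π.2.1 π.2.2|) := fun π =>
    (hSl _ _).trans (mul_le_mul_of_nonneg_left (hmax _ _) hcH0)
  set Ψ : (ℝ × E d) × (ℝ × E d) → E d := fun π =>
    fluxField F H (max (ρ₁ π.1.1 π.1.2) (ρ₂ π.2.1 π.2.2)) - fluxField F H (ρ₂ π.2.1 π.2.2) with hΨ
  have hΨm : Measurable Ψ :=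
    (hΨc.measurable.comp (hρ₁.max hρ₂)).sub (hΨc.measurable.comp hρ₂)
  have hΨb : ∀ π, ‖Ψ π‖ ≤ cΨ * (|ρ₁ π.1.1 π.1.2| + |ρ₂ π.2.1 π.2.2|) := fun π =>
    (hcΨ _ _).trans (mul_le_mul_of_nonneg_left (hmax _ _) hcΨ0)
  have hg₁ := hs₁.bounded.integrable.abs
  have hg₂ := hs₂.bounded.integrable.abs
  set σ : (ℝ × E d) × (ℝ × E d) → ℝ := fun π =>
    upperStep (ρ₂ π.2.1 π.2.2) (ρ₁ π.1.1 π.1.2) with hσ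
  have hσm : Measurable σ := measurable_upperStep_uncurry.comp (hρ₂.prodMk hρ₁)
  have hσb : ∀ π, |σ π| ≤ 1 := fun π => abs_upperStep_le_one _ _
  set S₁ := localSource α A B a b ρ₁ with hS₁'
  set S₂ := localSource α A B a b ρ₂ with hS₂'
  -- the four contributions
  set I₁ : (ℝ × E d) × (ℝ × E d) → ℝ := fun π =>
    deriv θ π.1.1 * γ (π.1.1 - π.2.1) * κ (π.1.2 - π.2.2) * Δ π with hI₁
  set I₂ : (ℝ × E d) × (ℝ × E d) → ℝ := fun π =>
    θ π.1.1 * deriv γ (π.1.1 - π.2.1) * κ (π.1.2 - π.2.2) * Δ π with hI₂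
  set I₃ : (ℝ × E d) × (ℝ × E d) → ℝ := fun π =>
    θ π.1.1 * γ (π.1.1 - π.2.1) * fderiv ℝ κ (π.1.2 - π.2.2) (Ψ π) with hI₃
  set J₁ : (ℝ × E d) × (ℝ × E d) → ℝ := fun π =>
    θ π.1.1 * γ (π.1.1 - π.2.1) * κ (π.1.2 - π.2.2) * (σ π * (H (ρ₁ π.1.1 π.1.2) * S₁ π.1)) with hJ₁
  set J₂ : (ℝ × E d) × (ℝ × E d) → ℝ := fun π =>
    θ π.1.1 * γ (π.1.1 - π.2.1) * κ (π.1.2 - π.2.2) * (σ π * (H (ρ₂ π.2.1 π.2.2) * S₂ π.2)) with hJ₂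
  have hweight : ∀ f g : ℝ → ℝ, Continuous f → Continuous g →
      Measurable fun π : (ℝ × E d) × (ℝ × E d) => f π.1.1 * g (π.1.1 - π.2.1) := fun f g hf hg => by
    fun_prop
  have hκπ : Measurable fun π : (ℝ × E d) × (ℝ × E d) => κ (π.1.2 - π.2.2) := by fun_prop
  have hκn : ∀ x, |κ x| = κ x := fun x => abs_of_nonneg (hw.nonneg_space x)
  have hΔint : ∀ f g : ℝ → ℝ, Continuous f → Continuous g → ∀ cf cg : ℝ, 0 ≤ cf → 0 ≤ cg →
      (∀ t, ‖f t‖ ≤ cf) → (∀ t, ‖g t‖ ≤ cg) →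
      Integrable (fun π : (ℝ × E d) × (ℝ × E d) =>
        f π.1.1 * g (π.1.1 - π.2.1) * κ (π.1.2 - π.2.2) * Δ π) ((slab d T).prod (slab d T)) :=
    fun f g hf hg cf cg hf0 hg0 hcf hcg => by
    refine (integrable_of_abs_le_kernel hT (κ := fun x => cf * cg * cH * κ x)
      (hκm.measurable.const_mul _) (hκi.const_mul _) hg₁ hg₂
      (((hweight f g hf hg).mul hκπ).mul hΔm).aestronglyMeasurable fun π => ?_).1
    calc _ = ‖f π.1.1‖ * ‖g (π.1.1 - π.2.1)‖ * |κ (π.1.2 - π.2.2)| * |Δ π| := by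
          simp only [Pi.mul_apply, abs_mul, Real.norm_eq_abs]
      _ ≤ cf * cg * |κ (π.1.2 - π.2.2)| * (cH * (|ρ₁ π.1.1 π.1.2| + |ρ₂ π.2.1 π.2.2|)) := by
          gcongr
          exacts [hcf _, hcg _, hΔb π]
      _ = _ := by rw [hκn]; ring
  have i₁ : Integrable I₁ ((slab d T).prod (slab d T)) :=
    hΔint (deriv θ) γ hθ' hγm cθ' cγ hcθ0' hcγ0 hcθ' hcγ
  have i₂ : Integrable I₂ ((slab d T).prod (slab d T)) :=
    hΔint θ (deriv γ) hθm hγ' cθ cγ' hcθ0 hcγ0' hcθ hcγ'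
  have i₃ : Integrable I₃ ((slab d T).prod (slab d T)) := by
    have hm : Measurable fun π : (ℝ × E d) × (ℝ × E d) => fderiv ℝ κ (π.1.2 - π.2.2) (Ψ π) := by
      have hc : Continuous fun q : (E d →L[ℝ] ℝ) × E d => q.1 q.2 := by fun_prop
      have hk : Measurable fun π : (ℝ × E d) × (ℝ × E d) => fderiv ℝ κ (π.1.2 - π.2.2) :=
        hκ'.measurable.comp ((measurable_snd.comp measurable_fst).sub
          (measurable_snd.comp measurable_snd))
      exact hc.measurable.comp (hk.prodMk hΨm)
    refine (integrable_of_abs_le_kernel hT (κ := fun x => cθ * cγ * cΨ * ‖fderiv ℝ κ x‖)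
      (hκ'.norm.measurable.const_mul _) (hκi'.const_mul _) hg₁ hg₂
      ((hweight θ γ hθm hγm).mul hm).aestronglyMeasurable fun π => ?_).1
    calc _ = ‖θ π.1.1‖ * ‖γ (π.1.1 - π.2.1)‖ * ‖fderiv ℝ κ (π.1.2 - π.2.2) (Ψ π)‖ := by
          simp only [Pi.mul_apply, abs_mul, Real.norm_eq_abs]
      _ ≤ cθ * cγ * (‖fderiv ℝ κ (π.1.2 - π.2.2)‖ *
            (cΨ * (|ρ₁ π.1.1 π.1.2| + |ρ₂ π.2.1 π.2.2|))) := by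
          gcongr
          exacts [hcθ _, hcγ _, ((fderiv ℝ κ _).le_opNorm _).trans
            (mul_le_mul_of_nonneg_left (hΨb π) (norm_nonneg _))]
      _ = _ := by ring
  have hJint : ∀ (r : (ℝ × E d) × (ℝ × E d) → ℝ) (X : (ℝ × E d) × (ℝ × E d) → ℝ), Measurable r →
      AEStronglyMeasurable X ((slab d T).prod (slab d T)) →
      (∀ π, |X π| ≤ |S₁ π.1| + |S₂ π.2|) → Integrable (fun π => θ π.1.1 * γ (π.1.1 - π.2.1) *
        κ (π.1.2 - π.2.2) * (σ π * (H (r π) * X π))) ((slab d T).prod (slab d T)) :=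
    fun r X hr hX hXb => by
    refine (integrable_of_abs_le_kernel hT (κ := fun x => cθ * cγ * cH * κ x)
      (hκm.measurable.const_mul _) (hκi.const_mul _) hS₁.abs hS₂.abs
      ((((hweight θ γ hθm hγm).mul hκπ).aestronglyMeasurable).mul (hσm.aestronglyMeasurable.mul
        ((hH.continuous.measurable.comp hr).aestronglyMeasurable.mul hX))) fun π => ?_).1
    calc _ = ‖θ π.1.1‖ * ‖γ (π.1.1 - π.2.1)‖ * |κ (π.1.2 - π.2.2)| *
            (|σ π| * (‖H (r π)‖ * |X π|)) := by
          simp only [Pi.mul_apply, abs_mul, Real.norm_eq_abs, Function.comp_apply]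
      _ ≤ cθ * cγ * |κ (π.1.2 - π.2.2)| * (1 * (cH * (|S₁ π.1| + |S₂ π.2|))) := by
          gcongr
          exacts [hcθ _, hcγ _, hσb π, hcH _, hXb π]
      _ = _ := by rw [hκn]; ring
  have j₁ : Integrable J₁ ((slab d T).prod (slab d T)) :=
    hJint _ (fun π => S₁ π.1) hρ₁ hS₁.1.comp_fst fun π => le_add_of_nonneg_right (abs_nonneg _)
  have j₂ : Integrable J₂ ((slab d T).prod (slab d T)) :=
    hJint _ (fun π => S₂ π.2) hρ₂ hS₂.1.comp_snd fun π => le_add_of_nonneg_left (abs_nonneg _)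
  -- On the support of the weight both times lie in [a,b], so inserting the indicator is free. It
  -- turns the source into `localSource`, which is assumed integrable on the whole strip.
  have hind : ∀ t s x y ρ, θ t * γ (t - s) * κ (x - y) * ρ = θ t * γ (t - s) * κ (x - y) *
      ((Icc a b).indicator (fun _ => (1 : ℝ)) t * ρ) ∧
      θ t * γ (t - s) * κ (x - y) * ρ = θ t * γ (t - s) * κ (x - y) *
      ((Icc a b).indicator (fun _ => (1 : ℝ)) s * ρ) := fun t s x y ρ => by
    by_cases h : θ t * γ (t - s) = 0
    · simp [h]
    · obtain ⟨h1, h2⟩ := hw.mem t s h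
      rw [indicator_of_mem h1, indicator_of_mem h2]; simp
  have hwc : ∀ t s, |θ t * γ (t - s)| ≤ c := fun t s => by
    rw [abs_of_nonneg (mul_nonneg (hw.nonneg_time _) (hw.nonneg_diag _))]; exact hc _ _
  have hwm : Measurable (Function.uncurry fun t s => θ t * γ (t - s)) := by
    simp only [Function.uncurry_def]; fun_prop
  have hH' : Continuous (deriv H) := hH.continuous_deriv (by simp)
  have hIoo : Icc a b ⊆ Ioo 0 T := fun t ht => ⟨hw.pos.trans_le ht.1, ht.2.trans_lt hw.lt⟩
  -- the first solution, with the second one frozen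
  have upper : -(c * (T * ∫ x, |κ x|) * ∫ u, |deriv H u.2.2| ∂m₁)
      ≤ ∫ π, I₁ π + I₂ π + I₃ π + J₁ π ∂(slab d T).prod (slab d T) := by
    obtain ⟨iD, hD⟩ := hs₁.tail.stripFinite.integral_defect_le hT hH' hHc.deriv hwm hwc
      hκm.measurable hκi
    have hi : Integrable (fun π => I₁ π + I₂ π + I₃ π + J₁ π) ((slab d T).prod (slab d T)) :=
      ((i₁.add i₂).add i₃).add j₁
    rw [integral_prod_symm _ hi]
    refine (neg_le_neg hD).trans ?_
    rw [← integral_neg]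
    refine integral_mono iD.neg hi.integral_prod_right fun q => ?_
    have hsupp : tsupport (fun t => θ t * γ (t - q.1)) ⊆ Ioo 0 T :=
      (closure_minimal (fun t ht => (hw.mem t q.1 ht).1) isClosed_Icc).trans hIoo
    refine (hs₁.inequality_upper (θ := fun t => θ t * γ (t - q.1)) (ψ := fun x => κ (x - q.2))
      (hθ.mul (hγ.comp (contDiff_id.sub contDiff_const))) hw.compact_time.mul_right hsupp
      (fun t => mul_nonneg (hw.nonneg_time _) (hw.nonneg_diag _))
      (hκ.comp (contDiff_id.sub contDiff_const))
      (hw.compact_space.comp_homeomorph (Homeomorph.subRight q.2)) (fun x => hw.nonneg_space _)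
      hH hHc hH0 (ρ₂ q.1 q.2)).trans_eq ?_
    refine integral_congr_ae (Eventually.of_forall fun p => ?_)
    have e1 : deriv (fun t => θ t * γ (t - q.1)) p.1
        = deriv θ p.1 * γ (p.1 - q.1) + θ p.1 * deriv γ (p.1 - q.1) := by
      have h1 := (hθd p.1).hasDerivAt.mul ((hγd (p.1 - q.1)).hasDerivAt.comp_sub_const p.1 q.1)
      exact h1.deriv
    have e2 : fderiv ℝ (fun x => κ (x - q.2)) p.2 = fderiv ℝ κ (p.2 - q.2) := fderiv_comp_sub q.2
    simp only [comparisonIntegrand, truncatedSource, e1, e2, hI₁, hI₂, hI₃, hJ₁, hΔ, hΨ, hS, hσ,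
      hS₁', localSource]
    rw [(hind p.1 q.1 p.2 q.2 (upperStep (ρ₂ q.1 q.2) (ρ₁ p.1 p.2) * (H (ρ₁ p.1 p.2) *
      (A (ρ₁ p.1 p.2) - fracLap α (fun y => B (ρ₁ p.1 y)) p.2)))).1]
    ring
  -- Now the derivatives act on s and y, so those of γ(t-s) and κ(x-y) appear with the opposite
  -- sign, and θ(t) is not differentiated. Adding the two inequalities removes I₂ and I₃.
  have lower : -(c * (T * ∫ x, |κ x|) * ∫ u, |deriv H u.2.2| ∂m₂)
      ≤ ∫ π, -I₂ π - I₃ π - J₂ π ∂(slab d T).prod (slab d T) := by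
    obtain ⟨iD, hD⟩ := hs₂.tail.stripFinite.integral_defect_le hT hH' hHc.deriv
      (w := fun s t => θ t * γ (t - s)) (c := c) (κ := fun x => κ (-x))
      (by simp only [Function.uncurry_def]; fun_prop) (fun s t => hwc t s)
      (hκm.measurable.comp measurable_neg) hκi.comp_neg
    rw [integral_neg_eq_self (fun x => |κ x|)] at hD
    have hi : Integrable (fun π => -I₂ π - I₃ π - J₂ π) ((slab d T).prod (slab d T)) :=
      (i₂.neg.sub i₃).sub j₂
    rw [integral_prod _ hi]
    refine (neg_le_neg hD).trans ?_
    rw [← integral_neg]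
    refine integral_mono iD.neg hi.integral_prod_left fun p => ?_
    have hcl : tsupport (fun s => θ p.1 * γ (p.1 - s)) ⊆ Icc a b :=
      closure_minimal (fun s hs => (hw.mem p.1 s hs).2) isClosed_Icc
    have hcs : HasCompactSupport (fun s => θ p.1 * γ (p.1 - s)) :=
      HasCompactSupport.of_support_subset_isCompact isCompact_Icc (subset_closure.trans hcl)
    have h := hs₂.inequality_lower (θ := fun s => θ p.1 * γ (p.1 - s)) (ψ := fun y => κ (p.2 - y))
      (contDiff_const.mul (hγ.comp (contDiff_const.sub contDiff_id))) hcs (hcl.trans hIoo)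
      (fun t => mul_nonneg (hw.nonneg_time _) (hw.nonneg_diag _))
      (hκ.comp (contDiff_const.sub contDiff_id))
      (hw.compact_space.comp_homeomorph (Homeomorph.subLeft p.2)) (fun x => hw.nonneg_space _)
      hH hHc hH0 (ρ₁ p.1 p.2)
    simp only [neg_sub]
    refine h.trans_eq ?_
    refine integral_congr_ae (Eventually.of_forall fun q => ?_)
    have e1 : deriv (fun s => θ p.1 * γ (p.1 - s)) q.1 = -(θ p.1 * deriv γ (p.1 - q.1)) := by
      have h1 := ((hγd (p.1 - q.1)).hasDerivAt.comp_const_sub p.1 q.1).const_mul (θ p.1)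
      rw [h1.deriv]; ring
    have e2 : ∀ v, fderiv ℝ (fun y => κ (p.2 - y)) q.2 v = -fderiv ℝ κ (p.2 - q.2) v := fun v => by
      have h1 : HasFDerivAt (fun y => κ (p.2 - y))
          ((fderiv ℝ κ (p.2 - q.2)).comp (-ContinuousLinearMap.id ℝ (E d))) q.2 :=
        (hκd (p.2 - q.2)).hasFDerivAt.comp q.2 ((hasFDerivAt_id q.2).const_sub p.2)
      rw [h1.fderiv]; simp
    simp only [comparisonIntegrand, truncatedSource, e1, e2, hI₂, hI₃, hJ₂, hΔ, hΨ, hS, hσ,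
      hS₂', localSource, lowerStep_eq, max_comm (ρ₂ q.1 q.2)]
    rw [(hind p.1 q.1 p.2 q.2 (-upperStep (ρ₂ q.1 q.2) (ρ₁ p.1 p.2) * (H (ρ₂ q.1 q.2) *
      (A (ρ₂ q.1 q.2) - fracLap α (fun y => B (ρ₂ q.1 y)) q.2)))).2]
    ring
  rw [mul_add, neg_add]
  refine (add_le_add upper lower).trans_eq ?_
  have iu : Integrable (fun π => I₁ π + I₂ π + I₃ π + J₁ π) ((slab d T).prod (slab d T)) :=
    ((i₁.add i₂).add i₃).add j₁
  have il : Integrable (fun π => -I₂ π - I₃ π - J₂ π) ((slab d T).prod (slab d T)) :=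
    (i₂.neg.sub i₃).sub j₂
  rw [← integral_add iu il]
  refine integral_congr_ae (Eventually.of_forall fun π => ?_)
  simp only [hI₁, hI₂, hI₃, hJ₁, hJ₂, hΔ]
  ring

end Doubling

/-! ### Removing the velocity truncation; source and diffusion terms. -/

section ComparisonInequality

variable {d : ℕ} {T : ℝ} {F : ℝ → E d} {A B : ℝ → ℝ} {K : ℝ≥0} {α M₁ C₁ M₂ C₂ a b : ℝ}
  {ρ₀₁ ρ₀₂ : E d → ℝ} {ρ₁ ρ₂ : ℝ → E d → ℝ} {m₁ m₂ : Measure (ℝ × E d × ℝ)} {θ γ : ℝ → ℝ}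
  {κ : E d → ℝ}

lemma max_sub_right (r s : ℝ) : max r s - s = max (r - s) 0 := by
  rw [← max_sub_sub_right, sub_self]

set_option maxHeartbeats 400000 in
/-- The doubled inequality after removal of the truncation in velocity. -/
theorem doubling_source (hs₁ : EntropySolution α T F A B K M₁ C₁ ρ₀₁ ρ₁ m₁)
    (hs₂ : EntropySolution α T F A B K M₂ C₂ ρ₀₂ ρ₂ m₂) (hw : DoublingWeights T a b θ γ κ)
    (hS₁ : Integrable (localSource α A B a b ρ₁) (slab d T))
    (hS₂ : Integrable (localSource α A B a b ρ₂) (slab d T)) :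
    0 ≤ ∫ π, (deriv θ π.1.1 * γ (π.1.1 - π.2.1) * κ (π.1.2 - π.2.2)
          * max (ρ₁ π.1.1 π.1.2 - ρ₂ π.2.1 π.2.2) 0
        + θ π.1.1 * γ (π.1.1 - π.2.1) * κ (π.1.2 - π.2.2)
          * (upperStep (ρ₂ π.2.1 π.2.2) (ρ₁ π.1.1 π.1.2)
            * (localSource α A B a b ρ₁ π.1 - localSource α A B a b ρ₂ π.2)))
      ∂(slab d T).prod (slab d T) := by
  have hT := hs₁.time_pos
  have hθm := hw.smooth_time.continuous
  have hγm := hw.smooth_diag.continuous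
  have hκm := hw.smooth_space.continuous
  have hθ' : Continuous (deriv θ) := hw.smooth_time.continuous_deriv (by simp)
  have hκi : Integrable κ := hκm.integrable_of_hasCompactSupport hw.compact_space
  obtain ⟨cθ, hcθ⟩ := hw.compact_time.exists_bound_of_continuous hθm
  obtain ⟨cθ', hcθ'⟩ := hw.compact_time.deriv.exists_bound_of_continuous hθ'
  obtain ⟨cγ, hcγ⟩ := hw.compact_diag.exists_bound_of_continuous hγm
  have hcθ0 := (norm_nonneg _).trans (hcθ 0)
  have hcθ0' := (norm_nonneg _).trans (hcθ' 0)
  have hcγ0 := (norm_nonneg _).trans (hcγ 0)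
  have hκn : ∀ x, |κ x| = κ x := fun x => abs_of_nonneg (hw.nonneg_space x)
  have hρ₁ : Measurable fun π : (ℝ × E d) × (ℝ × E d) => ρ₁ π.1.1 π.1.2 :=
    hs₁.bounded.measurable.comp measurable_fst
  have hρ₂ : Measurable fun π : (ℝ × E d) × (ℝ × E d) => ρ₂ π.2.1 π.2.2 :=
    hs₂.bounded.measurable.comp measurable_snd
  have hc : ∀ t r, θ t * γ r ≤ cθ * cγ := fun t r => (le_abs_self _).trans (by
    rw [abs_mul]; exact mul_le_mul (hcθ t) (hcγ r) (abs_nonneg _) hcθ0)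
  set S₁ := localSource α A B a b ρ₁
  set S₂ := localSource α A B a b ρ₂
  set σ : (ℝ × E d) × (ℝ × E d) → ℝ := fun π =>
    upperStep (ρ₂ π.2.1 π.2.2) (ρ₁ π.1.1 π.1.2) with hσ
  have hσm : Measurable σ := measurable_upperStep_uncurry.comp (hρ₂.prodMk hρ₁)
  have hσb : ∀ π, |σ π| ≤ 1 := fun π => abs_upperStep_le_one _ _
  have hm1 : Measurable fun π : (ℝ × E d) × (ℝ × E d) =>
      deriv θ π.1.1 * γ (π.1.1 - π.2.1) * κ (π.1.2 - π.2.2) := by fun_prop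
  have hm2 : Measurable fun π : (ℝ × E d) × (ℝ × E d) =>
      θ π.1.1 * γ (π.1.1 - π.2.1) * κ (π.1.2 - π.2.2) := by fun_prop
  set f : ℕ → (ℝ × E d) × (ℝ × E d) → ℝ := fun n π =>
    deriv θ π.1.1 * γ (π.1.1 - π.2.1) * κ (π.1.2 - π.2.2)
          * ((∫ v in (0 : ℝ)..max (ρ₁ π.1.1 π.1.2) (ρ₂ π.2.1 π.2.2), cutoff ((n : ℝ) + 1) v)
            - ∫ v in (0 : ℝ)..ρ₂ π.2.1 π.2.2, cutoff ((n : ℝ) + 1) v)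
        + θ π.1.1 * γ (π.1.1 - π.2.1) * κ (π.1.2 - π.2.2)
          * (σ π * (cutoff ((n : ℝ) + 1) (ρ₁ π.1.1 π.1.2) * S₁ π.1
              - cutoff ((n : ℝ) + 1) (ρ₂ π.2.1 π.2.2) * S₂ π.2)) with hf
  have hfm : ∀ n, AEStronglyMeasurable (f n) ((slab d T).prod (slab d T)) := fun n => by
    have hSm : Measurable fun r => ∫ v in (0 : ℝ)..r, cutoff ((n : ℝ) + 1) v :=
      (intervalIntegral.continuous_primitive
        (fun a b => (contDiff_cutoff _).continuous.intervalIntegrable a b) 0).measurable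
    have hcm : Measurable (cutoff ((n : ℝ) + 1)) := (contDiff_cutoff _).continuous.measurable
    exact (hm1.mul ((hSm.comp (hρ₁.max hρ₂)).sub (hSm.comp hρ₂))).aestronglyMeasurable.add
      (hm2.aestronglyMeasurable.mul (hσm.aestronglyMeasurable.mul
        (((hcm.comp hρ₁).aestronglyMeasurable.mul hS₁.1.comp_fst).sub
          ((hcm.comp hρ₂).aestronglyMeasurable.mul hS₂.1.comp_snd))))
  set G₁ : ℝ × E d → ℝ := fun p => cθ' * cγ * |ρ₁ p.1 p.2| + cθ * cγ * |S₁ p| with hG₁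
  set G₂ : ℝ × E d → ℝ := fun p => cθ' * cγ * |ρ₂ p.1 p.2| + cθ * cγ * |S₂ p| with hG₂
  have hG₁i : Integrable G₁ (slab d T) :=
    (hs₁.bounded.integrable.abs.const_mul _).add (hS₁.abs.const_mul _)
  have hG₂i : Integrable G₂ (slab d T) :=
    (hs₂.bounded.integrable.abs.const_mul _).add (hS₂.abs.const_mul _)
  have hfb : ∀ n π, |f n π| ≤ κ (π.1.2 - π.2.2) * (G₁ π.1 + G₂ π.2) := fun n π => by
    have h1 : |(∫ v in (0 : ℝ)..max (ρ₁ π.1.1 π.1.2) (ρ₂ π.2.1 π.2.2), cutoff ((n : ℝ) + 1) v)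
            - ∫ v in (0 : ℝ)..ρ₂ π.2.1 π.2.2, cutoff ((n : ℝ) + 1) v|
        ≤ |ρ₁ π.1.1 π.1.2| + |ρ₂ π.2.1 π.2.2| := by
      refine (abs_intervalIntegral_sub_le (contDiff_cutoff _).continuous.locallyIntegrable
        (abs_cutoff_le_one _) _ _).trans ?_
      rw [one_mul, max_sub_right, abs_of_nonneg (le_max_right _ _)]
      exact max_le ((le_abs_self _).trans (abs_sub _ _)) (by positivity)
    have h2 : |cutoff ((n : ℝ) + 1) (ρ₁ π.1.1 π.1.2) * S₁ π.1
        - cutoff ((n : ℝ) + 1) (ρ₂ π.2.1 π.2.2) * S₂ π.2| ≤ |S₁ π.1| + |S₂ π.2| := by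
      refine (abs_sub _ _).trans (add_le_add ?_ ?_) <;> rw [abs_mul] <;>
        exact mul_le_of_le_one_left (abs_nonneg _) (abs_cutoff_le_one _ _)
    refine (abs_add_le _ _).trans ?_
    calc _ ≤ cθ' * cγ * κ (π.1.2 - π.2.2) * (|ρ₁ π.1.1 π.1.2| + |ρ₂ π.2.1 π.2.2|)
          + cθ * cγ * κ (π.1.2 - π.2.2) * (1 * (|S₁ π.1| + |S₂ π.2|)) := by
          simp only [abs_mul, hκn]
          have := hw.nonneg_space (π.1.2 - π.2.2)
          gcongr
          exacts [hcθ' _, hcγ _, hcθ _, hcγ _, hσb π]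
      _ = _ := by simp only [hG₁, hG₂]; ring
  have hbound := (integrable_of_abs_le_kernel hT hκm.measurable hκi hG₁i hG₂i (hfm 0) (hfb 0))
  have hdom : Integrable (fun π : (ℝ × E d) × (ℝ × E d) => κ (π.1.2 - π.2.2) * (G₁ π.1 + G₂ π.2))
      ((slab d T).prod (slab d T)) := by
    refine (integrable_of_abs_le_kernel hT hκm.measurable hκi hG₁i hG₂i ?_ fun π => ?_).1
    · have : Measurable fun π : (ℝ × E d) × (ℝ × E d) => κ (π.1.2 - π.2.2) := by fun_prop
      exact this.aestronglyMeasurable.mul (hG₁i.1.comp_fst.add hG₂i.1.comp_snd)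
    · rw [abs_of_nonneg]
      have := hw.nonneg_space (π.1.2 - π.2.2)
      simp only [hG₁, hG₂]; positivity
  have hprim : ∀ r, Tendsto (fun n : ℕ => ∫ v in (0 : ℝ)..r, cutoff ((n : ℝ) + 1) v) atTop
      (𝓝 r) := fun r => by
    have h1 : ∫ _ in (0 : ℝ)..r, (1 : ℝ) = r := by simp
    nth_rewrite 2 [← h1]
    exact intervalIntegral.tendsto_integral_filter_of_dominated_convergence (fun _ => 1)
      (Eventually.of_forall fun n => (contDiff_cutoff _).continuous.aestronglyMeasurable)
      (Eventually.of_forall fun n => Eventually.of_forall fun v _ => abs_cutoff_le_one _ v)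
      intervalIntegrable_const (Eventually.of_forall fun v _ => tendsto_cutoff v)
  have hlim := tendsto_integral_of_dominated_convergence _ hfm hdom
    (fun n => Eventually.of_forall (hfb n)) (Eventually.of_forall fun π =>
      (((hprim (max (ρ₁ π.1.1 π.1.2) (ρ₂ π.2.1 π.2.2))).sub (hprim (ρ₂ π.2.1 π.2.2))).const_mul
        (deriv θ π.1.1 * γ (π.1.1 - π.2.1) * κ (π.1.2 - π.2.2))).add
      (((((tendsto_cutoff (ρ₁ π.1.1 π.1.2)).mul_const (S₁ π.1)).sub
        ((tendsto_cutoff (ρ₂ π.2.1 π.2.2)).mul_const (S₂ π.2))).const_mul (σ π)).const_mul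
          (θ π.1.1 * γ (π.1.1 - π.2.1) * κ (π.1.2 - π.2.2))))
  -- The whole truncation error is a fixed constant times the masses of |H'| under m₁ and m₂, both
  -- tending to 0.
  have hdef := ((hs₁.tail.tendsto_cutoff.add hs₂.tail.tendsto_cutoff).const_mul
    (cθ * cγ * (T * ∫ x, |κ x|))).neg
  rw [add_zero, mul_zero, neg_zero] at hdef
  have h := le_of_tendsto_of_tendsto hdef hlim (Eventually.of_forall fun n =>
    doubling_truncated hs₁ hs₂ hw hS₁ hS₂ hc (contDiff_cutoff ((n : ℝ) + 1))
      (hasCompactSupport_cutoff (by positivity)) (cutoff_nonneg _))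
  refine h.trans_eq (integral_congr_ae (Eventually.of_forall fun π => ?_))
  simp only [one_mul, max_sub_right]
  rfl

/-- The doubled comparison inequality. -/
theorem doubling_inequality (hs₁ : EntropySolution α T F A B K M₁ C₁ ρ₀₁ ρ₁ m₁)
    (hs₂ : EntropySolution α T F A B K M₂ C₂ ρ₀₂ ρ₂ m₂) (hw : DoublingWeights T a b θ γ κ)
    {g Λ : ℝ} (hA : SourceBounds A g Λ)
    (hA₁ : Integrable (fun p => (Icc a b).indicator (fun _ => 1) p.1 * A (ρ₁ p.1 p.2)) (slab d T))
    (hA₂ : Integrable (fun p => (Icc a b).indicator (fun _ => 1) p.1 * A (ρ₂ p.1 p.2)) (slab d T)) :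
    0 ≤ ∫ π, (deriv θ π.1.1 + Λ * θ π.1.1) * γ (π.1.1 - π.2.1) * κ (π.1.2 - π.2.2)
          * max (ρ₁ π.1.1 π.1.2 - ρ₂ π.2.1 π.2.2) 0 ∂(slab d T).prod (slab d T) := by
  have hT := hs₁.time_pos
  have hθm := hw.smooth_time.continuous
  have hγm := hw.smooth_diag.continuous
  have hκm := hw.smooth_space.continuous
  have hθ' : Continuous (deriv θ) := hw.smooth_time.continuous_deriv (by simp)
  have hκi : Integrable κ := hκm.integrable_of_hasCompactSupport hw.compact_space
  obtain ⟨cθ, hcθ⟩ := hw.compact_time.exists_bound_of_continuous hθm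
  obtain ⟨cθ', hcθ'⟩ := hw.compact_time.deriv.exists_bound_of_continuous hθ'
  obtain ⟨cγ, hcγ⟩ := hw.compact_diag.exists_bound_of_continuous hγm
  have hcθ0 := (norm_nonneg _).trans (hcθ 0)
  have hcθ0' := (norm_nonneg _).trans (hcθ' 0)
  have hcγ0 := (norm_nonneg _).trans (hcγ 0)
  have hκn : ∀ x, |κ x| = κ x := fun x => abs_of_nonneg (hw.nonneg_space x)
  have hρ₁ : Measurable fun π : (ℝ × E d) × (ℝ × E d) => ρ₁ π.1.1 π.1.2 :=
    hs₁.bounded.measurable.comp measurable_fst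
  have hρ₂ : Measurable fun π : (ℝ × E d) × (ℝ × E d) => ρ₂ π.2.1 π.2.2 :=
    hs₂.bounded.measurable.comp measurable_snd
  set χ : ℝ → ℝ := (Icc a b).indicator (fun _ => 1) with hχ
  have hχm : Measurable χ := measurable_const.indicator measurableSet_Icc
  have hχ1 : ∀ t, |χ t| ≤ 1 := fun t => by
    by_cases h : t ∈ Icc a b <;> simp [hχ, h]
  set L₁ : ℝ × E d → ℝ := fun p => fracLap α (fun y => B (ρ₁ p.1 y)) p.2 with hL₁
  set L₂ : ℝ × E d → ℝ := fun p => fracLap α (fun y => B (ρ₂ p.1 y)) p.2 with hL₂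
  have iL₁ : Integrable L₁ (slab d T) := hs₁.integrable_diffusion
  have iL₂ : Integrable L₂ (slab d T) := hs₂.integrable_diffusion
  have iS : ∀ (ρ : ℝ → E d → ℝ), Integrable (fun p => χ p.1 * A (ρ p.1 p.2)) (slab d T) →
      Integrable (fun p => fracLap α (fun y => B (ρ p.1 y)) p.2) (slab d T) →
      Integrable (localSource α A B a b ρ) (slab d T) := fun ρ h1 h2 => by
    have h3 := h2.bdd_mul (c := 1) (hχm.comp measurable_fst).aestronglyMeasurable
      (Eventually.of_forall fun p : ℝ × E d => hχ1 p.1)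
    refine (h1.sub h3).congr (Eventually.of_forall fun p => ?_)
    simp only [localSource, Pi.sub_apply, Function.comp_apply, ← hχ]
    ring
  have iS₁ := iS ρ₁ hA₁ iL₁
  have iS₂ := iS ρ₂ hA₂ iL₂
  have key := doubling_source hs₁ hs₂ hw iS₁ iS₂
  set σ : (ℝ × E d) × (ℝ × E d) → ℝ := fun π =>
    upperStep (ρ₂ π.2.1 π.2.2) (ρ₁ π.1.1 π.1.2) with hσ
  have hσm : Measurable σ := measurable_upperStep_uncurry.comp (hρ₂.prodMk hρ₁)
  have hσb : ∀ π, |σ π| ≤ 1 := fun π => abs_upperStep_le_one _ _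
  set W : (ℝ × E d) × (ℝ × E d) → ℝ := fun π =>
    θ π.1.1 * γ (π.1.1 - π.2.1) * κ (π.1.2 - π.2.2) with hW
  have hWm : Measurable W := by fun_prop
  have hW0 : ∀ π, 0 ≤ W π := fun π => mul_nonneg (mul_nonneg (hw.nonneg_time _)
    (hw.nonneg_diag _)) (hw.nonneg_space _)
  have hWb : ∀ π, W π ≤ cθ * cγ * κ (π.1.2 - π.2.2) := fun π =>
    mul_le_mul_of_nonneg_right ((le_abs_self _).trans (by
      rw [abs_mul]; exact mul_le_mul (hcθ _) (hcγ _) (abs_nonneg _) hcθ0)) (hw.nonneg_space _)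
  set P : (ℝ × E d) × (ℝ × E d) → ℝ := fun π => max (ρ₁ π.1.1 π.1.2 - ρ₂ π.2.1 π.2.2) 0 with hP
  have hPm : Measurable P := (hρ₁.sub hρ₂).max measurable_const
  have hPb : ∀ π, |P π| ≤ |ρ₁ π.1.1 π.1.2| + |ρ₂ π.2.1 π.2.2| := fun π => by
    rw [abs_of_nonneg (le_max_right _ _)]
    exact max_le ((le_abs_self _).trans (abs_sub _ _)) (by positivity)
  have iP : Integrable (fun π => W π * P π) ((slab d T).prod (slab d T)) := by
    refine (integrable_of_abs_le_kernel hT (κ := fun x => cθ * cγ * κ x)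
      (hκm.measurable.const_mul _) (hκi.const_mul _) hs₁.bounded.integrable.abs
      hs₂.bounded.integrable.abs (hWm.mul hPm).aestronglyMeasurable fun π => ?_).1
    rw [Pi.mul_apply, abs_mul, abs_of_nonneg (hW0 π)]
    exact mul_le_mul (hWb π) (hPb π) (abs_nonneg _) ((hW0 π).trans (hWb π))
  have iP' : Integrable (fun π : (ℝ × E d) × (ℝ × E d) => deriv θ π.1.1 * γ (π.1.1 - π.2.1) *
      κ (π.1.2 - π.2.2) * P π) ((slab d T).prod (slab d T)) := by
    have hm : Measurable fun π : (ℝ × E d) × (ℝ × E d) => deriv θ π.1.1 * γ (π.1.1 - π.2.1) *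
      κ (π.1.2 - π.2.2) := by fun_prop
    refine (integrable_of_abs_le_kernel hT (κ := fun x => cθ' * cγ * κ x)
      (hκm.measurable.const_mul _) (hκi.const_mul _) hs₁.bounded.integrable.abs
      hs₂.bounded.integrable.abs (hm.mul hPm).aestronglyMeasurable fun π => ?_).1
    simp only [Pi.mul_apply, abs_mul, hκn]
    have := hw.nonneg_space (π.1.2 - π.2.2)
    gcongr
    exacts [hcθ' _, hcγ _, hPb π]
  have iW : ∀ Y₁ Y₂ : ℝ × E d → ℝ, Integrable Y₁ (slab d T) → Integrable Y₂ (slab d T) →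
      Integrable (fun π => W π * (σ π * (Y₁ π.1 - Y₂ π.2))) ((slab d T).prod (slab d T)) :=
    fun Y₁ Y₂ h₁ h₂ => by
    refine (integrable_of_abs_le_kernel hT (κ := fun x => cθ * cγ * κ x)
      (hκm.measurable.const_mul _) (hκi.const_mul _) h₁.abs h₂.abs
      (hWm.aestronglyMeasurable.mul (hσm.aestronglyMeasurable.mul
        (h₁.1.comp_fst.sub h₂.1.comp_snd))) fun π => ?_).1
    calc |W π * (σ π * (Y₁ π.1 - Y₂ π.2))| = W π * (|σ π| * |Y₁ π.1 - Y₂ π.2|) := by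
          rw [abs_mul (W π), abs_mul (σ π), abs_of_nonneg (hW0 π)]
      _ ≤ _ := mul_le_mul (hWb π) ((mul_le_of_le_one_left (abs_nonneg _) (hσb π)).trans
          (abs_sub _ _)) (by positivity) ((hW0 π).trans (hWb π))
  have iN := iW L₁ L₂ iL₁ iL₂
  -- The indicator σ refers to ρ₁ and ρ₂, not to B(ρ₁) and B(ρ₂). Monotonicity of B still gives
  -- σ(B(ρ₁) - B(ρ₂)) = (B(ρ₁) - B(ρ₂))⁺, even where B is constant.
  have hnl : 0 ≤ ∫ π, W π * (σ π * (L₁ π.1 - L₂ π.2)) ∂(slab d T).prod (slab d T) := by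
    refine integral_nonlocal_nonneg
      (hs₁.bounded.comp_lipschitz hs₁.coeff.lipschitz hs₁.coeff.zero)
      (hs₂.bounded.comp_lipschitz hs₂.coeff.lipschitz hs₂.coeff.zero) hs₁.dim_pos hT hs₁.order
      (w := fun t s => θ t * γ (t - s)) (by simp only [Function.uncurry_def]; fun_prop)
      (fun t s => mul_nonneg (hw.nonneg_time _) (hw.nonneg_diag _)) (c := cθ * cγ)
      (fun t s => (le_abs_self _).trans (by
        rw [abs_mul]; exact mul_le_mul (hcθ _) (hcγ _) (abs_nonneg _) hcθ0))
      hκm.measurable hκi hw.nonneg_space hσm (fun π => upperStep_nonneg _ _)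
      (fun π => upperStep_le_one _ _) fun π => ?_
    by_cases h : ρ₂ π.2.1 π.2.2 < ρ₁ π.1.1 π.1.2
    · have := hs₁.coeff.monotone h.le
      simp only [hσ, upperStep, indicator_of_mem (show ρ₁ π.1.1 π.1.2 ∈ Ioi _ from h), one_mul]
      rw [max_eq_left (sub_nonneg.2 this)]
    · have := hs₁.coeff.monotone (not_lt.1 h)
      simp only [hσ, upperStep, indicator_of_notMem (show ρ₁ π.1.1 π.1.2 ∉ Ioi _ from h), zero_mul]
      rw [max_eq_right (sub_nonpos.2 this)]
  have hsum := (iP'.add (iP.const_mul Λ)).sub iN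
  have hle := key.trans (integral_mono (iP'.add (iW _ _ iS₁ iS₂)) hsum fun π => by
    simp only [Pi.add_apply, Pi.sub_apply]
    -- Only pairs with ρ₁ > ρ₂ are seen by σ, so the one-sided bound on A suffices.
    have hAσ : σ π * (A (ρ₁ π.1.1 π.1.2) - A (ρ₂ π.2.1 π.2.2)) ≤ Λ * P π := by
      by_cases h : ρ₂ π.2.1 π.2.2 < ρ₁ π.1.1 π.1.2
      · simp only [hσ, hP, upperStep, indicator_of_mem (show ρ₁ π.1.1 π.1.2 ∈ Ioi _ from h),
          one_mul]
        rw [max_eq_left (sub_nonneg.2 h.le)]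
        exact hA.one_sided _ _ h.le
      · simp only [hσ, hP, upperStep, indicator_of_notMem (show ρ₁ π.1.1 π.1.2 ∉ Ioi _ from h),
          zero_mul]
        rw [max_eq_right (sub_nonpos.2 (not_lt.1 h)), mul_zero]
    have hWχ : W π * (σ π * (localSource α A B a b ρ₁ π.1 - localSource α A B a b ρ₂ π.2))
        = W π * (σ π * (A (ρ₁ π.1.1 π.1.2) - A (ρ₂ π.2.1 π.2.2)))
          - W π * (σ π * (L₁ π.1 - L₂ π.2)) := by
      by_cases h : θ π.1.1 * γ (π.1.1 - π.2.1) = 0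
      · simp [hW, h]
      · obtain ⟨h1, h2⟩ := hw.mem _ _ h
        simp only [localSource, indicator_of_mem h1, indicator_of_mem h2, hL₁, hL₂]
        ring
    have := mul_le_mul_of_nonneg_left hAσ (hW0 π)
    have e : W π * (upperStep (ρ₂ π.2.1 π.2.2) (ρ₁ π.1.1 π.1.2) *
        (localSource α A B a b ρ₁ π.1 - localSource α A B a b ρ₂ π.2))
        = W π * (σ π * (localSource α A B a b ρ₁ π.1 - localSource α A B a b ρ₂ π.2)) := rfl
    linarith)
  have e1 : ∫ π, ((fun π : (ℝ × E d) × (ℝ × E d) => deriv θ π.1.1 * γ (π.1.1 - π.2.1) *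
      κ (π.1.2 - π.2.2) * P π) + (fun π => Λ * (W π * P π))) π ∂(slab d T).prod (slab d T)
      = ∫ π, (deriv θ π.1.1 + Λ * θ π.1.1) * γ (π.1.1 - π.2.1) * κ (π.1.2 - π.2.2)
          * P π ∂(slab d T).prod (slab d T) :=
    integral_congr_ae (Eventually.of_forall fun π => by
      simp only [Pi.add_apply, hW]; ring)
  rw [integral_sub' (iP'.add (iP.const_mul Λ)) iN, e1] at hle
  linarith

end ComparisonInequality

/-! ### Collapse onto the diagonal. -/

section Diagonal

variable {d : ℕ} {T M C : ℝ} {ρ : ℝ → E d → ℝ}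

lemma lintegral_abs_eq {g : E d → ℝ} (hg : Integrable g) :
    ∫⁻ x, ENNReal.ofReal |g x| = ENNReal.ofReal (∫ x, |g x|) :=
  (ofReal_integral_eq_lintegral_ofReal hg.abs (Eventually.of_forall fun _ => abs_nonneg _)).symm

/-- At fixed x the variable y occurs only in κ and integrates to 1. Then γ restricts to |t-s| ≤ δ,
where the modulus of continuity applies. Lower integrals avoid integrability conditions when the
order of integration is changed. -/
lemma lintegral_time_difference_le (hρm : Measurable (Function.uncurry ρ)) (hρ : L1Continuous T ρ)
    {δ η : ℝ} (hη : ∀ s ∈ Icc 0 T, ∀ t ∈ Icc 0 T, |s - t| ≤ δ → ∫ x, |ρ s x - ρ t x| ≤ η)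
    {γ : ℝ → ℝ} {κ : E d → ℝ} (hγm : Measurable γ) (hκm : Measurable κ)
    (hγ1 : ∫⁻ r, ENNReal.ofReal (γ r) = 1) (hκ1 : ∫⁻ x, ENNReal.ofReal (κ x) = 1)
    (hγ : ∀ r, δ < |r| → γ r = 0) :
    ∫⁻ π : (ℝ × E d) × (ℝ × E d), ENNReal.ofReal (γ (π.1.1 - π.2.1)) *
      ENNReal.ofReal (κ (π.1.2 - π.2.2)) * ENNReal.ofReal |ρ π.1.1 π.1.2 - ρ π.2.1 π.1.2|
        ∂(slab d T).prod (slab d T) ≤ ENNReal.ofReal T * ENNReal.ofReal η := by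
  have hm1 : Measurable fun π : (ℝ × E d) × (ℝ × E d) => ENNReal.ofReal (γ (π.1.1 - π.2.1)) *
      ENNReal.ofReal (κ (π.1.2 - π.2.2)) * ENNReal.ofReal |ρ π.1.1 π.1.2 - ρ π.2.1 π.1.2| := by
    have h1 : Measurable fun π : (ℝ × E d) × (ℝ × E d) => ρ π.1.1 π.1.2 := hρm.comp measurable_fst
    have h2 : Measurable fun π : (ℝ × E d) × (ℝ × E d) => ρ π.2.1 π.1.2 := hρm.comp
      ((measurable_fst.comp measurable_snd).prodMk (measurable_snd.comp measurable_fst))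
    exact ((hγm.comp (by fun_prop)).ennreal_ofReal.mul (hκm.comp (by fun_prop)).ennreal_ofReal).mul
      (h1.sub h2).abs.ennreal_ofReal
  have hm2 : Measurable fun r : ((ℝ × E d) × ℝ) => ENNReal.ofReal (γ (r.1.1 - r.2)) *
      ENNReal.ofReal |ρ r.1.1 r.1.2 - ρ r.2 r.1.2| := by
    have h1 : Measurable fun r : (ℝ × E d) × ℝ => ρ r.1.1 r.1.2 := hρm.comp measurable_fst
    have h2 : Measurable fun r : (ℝ × E d) × ℝ => ρ r.2 r.1.2 := hρm.comp
      (measurable_snd.prodMk (measurable_snd.comp measurable_fst))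
    exact (hγm.comp (by fun_prop)).ennreal_ofReal.mul (h1.sub h2).abs.ennreal_ofReal
  rw [lintegral_prod _ hm1.aemeasurable]
  have e1 : ∀ p : ℝ × E d, ∫⁻ q, ENNReal.ofReal (γ (p.1 - q.1)) *
      ENNReal.ofReal (κ (p.2 - q.2)) * ENNReal.ofReal |ρ p.1 p.2 - ρ q.1 p.2| ∂slab d T
      = ∫⁻ s in Ioo 0 T, ENNReal.ofReal (γ (p.1 - s)) * ENNReal.ofReal |ρ p.1 p.2 - ρ s p.2| :=
    fun p => by
    have hmp : Measurable fun q : ℝ × E d => ENNReal.ofReal (γ (p.1 - q.1)) *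
        ENNReal.ofReal (κ (p.2 - q.2)) * ENNReal.ofReal |ρ p.1 p.2 - ρ q.1 p.2| :=
      hm1.comp measurable_prodMk_left
    rw [slab, lintegral_prod _ hmp.aemeasurable]
    refine lintegral_congr fun s => ?_
    simp only [mul_right_comm _ (ENNReal.ofReal (κ _))]
    rw [lintegral_const_mul _ (by fun_prop : Measurable fun y => ENNReal.ofReal (κ (p.2 - y))),
      lintegral_sub_left_eq_self (fun y => ENNReal.ofReal (κ y)), hκ1, mul_one]
  simp only [e1]
  rw [slab, lintegral_prod _ hm2.lintegral_prod_right'.aemeasurable]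
  calc _ ≤ ∫⁻ _ in Ioo 0 T, ENNReal.ofReal η := by
        refine setLIntegral_mono measurable_const fun t ht => ?_
        have hmt : Measurable fun r : E d × ℝ => ((t, r.1), r.2) := by fun_prop
        have hsw := lintegral_lintegral_swap (μ := (volume : Measure (E d)))
          (ν := volume.restrict (Ioo 0 T)) (f := fun x s => ENNReal.ofReal (γ (t - s)) *
            ENNReal.ofReal |ρ t x - ρ s x|) (hm2.comp hmt).aemeasurable
        refine hsw.trans_le ?_
        calc _ ≤ ∫⁻ s in Ioo 0 T, ENNReal.ofReal (γ (t - s)) * ENNReal.ofReal η := by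
              refine setLIntegral_mono
                ((hγm.comp (by fun_prop)).ennreal_ofReal.mul_const _) fun s hs => ?_
              have ht' := Ioo_subset_Icc_self ht
              have hs' := Ioo_subset_Icc_self hs
              have hmx : Measurable fun x => ENNReal.ofReal |ρ t x - ρ s x| :=
                ((hρm.comp measurable_prodMk_left).sub
                  (hρm.comp measurable_prodMk_left)).abs.ennreal_ofReal
              rw [lintegral_const_mul _ hmx]
              rcases le_or_gt |t - s| δ with h | h
              · gcongr
                have := lintegral_abs_eq ((hρ.integrable t ht').sub (hρ.integrable s hs'))
                simp only [Pi.sub_apply] at this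
                rw [this]
                exact ENNReal.ofReal_le_ofReal (hη t ht' s hs' h)
              · rw [hγ _ h]; simp
          _ ≤ ∫⁻ s, ENNReal.ofReal (γ (t - s)) * ENNReal.ofReal η := setLIntegral_le_lintegral _ _
          _ = ENNReal.ofReal η := by
              rw [lintegral_mul_const _ (by fun_prop : Measurable fun s => ENNReal.ofReal (γ (t - s))),
                lintegral_sub_left_eq_self (fun y => ENNReal.ofReal (γ y)), hγ1, one_mul]
    _ = ENNReal.ofReal T * ENNReal.ofReal η := by
        rw [setLIntegral_const, Real.volume_Ioo, sub_zero, mul_comm]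

/-- At fixed s the variable t occurs only in γ and contributes mass at most 1. Substituting z = x -
y leaves an average of translation differences with |z| ≤ δ. -/
lemma lintegral_space_difference_le (hρ : TranslationBounded T M C ρ) {δ : ℝ}
    {γ : ℝ → ℝ} {κ : E d → ℝ} (hγm : Measurable γ) (hκm : Measurable κ)
    (hγ1 : ∫⁻ r, ENNReal.ofReal (γ r) = 1) (hκ1 : ∫⁻ x, ENNReal.ofReal (κ x) = 1)
    (hκ : ∀ x, δ < ‖x‖ → κ x = 0) :
    ∫⁻ π : (ℝ × E d) × (ℝ × E d), ENNReal.ofReal (γ (π.1.1 - π.2.1)) *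
      ENNReal.ofReal (κ (π.1.2 - π.2.2)) * ENNReal.ofReal |ρ π.2.1 π.1.2 - ρ π.2.1 π.2.2|
        ∂(slab d T).prod (slab d T) ≤ ENNReal.ofReal T * ENNReal.ofReal (C * δ) := by
  have hρm := hρ.measurable
  have hm1 : Measurable fun π : (ℝ × E d) × (ℝ × E d) => ENNReal.ofReal (γ (π.1.1 - π.2.1)) *
      ENNReal.ofReal (κ (π.1.2 - π.2.2)) * ENNReal.ofReal |ρ π.2.1 π.1.2 - ρ π.2.1 π.2.2| := by
    have h1 : Measurable fun π : (ℝ × E d) × (ℝ × E d) => ρ π.2.1 π.2.2 := hρm.comp measurable_snd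
    have h2 : Measurable fun π : (ℝ × E d) × (ℝ × E d) => ρ π.2.1 π.1.2 := hρm.comp
      ((measurable_fst.comp measurable_snd).prodMk (measurable_snd.comp measurable_fst))
    exact ((hγm.comp (by fun_prop)).ennreal_ofReal.mul (hκm.comp (by fun_prop)).ennreal_ofReal).mul
      (h2.sub h1).abs.ennreal_ofReal
  have hm2 : Measurable fun r : ((ℝ × E d) × E d) => ENNReal.ofReal (κ r.2) *
      ENNReal.ofReal |ρ r.1.1 (r.2 + r.1.2) - ρ r.1.1 r.1.2| :=
    (hκm.comp measurable_snd).ennreal_ofReal.mul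
      (hρ.measurable_translate.sub (hρm.comp measurable_fst)).abs.ennreal_ofReal
  rw [lintegral_prod_symm' _ hm1]
  have e1 : ∀ q : ℝ × E d, ∫⁻ p, ENNReal.ofReal (γ (p.1 - q.1)) *
      ENNReal.ofReal (κ (p.2 - q.2)) * ENNReal.ofReal |ρ q.1 p.2 - ρ q.1 q.2| ∂slab d T
      ≤ ∫⁻ z, ENNReal.ofReal (κ z) * ENNReal.ofReal |ρ q.1 (z + q.2) - ρ q.1 q.2| :=
    fun q => by
    have hmq : Measurable fun x => ENNReal.ofReal (κ (x - q.2)) *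
        ENNReal.ofReal |ρ q.1 x - ρ q.1 q.2| :=
      (hκm.comp (by fun_prop)).ennreal_ofReal.mul
        ((hρm.comp measurable_prodMk_left).sub_const _).abs.ennreal_ofReal
    have e2 : ∫⁻ x, ENNReal.ofReal (κ (x - q.2)) * ENNReal.ofReal |ρ q.1 x - ρ q.1 q.2|
        = ∫⁻ z, ENNReal.ofReal (κ z) * ENNReal.ofReal |ρ q.1 (z + q.2) - ρ q.1 q.2| := by
      rw [← lintegral_add_right_eq_self _ q.2]
      simp only [add_sub_cancel_right]
    simp only [mul_assoc]
    rw [slab, lintegral_prod_mul (f := fun t => ENNReal.ofReal (γ (t - q.1)))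
      (g := fun x => ENNReal.ofReal (κ (x - q.2)) * ENNReal.ofReal |ρ q.1 x - ρ q.1 q.2|)
      (hγm.comp (by fun_prop)).ennreal_ofReal.aemeasurable hmq.aemeasurable, e2]
    refine mul_le_of_le_one_left zero_le ?_
    refine (setLIntegral_le_lintegral _ _).trans_eq ?_
    rw [lintegral_sub_right_eq_self (fun y => ENNReal.ofReal (γ y)), hγ1]
  refine (lintegral_mono e1).trans ?_
  rw [slab, lintegral_prod _ hm2.lintegral_prod_right'.aemeasurable]
  calc _ ≤ ∫⁻ _ in Ioo 0 T, ENNReal.ofReal (C * δ) := by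
        refine lintegral_mono_ae ?_
        filter_upwards [hρ.bound] with s hs
        have hms : Measurable fun r : E d × E d => ((s, r.1), r.2) := by fun_prop
        have hsw := lintegral_lintegral_swap (μ := (volume : Measure (E d)))
          (ν := (volume : Measure (E d))) (f := fun y z => ENNReal.ofReal (κ z) *
            ENNReal.ofReal |ρ s (z + y) - ρ s y|) (hm2.comp hms).aemeasurable
        refine hsw.trans_le ?_
        calc _ ≤ ∫⁻ z, ENNReal.ofReal (κ z) * ENNReal.ofReal (C * δ) := by
              refine lintegral_mono fun z => ?_
              have hmx : Measurable fun y => ENNReal.ofReal |ρ s (z + y) - ρ s y| :=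
                ((hρm.comp (measurable_const.prodMk (measurable_id.const_add z))).sub
                  (hρm.comp measurable_prodMk_left)).abs.ennreal_ofReal
              simp only []
              rw [lintegral_const_mul _ hmx]
              rcases le_or_gt ‖z‖ δ with h | h
              · gcongr
                have := lintegral_abs_eq ((hs.1.comp_add_left z).sub hs.1)
                simp only [Pi.sub_apply] at this
                rw [this]
                exact ENNReal.ofReal_le_ofReal ((hs.2.2 z).trans
                  (mul_le_mul_of_nonneg_left h hρ.nonneg.2))
              · rw [hκ _ h]; simp
          _ = ENNReal.ofReal (C * δ) := by
              rw [lintegral_mul_const _ hκm.ennreal_ofReal, hκ1, one_mul]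
    _ = ENNReal.ofReal T * ENNReal.ofReal (C * δ) := by
        rw [setLIntegral_const, Real.volume_Ioo, sub_zero, mul_comm]

/-- A space-time mollification converges in `L¹` on the diagonal. -/
lemma integral_diagonal_difference_le (hT : 0 < T) (hρ : TranslationBounded T M C ρ)
    (hρc : L1Continuous T ρ) {δ η : ℝ} (hδ : 0 ≤ δ) (hη0 : 0 ≤ η)
    (hη : ∀ s ∈ Icc 0 T, ∀ t ∈ Icc 0 T, |s - t| ≤ δ → ∫ x, |ρ s x - ρ t x| ≤ η)
    {γ : ℝ → ℝ} {κ : E d → ℝ} (hγm : Measurable γ) (hκm : Measurable κ)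
    (hγi : Integrable γ) (hκi : Integrable κ) {c : ℝ} (hγb : ∀ r, γ r ≤ c)
    (hγ0 : ∀ r, 0 ≤ γ r) (hκ0 : ∀ x, 0 ≤ κ x)
    (hγ1 : ∫ r, γ r = 1) (hκ1 : ∫ x, κ x = 1)
    (hγ : ∀ r, δ < |r| → γ r = 0) (hκ : ∀ x, δ < ‖x‖ → κ x = 0) :
    Integrable (fun π : (ℝ × E d) × (ℝ × E d) => γ (π.1.1 - π.2.1) * κ (π.1.2 - π.2.2) *
      |ρ π.1.1 π.1.2 - ρ π.2.1 π.2.2|) ((slab d T).prod (slab d T)) ∧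
    ∫ π : (ℝ × E d) × (ℝ × E d), γ (π.1.1 - π.2.1) * κ (π.1.2 - π.2.2) *
      |ρ π.1.1 π.1.2 - ρ π.2.1 π.2.2| ∂(slab d T).prod (slab d T) ≤ T * (η + C * δ) := by
  have hρm := hρ.measurable
  have hm : Measurable fun π : (ℝ × E d) × (ℝ × E d) => γ (π.1.1 - π.2.1) * κ (π.1.2 - π.2.2) *
      |ρ π.1.1 π.1.2 - ρ π.2.1 π.2.2| :=
    ((hγm.comp (by fun_prop)).mul (hκm.comp (by fun_prop))).mul
      ((hρm.comp measurable_fst).sub (hρm.comp measurable_snd)).abs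
  have hn : ∀ π : (ℝ × E d) × (ℝ × E d), 0 ≤ γ (π.1.1 - π.2.1) * κ (π.1.2 - π.2.2) *
      |ρ π.1.1 π.1.2 - ρ π.2.1 π.2.2| := fun π =>
    mul_nonneg (mul_nonneg (hγ0 _) (hκ0 _)) (abs_nonneg _)
  have hi : Integrable (fun π : (ℝ × E d) × (ℝ × E d) => γ (π.1.1 - π.2.1) *
      κ (π.1.2 - π.2.2) * |ρ π.1.1 π.1.2 - ρ π.2.1 π.2.2|) ((slab d T).prod (slab d T)) := by
    refine (integrable_of_abs_le_kernel hT (κ := fun x => c * κ x) (hκm.const_mul _)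
      (hκi.const_mul _) hρ.integrable.abs hρ.integrable.abs hm.aestronglyMeasurable fun π => ?_).1
    rw [abs_of_nonneg (hn π)]
    exact mul_le_mul (mul_le_mul_of_nonneg_right (hγb _) (hκ0 _)) (abs_sub _ _) (abs_nonneg _)
      (mul_nonneg ((hγ0 0).trans (hγb 0)) (hκ0 _))
  refine ⟨hi, ?_⟩
  have hγ1' : ∫⁻ r, ENNReal.ofReal (γ r) = 1 := by
    rw [← ofReal_integral_eq_lintegral_ofReal hγi (Eventually.of_forall hγ0), hγ1, ENNReal.ofReal_one]
  have hκ1' : ∫⁻ r, ENNReal.ofReal (κ r) = 1 := by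
    rw [← ofReal_integral_eq_lintegral_ofReal hκi (Eventually.of_forall hκ0), hκ1, ENNReal.ofReal_one]
  have hCδ : 0 ≤ C * δ := mul_nonneg hρ.nonneg.2 hδ
  rw [← ENNReal.ofReal_le_ofReal_iff (by positivity),
    ofReal_integral_eq_lintegral_ofReal hi (Eventually.of_forall hn), mul_add,
    ENNReal.ofReal_add (by positivity) (by positivity), ENNReal.ofReal_mul hT.le,
    ENNReal.ofReal_mul hT.le]
  have h1 := lintegral_time_difference_le hρm hρc hη hγm hκm hγ1' hκ1' hγ
  have h2 := lintegral_space_difference_le hρ hγm hκm hγ1' hκ1' hκ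
  -- Triangle inequality through the intermediate value ρ(s,x).
  refine le_trans ?_ (add_le_add h1 h2)
  rw [← lintegral_add_right]
  · refine lintegral_mono fun π => ?_
    rw [ENNReal.ofReal_mul (mul_nonneg (hγ0 _) (hκ0 _)), ENNReal.ofReal_mul (hγ0 _), ← mul_add,
      ← ENNReal.ofReal_add (abs_nonneg _) (abs_nonneg _)]
    gcongr
    exact abs_sub_le _ _ _
  · have h1 : Measurable fun π : (ℝ × E d) × (ℝ × E d) => ρ π.2.1 π.2.2 := hρm.comp measurable_snd
    have h2 : Measurable fun π : (ℝ × E d) × (ℝ × E d) => ρ π.2.1 π.1.2 := hρm.comp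
      ((measurable_fst.comp measurable_snd).prodMk (measurable_snd.comp measurable_fst))
    exact ((hγm.comp (by fun_prop)).ennreal_ofReal.mul (hκm.comp (by fun_prop)).ennreal_ofReal).mul
      (h2.sub h1).abs.ennreal_ofReal

end Diagonal

/-! ### Comparison localised in time, and Gronwall. -/

section Gronwall

variable {d : ℕ} {T : ℝ} {F : ℝ → E d} {A B : ℝ → ℝ} {K : ℝ≥0} {α M₁ C₁ M₂ C₂ g Λ : ℝ}
  {ρ₀₁ ρ₀₂ : E d → ℝ} {ρ₁ ρ₂ : ℝ → E d → ℝ} {m₁ m₂ : Measure (ℝ × E d × ℝ)} {θ : ℝ → ℝ}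

lemma EntropySolution.integrable_source_indicator
    (hs : EntropySolution α T F A B K M₁ C₁ ρ₀₁ ρ₁ m₁) (hA : SourceBounds A g Λ) {a b : ℝ}
    (ha : 0 < a) (hab : a < b) (hb : b < T) :
    Integrable (fun p => (Icc a b).indicator (fun _ => 1) p.1 * A (ρ₁ p.1 p.2)) (slab d T) := by
  have hmin : 0 < min a (T - b) := lt_min ha (sub_pos.2 hb)
  have h1 := min_le_left a (T - b)
  have h2 := min_le_right a (T - b)
  set ζ : ContDiffBump ((a + b) / 2) :=
    -- The bump is 1 on [a,b], and the extra half of min(a, T-b) keeps its support inside (0,T).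
    ⟨(b - a) / 2, (b - a) / 2 + min a (T - b) / 2, by linarith, by linarith⟩ with hζ
  have hζs : ContDiff ℝ ∞ ζ := ζ.contDiff
  have hsupp : tsupport ζ ⊆ Ioo 0 T := by
    rw [ζ.tsupport_eq, Real.closedBall_eq_Icc]
    simp only [hζ]
    exact fun t ht => ⟨by linarith [ht.1], by linarith [ht.2]⟩
  have hi := hs.integrable_source hζs ζ.hasCompactSupport hsupp (fun t => ζ.nonneg) hA.nonneg
    hA.upper hA.lower
  have hm : Measurable fun p : ℝ × E d => (Icc a b).indicator (fun _ => (1 : ℝ)) p.1 :=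
    (measurable_const.indicator measurableSet_Icc).comp measurable_fst
  refine (hi.bdd_mul (c := 1) hm.aestronglyMeasurable (Eventually.of_forall fun p => ?_)).congr
    (Eventually.of_forall fun p => ?_)
  · by_cases h : p.1 ∈ Icc a b <;> simp [h]
  · by_cases h : p.1 ∈ Icc a b
    · have : ζ p.1 = 1 := by
        refine ζ.one_of_mem_closedBall ?_
        rw [Real.closedBall_eq_Icc]
        simp only [hζ]
        exact ⟨by linarith [h.1], by linarith [h.2]⟩
      simp only [this, one_mul]
    · simp [h]

/-- The comparison inequality, localised in time. -/
theorem comparison_weak (hs₁ : EntropySolution α T F A B K M₁ C₁ ρ₀₁ ρ₁ m₁)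
    (hs₂ : EntropySolution α T F A B K M₂ C₂ ρ₀₂ ρ₂ m₂) (hρ₂ : L1Continuous T ρ₂)
    (hA : SourceBounds A g Λ) (hθ : ContDiff ℝ ∞ θ) (hθc : HasCompactSupport θ)
    (hθ0 : ∀ t, 0 ≤ θ t) {a b : ℝ} (ha : 0 < a) (hab : a < b) (hb : b < T)
    (hθs : ∀ t, t ∉ Icc a b → θ t = 0) :
    0 ≤ ∫ t in Ioo 0 T, (deriv θ t + Λ * θ t) * ∫ x, max (ρ₁ t x - ρ₂ t x) 0 := by
  have hT := hs₁.time_pos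
  have hθm := hθ.continuous
  have hθ' : Continuous (deriv θ) := hθ.continuous_deriv (by simp)
  have hρ₁m := hs₁.bounded.measurable
  have hρ₂m := hs₂.bounded.measurable
  set f : ℝ → ℝ := fun t => deriv θ t + Λ * θ t with hf
  have hfm : Continuous f := by fun_prop
  have hfc : HasCompactSupport f := hθc.deriv.add hθc.mul_left
  obtain ⟨cf, hcf⟩ := hfc.exists_bound_of_continuous hfm
  have hcf0 := (norm_nonneg _).trans (hcf 0)
  have hfs : ∀ t, t ∉ Icc a b → f t = 0 := fun t ht => by
    have h1 : deriv θ t = 0 := by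
      have : θ =ᶠ[𝓝 t] fun _ => 0 := by
        filter_upwards [isClosed_Icc.isOpen_compl.mem_nhds ht] with s hs using hθs s hs
      rw [this.deriv_eq, deriv_const]
    simp only [hf, h1, hθs t ht, mul_zero, add_zero]
  set P₀ : ℝ × E d → ℝ := fun p => f p.1 * max (ρ₁ p.1 p.2 - ρ₂ p.1 p.2) 0 with hP₀
  have hP₀m : Measurable P₀ := (hfm.measurable.comp measurable_fst).mul
    ((hρ₁m.sub hρ₂m).max measurable_const)
  have hP₀i : Integrable P₀ (slab d T) := by
    refine ((hs₁.bounded.integrable.abs.add hs₂.bounded.integrable.abs).const_mul cf).mono'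
      hP₀m.aestronglyMeasurable (Eventually.of_forall fun p => ?_)
    rw [norm_mul]
    refine mul_le_mul (hcf _) ?_ (norm_nonneg _) hcf0
    rw [Real.norm_of_nonneg (le_max_right _ _)]
    exact max_le ((le_abs_self _).trans (abs_sub _ _)) (by
      simp only [Pi.add_apply]; positivity)
  have hX : ∫ t in Ioo 0 T, f t * ∫ x, max (ρ₁ t x - ρ₂ t x) 0 = ∫ p, P₀ p ∂slab d T := by
    rw [slab, integral_prod _ hP₀i]
    simp only [hP₀, integral_const_mul]
  rw [hX]
  refine le_of_forall_pos_le_add fun ε hε => ?_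
  -- choice of the scale of regularisation
  set η : ℝ := ε / (2 * (cf * T + 1)) with hη
  have hη0 : 0 < η := by positivity
  obtain ⟨δ₀, hδ₀, hmod⟩ := hρ₂.modulus η hη0
  have hC0 := hs₂.bounded.nonneg.2
  obtain ⟨δ, hδ0, hδa, hδb, hδδ, hδC⟩ : ∃ δ : ℝ, 0 < δ ∧ δ < a / 2 ∧ δ < (T - b) / 2 ∧ δ < δ₀ ∧
      C₂ * δ ≤ η := by
    have h4 : 0 < η / (C₂ + 1) := by positivity
    set μ := min (min (a / 2) ((T - b) / 2)) (min δ₀ (η / (C₂ + 1))) with hμ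
    have hμ0 : 0 < μ := lt_min (lt_min (by positivity) (by linarith)) (lt_min hδ₀ h4)
    have m1 : μ ≤ a / 2 := (min_le_left _ _).trans (min_le_left _ _)
    have m2 : μ ≤ (T - b) / 2 := (min_le_left _ _).trans (min_le_right _ _)
    have m3 : μ ≤ δ₀ := (min_le_right _ _).trans (min_le_left _ _)
    have m4 : μ ≤ η / (C₂ + 1) := (min_le_right _ _).trans (min_le_right _ _)
    refine ⟨μ / 2, by positivity, by linarith, by linarith, by linarith, ?_⟩
    rw [le_div_iff₀ (by positivity)] at m4
    nlinarith
  set γb : ContDiffBump (0 : ℝ) := ⟨δ / 2, δ, by positivity, by linarith⟩ with hγb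
  set κb : ContDiffBump (0 : E d) := ⟨δ / 2, δ, by positivity, by linarith⟩ with hκb
  set γ : ℝ → ℝ := γb.normed volume with hγ
  set κ : E d → ℝ := κb.normed volume with hκ
  have hγs : ContDiff ℝ ∞ γ := γb.contDiff_normed
  have hκs : ContDiff ℝ ∞ κ := κb.contDiff_normed
  have hγc : HasCompactSupport γ := γb.hasCompactSupport_normed
  have hκc : HasCompactSupport κ := κb.hasCompactSupport_normed
  have hγ0 : ∀ r, 0 ≤ γ r := γb.nonneg_normed
  have hκ0 : ∀ x, 0 ≤ κ x := κb.nonneg_normed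
  have hγ1 : ∫ r, γ r = 1 := γb.integral_normed
  have hκ1 : ∫ x, κ x = 1 := κb.integral_normed
  have hγδ : ∀ r, δ < |r| → γ r = 0 := fun r hr => by
    by_contra h
    have : r ∈ Function.support γ := h
    rw [hγ, γb.support_normed_eq, mem_ball_zero_iff] at this
    exact absurd (this.trans hr) (lt_irrefl _)
  have hκδ : ∀ x, δ < ‖x‖ → κ x = 0 := fun x hx => by
    by_contra h
    have : x ∈ Function.support κ := h
    rw [hκ, κb.support_normed_eq, mem_ball_zero_iff] at this
    exact absurd (this.trans hx) (lt_irrefl _)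
  have hγi : Integrable γ := hγs.continuous.integrable_of_hasCompactSupport hγc
  have hκi : Integrable κ := hκs.continuous.integrable_of_hasCompactSupport hκc
  have hγm := hγs.continuous
  have hκm := hκs.continuous
  obtain ⟨cγ, hcγ⟩ := hγc.exists_bound_of_continuous hγm
  have hcγ0 := (norm_nonneg _).trans (hcγ 0)
  have hmemt : ∀ t, θ t ≠ 0 → t ∈ Icc a b := fun t ht => by
    by_contra h
    exact ht (hθs t h)
  -- The interval is enlarged because s may differ from t ∈ [a,b] by up to δ, and δ is smaller than
  -- a/2 and (T-b)/2.
  have hw : DoublingWeights T (a / 2) ((b + T) / 2) θ γ κ :=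
    { pos := by positivity
      lt := by linarith
      smooth_time := hθ
      compact_time := hθc
      nonneg_time := hθ0
      smooth_diag := hγs
      compact_diag := hγc
      nonneg_diag := hγ0
      smooth_space := hκs
      compact_space := hκc
      nonneg_space := hκ0
      mem := fun t s hts => by
        have h1 := hmemt t (left_ne_zero_of_mul hts)
        have h2 : |t - s| ≤ δ := by
          by_contra! h
          exact (right_ne_zero_of_mul hts) (hγδ _ h)
        rw [abs_le] at h2
        refine ⟨⟨?_, ?_⟩, ?_, ?_⟩ <;> linarith [h1.1, h1.2, h2.1, h2.2] }
  have key := doubling_inequality hs₁ hs₂ hw hA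
    (hs₁.integrable_source_indicator hA hw.pos (by linarith) hw.lt)
    (hs₂.integrable_source_indicator hA hw.pos (by linarith) hw.lt)
  obtain ⟨iD, hD⟩ := integral_diagonal_difference_le hT hs₂.bounded hρ₂ hδ0.le hη0.le
    (fun s hs t ht hst => hmod s hs t ht (hst.trans_lt hδδ)) hγm.measurable hκm.measurable hγi hκi
    (fun r => (le_abs_self _).trans (hcγ r)) hγ0 hκ0 hγ1 hκ1 hγδ hκδ
  -- J has ρ₂(s,y) replaced by ρ₂(t,x). Only the regularity of ρ₂ is spent on this, since ρ₁ already
  -- sits at (t,x), and the second point then integrates out.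
  set J : (ℝ × E d) × (ℝ × E d) → ℝ := fun π =>
    γ (π.1.1 - π.2.1) * κ (π.1.2 - π.2.2) * P₀ π.1 with hJ
  have hwm : Measurable fun π : (ℝ × E d) × (ℝ × E d) =>
    γ (π.1.1 - π.2.1) * κ (π.1.2 - π.2.2) := by fun_prop
  have hJi : Integrable J ((slab d T).prod (slab d T)) := by
    refine (integrable_of_abs_le_kernel hT (κ := fun x => cγ * κ x)
      (hκm.measurable.const_mul _) (hκi.const_mul _) hP₀i.abs hP₀i.abs
      (hwm.mul (hP₀m.comp measurable_fst)).aestronglyMeasurable fun π => ?_).1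
    calc _ = ‖γ (π.1.1 - π.2.1)‖ * |κ (π.1.2 - π.2.2)| * |P₀ π.1| := by
          simp only [Pi.mul_apply, abs_mul, Real.norm_eq_abs, Function.comp_apply]
      _ ≤ cγ * |κ (π.1.2 - π.2.2)| * (|P₀ π.1| + |P₀ π.2|) := by
          gcongr
          exacts [hcγ _, le_add_of_nonneg_right (abs_nonneg _)]
      _ = _ := by rw [abs_of_nonneg (hκ0 _)]
  have hJ0 : ∫ π, J π ∂(slab d T).prod (slab d T) = ∫ p, P₀ p ∂slab d T := by
    rw [integral_prod _ hJi]
    refine integral_congr_ae (Eventually.of_forall fun p => ?_)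
    simp only [hJ, integral_mul_const]
    by_cases hp : p.1 ∈ Icc a b
    -- For t ∈ [a,b] the support of γ(t - ·) lies inside (0,T), so no mass is lost at the ends and
    -- the integral is exactly 1.
    · have h1 : ∫ q : ℝ × E d, γ (p.1 - q.1) * κ (p.2 - q.2) ∂slab d T = 1 := by
        rw [slab, integral_prod_mul (fun s => γ (p.1 - s)) (fun y => κ (p.2 - y)),
          integral_sub_left_eq_self (fun y => κ y), hκ1, mul_one,
          setIntegral_eq_integral_of_forall_compl_eq_zero (fun s hs => ?_),
          integral_sub_left_eq_self (fun y => γ y), hγ1]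
        refine hγδ _ ?_
        by_contra! h
        rw [abs_le] at h
        exact hs ⟨by linarith [hp.1, h.2], by linarith [hp.2, h.1]⟩
      rw [h1, one_mul]
    · simp only [hP₀, hfs _ hp, zero_mul, mul_zero]
  rw [← hJ0]
  set I : (ℝ × E d) × (ℝ × E d) → ℝ := fun π => (deriv θ π.1.1 + Λ * θ π.1.1) *
    γ (π.1.1 - π.2.1) * κ (π.1.2 - π.2.2) * max (ρ₁ π.1.1 π.1.2 - ρ₂ π.2.1 π.2.2) 0 with hI
  have hIm : Measurable I := by
    have h1 : Measurable fun π : (ℝ × E d) × (ℝ × E d) => (deriv θ π.1.1 + Λ * θ π.1.1) *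
      γ (π.1.1 - π.2.1) * κ (π.1.2 - π.2.2) := by fun_prop
    exact h1.mul (((hρ₁m.comp measurable_fst).sub (hρ₂m.comp measurable_snd)).max
      measurable_const)
  have hIJ : ∀ π, |I π - J π| ≤ cf * (γ (π.1.1 - π.2.1) * κ (π.1.2 - π.2.2) *
      |ρ₂ π.1.1 π.1.2 - ρ₂ π.2.1 π.2.2|) := fun π => by
    have e : I π - J π = f π.1.1 * (γ (π.1.1 - π.2.1) * κ (π.1.2 - π.2.2)) *
        (max (ρ₁ π.1.1 π.1.2 - ρ₂ π.2.1 π.2.2) 0 - max (ρ₁ π.1.1 π.1.2 - ρ₂ π.1.1 π.1.2) 0) := by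
      simp only [hI, hJ, hP₀, hf]; ring
    have h0 := mul_nonneg (hγ0 (π.1.1 - π.2.1)) (hκ0 (π.1.2 - π.2.2))
    rw [e, abs_mul, abs_mul, abs_of_nonneg h0, mul_assoc]
    refine mul_le_mul (hcf _) (mul_le_mul_of_nonneg_left ?_ h0)
      (mul_nonneg h0 (abs_nonneg _)) hcf0
    refine (abs_max_sub_max_le_abs _ _ _).trans (le_of_eq ?_)
    congr 1; ring
  have hIJi : Integrable (fun π => I π - J π) ((slab d T).prod (slab d T)) :=
    (iD.const_mul cf).mono' (hIm.aestronglyMeasurable.sub hJi.1) (Eventually.of_forall hIJ)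
  have hIi : Integrable I ((slab d T).prod (slab d T)) :=
    (hIJi.add hJi).congr (Eventually.of_forall fun π => by simp)
  have hle : ∫ π, I π ∂(slab d T).prod (slab d T) - ∫ π, J π ∂(slab d T).prod (slab d T)
      ≤ cf * (T * (η + C₂ * δ)) := by
    rw [← integral_sub hIi hJi]
    refine (integral_mono hIJi (iD.const_mul cf)
      fun π => (le_abs_self _).trans (hIJ π)).trans ?_
    rw [integral_const_mul]
    exact mul_le_mul_of_nonneg_left hD hcf0
  have hfin : cf * (T * (η + C₂ * δ)) ≤ ε := by
    calc cf * (T * (η + C₂ * δ)) ≤ cf * (T * (η + η)) := by gcongr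
      _ = ε * (cf * T / (cf * T + 1)) := by rw [hη]; field_simp; ring
      _ ≤ ε * 1 := by
          refine mul_le_mul_of_nonneg_left ?_ hε.le
          rw [div_le_one (by positivity)]; linarith
      _ = ε := mul_one _
  linarith

/-- Comparison for entropy solutions: the positive part of the difference grows at most at the rate
`Λ`. -/
theorem comparison_positive_part (hs₁ : EntropySolution α T F A B K M₁ C₁ ρ₀₁ ρ₁ m₁)
    (hs₂ : EntropySolution α T F A B K M₂ C₂ ρ₀₂ ρ₂ m₂) (hρ₁ : L1Continuous T ρ₁)
    (hρ₂ : L1Continuous T ρ₂) (hA : SourceBounds A g Λ) {t : ℝ} (ht : t ∈ Icc 0 T) :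
    ∫ x, max (ρ₁ t x - ρ₂ t x) 0 ≤ Real.exp (Λ * t) * ∫ x, max (ρ₀₁ x - ρ₀₂ x) 0 := by
  have hT := hs₁.time_pos
  set D : ℝ → ℝ := fun t => ∫ x, max (ρ₁ t x - ρ₂ t x) 0 with hD
  have hDi : ∀ t ∈ Icc 0 T, Integrable fun x => max (ρ₁ t x - ρ₂ t x) 0 := fun t ht =>
    ((hρ₁.integrable t ht).sub (hρ₂.integrable t ht)).pos_part
  have hDc : ContinuousOn D (Icc 0 T) := fun t ht => by
    rw [ContinuousWithinAt, tendsto_iff_norm_sub_tendsto_zero]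
    refine squeeze_zero' (Eventually.of_forall fun _ => norm_nonneg _) ?_
      (by simpa using (hρ₁.tendsto ht).add (hρ₂.tendsto ht))
    filter_upwards [self_mem_nhdsWithin] with s hs
    have i1 := ((hρ₁.integrable s hs).sub (hρ₁.integrable t ht)).abs
    have i2 := ((hρ₂.integrable s hs).sub (hρ₂.integrable t ht)).abs
    simp only [Pi.sub_apply] at i1 i2
    simp only [hD]
    rw [← integral_sub (hDi s hs) (hDi t ht), ← integral_add i1 i2]
    refine norm_integral_le_of_norm_le (i1.add i2) (Eventually.of_forall fun x => ?_)
    refine (abs_max_sub_max_le_abs _ _ _).trans ?_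
    rw [show ρ₁ s x - ρ₂ s x - (ρ₁ t x - ρ₂ t x) = (ρ₁ s x - ρ₁ t x) - (ρ₂ s x - ρ₂ t x) by ring]
    exact abs_sub _ _
  set W : ℝ → ℝ := fun t => Real.exp (-Λ * t) * D t with hW
  have hexp : Continuous fun t => Real.exp (-Λ * t) := by fun_prop
  have hWc : ContinuousOn W (Icc 0 T) := hexp.continuousOn.mul hDc
  have hWi : IntegrableOn W (Ioo 0 T) :=
    (hWc.integrableOn_compact isCompact_Icc).mono_set Ioo_subset_Icc_self
  have hWt : ∀ a ∈ Ico 0 T, Tendsto W (𝓝[>] a) (𝓝 (W a)) := fun a ha => by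
    rw [← nhdsWithin_Ioo_eq_nhdsGT ha.2]
    exact (hWc a ⟨ha.1, ha.2.le⟩).mono_left (nhdsWithin_mono _ fun s hs =>
      ⟨ha.1.trans hs.1.le, hs.2.le⟩)
  -- A difference of two time steps approximates the indicator of (a,b); its derivative recovers
  -- W(a) - W(b) in the limit.
  have hmono : ∀ a b, 0 < a → a < b → b < T → W b ≤ W a := fun a b ha hab hb => by
    have hlim := (tendsto_integral_deriv_timeStep ha.le (hab.trans hb) hWi
      (hWt a ⟨ha.le, hab.trans hb⟩)).sub
      (tendsto_integral_deriv_timeStep (ha.trans hab).le hb hWi (hWt b ⟨(ha.trans hab).le, hb⟩))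
    rw [← sub_nonneg]
    refine ge_of_tendsto hlim ?_
    obtain ⟨N, hN⟩ := exists_nat_one_div_lt (sub_pos.2 hb)
    filter_upwards [eventually_ge_atTop (N + 1)] with n hn
    have hn0 : 0 < n := by omega
    have hn' : (0 : ℝ) < n := Nat.cast_pos.2 hn0
    have hnT : b + 1 / (n : ℝ) < T := by
      have : 1 / (n : ℝ) ≤ 1 / ((N : ℝ) + 1) :=
        one_div_le_one_div_of_le (by positivity) (by exact_mod_cast hn)
      linarith
    have hpos : 0 < 1 / (n : ℝ) := by positivity
    set φ : ℝ → ℝ := fun t => timeStep a n t - timeStep b n t with hφ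
    have hφs : ContDiff ℝ ∞ φ := (contDiff_timeStep a n).sub (contDiff_timeStep b n)
    have hφ0 : ∀ t, 0 ≤ φ t := fun t => sub_nonneg.2 (Real.smoothTransition.monotone
      (mul_le_mul_of_nonneg_left (by linarith) hn'.le))
    have hφz : ∀ t, t ∉ Icc a (b + 1 / (n : ℝ)) → φ t = 0 := fun t ht => by
      rw [mem_Icc, not_and_or, not_le, not_le] at ht
      rcases ht with ht | ht
      · simp only [hφ]
        rw [timeStep_eq_zero ht.le, timeStep_eq_zero (by linarith), sub_zero]
      · simp only [hφ]
        rw [timeStep_eq_one hn0 (by linarith), timeStep_eq_one hn0 ht.le, sub_self]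
    -- The integrating factor: θ' + Λθ = e^{-Λt} φ', so the zeroth-order term is absorbed.
    set θ : ℝ → ℝ := fun t => Real.exp (-Λ * t) * φ t with hθ
    have hes : ContDiff ℝ ∞ fun t => Real.exp (-Λ * t) :=
      Real.contDiff_exp.comp (contDiff_const.mul contDiff_id)
    have hθs : ContDiff ℝ ∞ θ := hes.mul hφs
    have hθz : ∀ t, t ∉ Icc a (b + 1 / (n : ℝ)) → θ t = 0 := fun t ht => by
      simp only [hθ, hφz t ht, mul_zero]
    have h := comparison_weak hs₁ hs₂ hρ₂ hA hθs (HasCompactSupport.intro isCompact_Icc hθz)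
      (fun t => mul_nonneg (Real.exp_nonneg _) (hφ0 t)) ha (by linarith) hnT hθz
    refine h.trans_eq ?_
    have hi : ∀ c, IntegrableOn (fun t => deriv (timeStep c n) t * W t) (Ioo 0 T) := fun c =>
      ((((contDiff_timeStep c n).continuous_deriv (by simp)).continuousOn.mul
        hWc).integrableOn_compact isCompact_Icc).mono_set Ioo_subset_Icc_self
    rw [← integral_sub (hi a) (hi b)]
    refine integral_congr_ae (Eventually.of_forall fun t => ?_)
    have hd1 := ((contDiff_timeStep a n).differentiable (by simp) t).hasDerivAt
    have hd2 := ((contDiff_timeStep b n).differentiable (by simp) t).hasDerivAt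
    have hd3 : HasDerivAt (fun t => Real.exp (-Λ * t)) (Real.exp (-Λ * t) * (-Λ * 1)) t :=
      ((hasDerivAt_id t).const_mul (-Λ)).exp
    have e : deriv θ t = Real.exp (-Λ * t) * (-Λ * 1) * φ t + Real.exp (-Λ * t) *
        (deriv (timeStep a n) t - deriv (timeStep b n) t) := (hd3.mul (hd1.sub hd2)).deriv
    have e' : deriv θ t + Λ * θ t = Real.exp (-Λ * t) *
        (deriv (timeStep a n) t - deriv (timeStep b n) t) := by
      rw [e]
      simp only [hθ]
      ring
    beta_reduce
    rw [e']
    simp only [hW, hD]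
    ring
  have hW0 : ∀ b, 0 < b → b < T → W b ≤ W 0 := fun b hb hbT => by
    refine ge_of_tendsto (hWt 0 ⟨le_rfl, hT⟩) ?_
    filter_upwards [Ioo_mem_nhdsGT hb] with a ha using hmono a b ha.1 ha.2 hbT
  -- The inequality was obtained for interior times only; continuity up to both ends extends it to
  -- all of [0,T].
  have hWT : ∀ b ∈ Icc 0 T, W b ≤ W 0 := fun b hb => by
    have hcl : b ∈ closure (Ioo 0 T) := by rw [closure_Ioo hT.ne]; exact hb
    have : (𝓝[Ioo 0 T] b).NeBot := mem_closure_iff_nhdsWithin_neBot.1 hcl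
    refine le_of_tendsto ((hWc b hb).mono_left (nhdsWithin_mono _ Ioo_subset_Icc_self)) ?_
    filter_upwards [self_mem_nhdsWithin] with s hs using hW0 s hs.1 hs.2
  have hD0 : D 0 = ∫ x, max (ρ₀₁ x - ρ₀₂ x) 0 := by
    refine integral_congr_ae ?_
    filter_upwards [hs₁.initial_eq hρ₁, hs₂.initial_eq hρ₂] with x h1 h2
    rw [h1, h2]
  have h := hWT t ht
  simp only [hW, mul_zero, Real.exp_zero, one_mul, hD0] at h
  calc D t = Real.exp (Λ * t) * (Real.exp (-Λ * t) * D t) := by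
        rw [← mul_assoc, ← Real.exp_add]; simp
    _ ≤ _ := mul_le_mul_of_nonneg_left h (Real.exp_nonneg _)

end Gronwall

/-! ### The zero solution. -/

section Zero

variable {d : ℕ}

lemma totalVariation_zero : totalVariation (0 : E d → ℝ) = 0 := by
  simp [totalVariation]

/-- Needed to read nonnegativity as comparison with 0. Since χ₀ = 0 and the defect density of 0
vanishes, the choices m = 0 and g = 0 work. -/
lemma isKineticSolution_zero (α T : ℝ) (F : ℝ → E d) (A : ℝ → ℝ) (B : ℝ → ℝ) :
    IsKineticSolution α T F A B (0 : E d → ℝ) 0 := by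
  have hfrac : ∀ c : ℝ, ∀ x : E d, fracLap α (fun _ => c) x = 0 := fun c x => by simp [fracLap]
  have hn : defectMeasure (d := d) α T B 0 = 0 := by
    have : (fun p : ℝ × E d × ℝ => ENNReal.ofReal (defectDensity α B 0 p)) = 0 := by
      ext p
      simp [defectDensity, hfrac]
    rw [defectMeasure, this, withDensity_zero]
  have hchi : ∀ v, chi 0 v = 0 := fun v => by simp [chi]
  refine ⟨measurable_const, fun _ _ => integrable_zero _ _ _, fun t _ => ?_, ⟨0, ?_⟩, 0, by simp,
    fun φ _ => ?_, 0, ⟨measurable_zero, ⟨0, by simp⟩, fun ε _ => ⟨0, by simp⟩⟩, ?_⟩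
  · simp [tendsto_const_nhds]
  · refine Eventually.of_forall fun t _ => ?_
    simp only [Pi.zero_apply]
    exact totalVariation_zero.le
  · simp [hn, hchi]
  · simp [hn]

end Zero

/-! ### L¹ estimate and order preservation. -/

section Comparison

variable {d : ℕ} {T : ℝ} {F : ℝ → E d} {A B : ℝ → ℝ} {K : ℝ≥0} {α M₁ C₁ M₂ C₂ g Λ : ℝ}
  {ρ₀₁ ρ₀₂ : E d → ℝ} {ρ₁ ρ₂ : ℝ → E d → ℝ} {m₁ m₂ : Measure (ℝ × E d × ℝ)}

lemma integral_abs_sub_eq_add {p q : E d → ℝ} (hp : Integrable p) (hq : Integrable q) :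
    ∫ x, |p x - q x| = (∫ x, max (p x - q x) 0) + ∫ x, max (q x - p x) 0 := by
  have h₁ : Integrable fun x => max (p x - q x) 0 := (hp.sub hq).pos_part
  have h₂ : Integrable fun x => max (q x - p x) 0 := (hq.sub hp).pos_part
  rw [← integral_add h₁ h₂]
  refine integral_congr_ae (Eventually.of_forall fun x => ?_)
  beta_reduce
  rcases le_total (p x) (q x) with h | h
  · rw [abs_of_nonpos (by linarith), max_eq_right (by linarith), max_eq_left (by linarith)]
    ring
  · rw [abs_of_nonneg (by linarith), max_eq_left (by linarith), max_eq_right (by linarith)]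
    ring

lemma eLpNorm_one_eq_ofReal_integral_abs {p : E d → ℝ} (hp : Integrable p) :
    eLpNorm p 1 volume = ENNReal.ofReal (∫ x, |p x|) := by
  rw [integral_abs_eq_toReal_eLpNorm hp.1,
    ENNReal.ofReal_toReal (memLp_one_iff_integrable.2 hp).eLpNorm_ne_top]

/-- The positive-part estimate is applied to the pair in both orders and added, using |r| = r⁺ +
(-r)⁺. -/
lemma eLpNorm_sub_le (hs₁ : EntropySolution α T F A B K M₁ C₁ ρ₀₁ ρ₁ m₁)
    (hs₂ : EntropySolution α T F A B K M₂ C₂ ρ₀₂ ρ₂ m₂) (hρ₁ : L1Continuous T ρ₁)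
    (hρ₂ : L1Continuous T ρ₂) (hρ₀₁ : Integrable ρ₀₁) (hρ₀₂ : Integrable ρ₀₂)
    (hA : SourceBounds A g Λ) {t : ℝ} (ht : t ∈ Icc 0 T) :
    eLpNorm (ρ₁ t - ρ₂ t) 1 volume ≤
      ENNReal.ofReal (Real.exp (Λ * t)) * eLpNorm (ρ₀₁ - ρ₀₂) 1 volume := by
  have h₁ := hρ₁.integrable t ht
  have h₂ := hρ₂.integrable t ht
  rw [eLpNorm_one_eq_ofReal_integral_abs (h₁.sub h₂),
    eLpNorm_one_eq_ofReal_integral_abs (hρ₀₁.sub hρ₀₂),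
    ← ENNReal.ofReal_mul (Real.exp_nonneg _)]
  refine ENNReal.ofReal_le_ofReal ?_
  simp only [Pi.sub_apply]
  rw [integral_abs_sub_eq_add h₁ h₂, integral_abs_sub_eq_add hρ₀₁ hρ₀₂, mul_add]
  exact add_le_add (comparison_positive_part hs₁ hs₂ hρ₁ hρ₂ hA ht)
    (comparison_positive_part hs₂ hs₁ hρ₂ hρ₁ hA ht)

lemma ae_le_of_initial_ae_le (hs₁ : EntropySolution α T F A B K M₁ C₁ ρ₀₁ ρ₁ m₁)
    (hs₂ : EntropySolution α T F A B K M₂ C₂ ρ₀₂ ρ₂ m₂) (hρ₁ : L1Continuous T ρ₁)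
    (hρ₂ : L1Continuous T ρ₂) (hA : SourceBounds A g Λ) (h0 : ρ₀₁ ≤ᵐ[volume] ρ₀₂) {t : ℝ}
    (ht : t ∈ Icc 0 T) : ρ₁ t ≤ᵐ[volume] ρ₂ t := by
  have hi := ((hρ₁.integrable t ht).sub (hρ₂.integrable t ht)).pos_part
  have hz : ∫ x, max (ρ₀₁ x - ρ₀₂ x) 0 = 0 := by
    refine integral_eq_zero_of_ae ?_
    filter_upwards [h0] with x hx using max_eq_right (sub_nonpos.2 hx)
  have h := comparison_positive_part hs₁ hs₂ hρ₁ hρ₂ hA ht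
  rw [hz, mul_zero] at h
  have := (integral_eq_zero_iff_of_nonneg (fun x => le_max_right _ _) hi).1
    (h.antisymm (integral_nonneg fun x => le_max_right _ _))
  filter_upwards [this] with x hx
  exact sub_nonpos.1 ((le_max_left _ _).trans_eq hx)

end Comparison

end

end NonlocalKinetic

open NonlocalKinetic in
/-- Comparison principle for kinetic solutions of
`∂ₜρ + div F(ρ) + (-Δ)^{α/2} B(ρ) = A(ρ)`. -/
theorem corollary3p1 (d : ℕ) (hd : 0 < d) (α T M₁ M₂ : ℝ) (hα : α ∈ Ioo (0 : ℝ) 1) (hT : 0 < T)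
    (F : ℝ → E d) (A B : ℝ → ℝ)
    -- `F ∈ W^{1,∞}_loc(ℝ; ℝᵈ)`
    (hF : LocallyLipschitz F)
    -- `A(0) = 0`, `A ∈ W^{1,1}_loc(ℝ)`
    (hA0 : A 0 = 0) (hA : ∀ a b : ℝ, AbsolutelyContinuousOnInterval A a b)
    -- `B(0) = 0`, `B ∈ W^{1,∞}_loc(ℝ)`, `B' ≥ 0`, `B' ∈ L^∞(ℝ)`
    (hB0 : B 0 = 0) (hB : LocallyLipschitz B) (hB_nonneg : ∀ᵐ v : ℝ, 0 ≤ deriv B v)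
    (hB_bdd : ∃ K : ℝ, ∀ᵐ v : ℝ, |deriv B v| ≤ K)
    -- one-sided bounds on `A'`
    (hA_pos : ∀ᵐ v : ℝ, 0 < v → deriv A v ≤ M₁)
    (hA_neg : ∀ᵐ v : ℝ, v ≤ 0 → -M₂ ≤ deriv A v ∧ deriv A v ≤ M₁) :
    (∀ ρ₀₁ ρ₀₂ : E d → ℝ, MemL1BV ρ₀₁ → MemL1BV ρ₀₂ → ∀ ρ₁ ρ₂ : ℝ → E d → ℝ,
      IsKineticSolution α T F A B ρ₀₁ ρ₁ → IsKineticSolution α T F A B ρ₀₂ ρ₂ →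
        (∀ t ∈ Icc 0 T, eLpNorm (ρ₁ t - ρ₂ t) 1 volume ≤
          ENNReal.ofReal (Real.exp (M₁ * t)) * eLpNorm (ρ₀₁ - ρ₀₂) 1 volume) ∧
        (ρ₀₁ ≤ᵐ[volume] ρ₀₂ → ∀ t ∈ Icc 0 T, ρ₁ t ≤ᵐ[volume] ρ₂ t)) ∧
    (∀ ρ₀ : E d → ℝ, MemL1BV ρ₀ → 0 ≤ᵐ[volume] ρ₀ → ∀ ρ : ℝ → E d → ℝ,
      IsKineticSolution α T F A B ρ₀ ρ → ∀ t ∈ Icc 0 T, 0 ≤ᵐ[volume] ρ t) := by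
  obtain ⟨K, hc⟩ := exists_coefficientBounds hF hA0 hA hB0 hB hB_nonneg hB_bdd
  have hS := exists_sourceBounds hA0 hA hA_pos hA_neg
  have hle : ∀ ρ₀₁ ρ₀₂ : E d → ℝ, MemL1BV ρ₀₁ → MemL1BV ρ₀₂ → ∀ ρ₁ ρ₂ : ℝ → E d → ℝ,
      IsKineticSolution α T F A B ρ₀₁ ρ₁ → IsKineticSolution α T F A B ρ₀₂ ρ₂ →
        (∀ t ∈ Icc 0 T, eLpNorm (ρ₁ t - ρ₂ t) 1 volume ≤
          ENNReal.ofReal (Real.exp (M₁ * t)) * eLpNorm (ρ₀₁ - ρ₀₂) 1 volume) ∧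
        (ρ₀₁ ≤ᵐ[volume] ρ₀₂ → ∀ t ∈ Icc 0 T, ρ₁ t ≤ᵐ[volume] ρ₂ t) := by
    intro ρ₀₁ ρ₀₂ h₀₁ h₀₂ ρ₁ ρ₂ h₁ h₂
    obtain ⟨hρ₁, _, _, _, hs₁⟩ := h₁.exists_entropySolution hd hT hα hc h₀₁.1
    obtain ⟨hρ₂, _, _, _, hs₂⟩ := h₂.exists_entropySolution hd hT hα hc h₀₂.1
    exact ⟨fun t ht => eLpNorm_sub_le hs₁ hs₂ hρ₁ hρ₂ h₀₁.1 h₀₂.1 hS ht,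
      fun h0 t ht => ae_le_of_initial_ae_le hs₁ hs₂ hρ₁ hρ₂ hS h0 ht⟩
  refine ⟨hle, fun ρ₀ h₀ h0 ρ h t ht => ?_⟩
  exact (hle 0 ρ₀ ⟨integrable_zero _ _ _, by simp [totalVariation_zero]⟩ h₀ 0 ρ
    (isKineticSolution_zero α T F A B) h).2 h0 t ht
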